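/- **Setting.** Let $f=\frac1N\sum_{i=1}^N f_i$ on $\mathbb R^d$ with $f_i(x)=\mathbb E_{\xi\sim\mathcal D_i}[F_i(x;\xi)]$, where $F_i$ is measurable, differentiable in $x$, and integrable in $\xi$. Assume $f(x_0)-\inf f\le\Delta$, each $f_i$ is differentiable with $L$-Lipschitz gradient, and $\mathbb E_{\xi\sim\mathcal D_i}\|\nabla F_i(x;\xi)-\nabla f_i(x)\|^2\le\sigma^2$ for all $x$ and $i$ ($\Delta,L,\sigma\ge0$). Let $P\ge1$ divide the number of rounds $R$. For $0\le r<R$ the participation weights $q_r^i$ ($i=1,\dots,N$) are random variables with $q_r^i\ge0$, $\sum_i q_r^i=1$ and $\sum_i(q_r^i)^2\le\rho^2$ almost surely. For $r_0\in\{0,P,\dots,R-P\}$ put $\bar q_{r_0}^i=\frac1P\sum_{r=r_0}^{r_0+P-1}q_r^i$, and let $\mathcal Q_{:r_0}$ be the $\sigma$-algebra generated by the weights of the rounds before $r_0$. Participation is *regularized* if $\bar q_{r_0}^i=\frac1N$ almost surely for all such $r_0$ and all $i$. **Algorithm (Amplified SCAFFOLD, step sizes $\eta,\gamma>0$, $I\ge1$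 local steps).** $\bar x_0=x_0$, and $G_0^i$ is the average of $B\ge1$ stochastic gradients of client $i$ at $x_0$. In round $r$ of the window $r_0\le r<r_0+P$: $x_{r,0}^i=\bar x_r$ and, for $0\le k<I$, $x_{r,k+1}^i=x_{r,k}^i-\eta\,(\nabla F_i(x_{r,k}^i;\xi_{r,k}^i)-G_{r_0}^i+G_{r_0})$, with $G_{r_0}=\frac1N\sum_iG_{r_0}^i$. If $r+1<r_0+P$, then $\bar x_{r+1}=\bar x_r+\sum_iq_r^i(x_{r,I}^i-\bar x_r)$. At the end of the window, $\bar x_{r_0+P}=\bar x_{r_0}+\gamma\sum_{r=r_0}^{r_0+P-1}\sum_iq_r^i(x_{r,I}^i-\bar x_r)$, and $G_{r_0+P}^i=\frac1{P\bar q_{r_0}^iI}\sum_{r=r_0}^{r_0+P-1}q_r^i\sum_{k=0}^{I-1}\nabla F_i(x_{r,k}^i;\xi_{r,k}^i)$ if $\bar q_{r_0}^i>0$, and $G_{r_0+P}^i=G_{r_0}^i$ otherwise. The samples of client $i$ (including those that initialize $G_0^i$) have law $\mathcal D_i$; all samples are mutually independent and jointly independent of the weights. The output is $\hat x=\bar x_{mP}$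 with $m$ uniform on $\{0,\dots,R/P-1\}$ and independent of everything else. **Claim 1.** Under regularized participation, for all $r_0\in\{0,P,\dots,R-P\}$ and all $i$: $\mathbb E[\bar q_{r_0}^i\mid\mathcal Q_{:r_0}]=\frac1N$ a.s. and $\mathbb P(\bar q_{r_0}^i>0\mid\mathcal Q_{:r_0})\ge p_{\rm sample}=1$ a.s., and the following two conditions hold: $$\text{(1)}\quad \mathbb E[w_{r_0}^i]\le\frac{P^2}{N}\ \text{ and also }\ \mathbb E[w_{r_0}^i\mid\mathcal Q_{:r_0}]\le\frac{P^2}N\text{ a.s.},\qquad \text{(2)}\quad \mathbb E\Big[\sum_{i=1}^N(v_{r_0}^i)^2\Lambda_{r_0}^i\Big]\le\rho^2 .$$ Here $w_{r_0}^i=\frac1N\sum_{j=1}^N\frac{\mathbf 1\{\bar q_{r_0}^j>0\}}{P\bar q_{r_0}^j}\sum_{s=r_0}^{r_0+P-1}q_s^iq_s^j$, $v_{r_0}^i=\bar q_{r_0}^i-\frac1N$ and $\Lambda_{r_0}^i=\big(\frac1P\sum_{s=r_0-P}^{r_0-1}(z_s^i)^2\big)\big/\big(\frac1P\sum_{s=r_0-P}^{r_0-1}z_s^i\big)^2$,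 where, for $s$ in a window starting at $r_1$, $z_s^i=q_s^i$ if $\bar q_{r_1}^i>0$ and $z_s^i=z_{s-P}^i$ otherwise, with $z_s^i=q_0^i$ for $-P\le s<0$. **Claim 2.** There is a universal constant $C$ such that for all $P\ge1$, $\Delta,L,\sigma,\rho\ge0$ and $\epsilon>0$ there are $\eta,\gamma>0$, $I\ge1$ and a positive multiple $R$ of $P$, depending only on $(P,\Delta,L,\sigma,\rho,\epsilon)$, with $$R\le C\,P\max\Big\{1,\frac{\Delta L}{\epsilon^2}\Big\},\qquad RI\le C\,P\max\Big\{1,\frac{\Delta L}{\epsilon^2}\Big\}\max\Big\{1,\frac{\rho^2\sigma^2}{P\epsilon^2}\Big\},$$ such that, for every problem and every regularized participation process as above, Amplified SCAFFOLD satisfies $\mathbb E[\|\nabla f(\hat x)\|^2]\le C\epsilon^2$. In particular, $$R\le C\,\frac{\Delta LP}{\epsilon^2}\ \text{ if }\epsilon^2\le\Delta L,\qquad RI\le C\,\frac{\Delta L\rho^2\sigma^2}{\epsilon^4}\ \text{ if moreover }P\epsilon^2\le\rho^2\sigma^2 .$$ -/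

import Mathlib

open MeasureTheory ProbabilityTheory Finset

namespace AmpScaffold

noncomputable section

/-- The model space `ℝ^d` with the Euclidean norm. -/
abbrev Vec (d : ℕ) : Type := EuclideanSpace ℝ (Fin d)

/-! ### The optimization problem -/

/-- The local objective `f_i(x) = E_{ξ ∼ D_i} F_i(x; ξ)`. -/
def localObj {N d : ℕ} {Ξ : Type*} [MeasurableSpace Ξ] (F : Fin N → Vec d → Ξ → ℝ)
    (D : Fin N → Measure Ξ) (i : Fin N) (x : Vec d) : ℝ :=
  ∫ ξ, F i x ξ ∂(D i)

/-- The global objective `f = (1/N) ∑_i f_i`. -/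
def globalObj {N d : ℕ} {Ξ : Type*} [MeasurableSpace Ξ] (F : Fin N → Vec d → Ξ → ℝ)
    (D : Fin N → Measure Ξ) (x : Vec d) : ℝ :=
  (1 / (N : ℝ)) * ∑ i, localObj F D i x

/-- The stochastic gradient `∇F_i(x; ξ)` (gradient with respect to `x`). -/
def stochGrad {N d : ℕ} {Ξ : Type*} (F : Fin N → Vec d → Ξ → ℝ) (i : Fin N) (ξ : Ξ)
    (x : Vec d) : Vec d :=
  gradient (fun y => F i y ξ) x

/-- Assumptions on the objectives: the losses are measurable, differentiable in `x` and have
finite expectation; `f x₀ - inf f ≤ Δ`; each `f_i` is `L`-smooth; the stochastic gradients have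
variance at most `σ²`. -/
structure ObjectiveAssumption {N d : ℕ} {Ξ : Type*} [MeasurableSpace Ξ]
    (F : Fin N → Vec d → Ξ → ℝ) (D : Fin N → Measure Ξ) (x₀ : Vec d) (Δ L σ : ℝ) : Prop where
  measurable : ∀ i, Measurable (fun p : Vec d × Ξ => F i p.1 p.2)
  differentiable : ∀ i ξ, Differentiable ℝ (fun x => F i x ξ)
  integrable : ∀ i x, Integrable (F i x) (D i)
  gap : ∀ x, globalObj F D x₀ - globalObj F D x ≤ Δ
  smooth_differentiable : ∀ i, Differentiable ℝ (localObj F D i)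
  smooth : ∀ i x y,
    ‖gradient (localObj F D i) x - gradient (localObj F D i) y‖ ≤ L * ‖x - y‖
  variance : ∀ i x,
    ∫⁻ ξ, ‖stochGrad F i ξ x - gradient (localObj F D i) x‖ₑ ^ 2 ∂(D i) ≤ ENNReal.ofReal (σ ^ 2)

/-! ### Participation -/

/-- The participation of client `i` averaged over the window of `P` rounds that starts at round
`r₀`, for one realization `q` of the weights. -/
def qBar {N : ℕ} (P : ℕ) (q : ℕ → Fin N → ℝ) (r₀ : ℕ) (i : Fin N) : ℝ :=
  (1 / (P : ℝ)) * ∑ j ∈ range P, q (r₀ + j) i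

/-- The weights of rounds `0, …, R - 1` are random variables; in each round they are nonnegative,
sum to one, and their squares sum to at most `ρ²`. -/
structure WeightAssumption {Ω : Type*} [MeasurableSpace Ω] (μ : Measure Ω) {N : ℕ} (R : ℕ)
    (ρ : ℝ) (q : Ω → ℕ → Fin N → ℝ) : Prop where
  measurable : ∀ r < R, ∀ i, Measurable (fun ω => q ω r i)
  nonneg : ∀ r < R, ∀ i, ∀ᵐ ω ∂μ, 0 ≤ q ω r i
  sum_eq_one : ∀ r < R, ∀ᵐ ω ∂μ, ∑ i, q ω r i = 1
  sum_sq_le : ∀ r < R, ∀ᵐ ω ∂μ, ∑ i, (q ω r i) ^ 2 ≤ ρ ^ 2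

/-- Regularized participation: over every window `mP, …, (m+1)P - 1` with `m < R/P`, the averaged
weight of each client is almost surely `1/N`. -/
def IsRegularized {Ω : Type*} [MeasurableSpace Ω] (μ : Measure Ω) {N : ℕ} (P R : ℕ)
    (q : Ω → ℕ → Fin N → ℝ) : Prop :=
  ∀ m < R / P, ∀ i : Fin N, ∀ᵐ ω ∂μ, qBar P (q ω) (m * P) i = 1 / (N : ℝ)

/-- The σ-algebra generated by the weights of the rounds before `r₀`. -/
@[reducible] def pastWeights {Ω : Type*} {N : ℕ} (q : Ω → ℕ → Fin N → ℝ) (r₀ : ℕ) : MeasurableSpace Ω :=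
  MeasurableSpace.comap (fun ω (r : Fin r₀) (i : Fin N) => q ω r i) inferInstance

/-- Every window is unbiased across clients: given the weights before the window, the
expected averaged weight of each client is `1/N`. -/
def UnbiasedParticipation {Ω : Type*} [MeasurableSpace Ω] (μ : Measure Ω) {N : ℕ} (P R : ℕ)
    (q : Ω → ℕ → Fin N → ℝ) : Prop :=
  ∀ m < R / P, ∀ i : Fin N,
    μ[fun ω => qBar P (q ω) (m * P) i | pastWeights q (m * P)] =ᵐ[μ] fun _ => 1 / (N : ℝ)

/-- Given the weights before a window, each client is sampled in that window with
(conditional) probability at least `p`. -/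
def SampledWithProb {Ω : Type*} [MeasurableSpace Ω] (μ : Measure Ω) {N : ℕ} (P R : ℕ)
    (q : Ω → ℕ → Fin N → ℝ) (p : ℝ) : Prop :=
  ∀ m < R / P, ∀ i : Fin N, ∀ᵐ ω ∂μ,
    p ≤ (μ[Set.indicator {ω' | 0 < qBar P (q ω') (m * P) i} (fun _ => (1 : ℝ)) |
      pastWeights q (m * P)]) ω

open Classical in
/-- `w^i_{r₀} = (1/N) ∑_j (1{q̄^j > 0} / (P q̄^j)) ∑_{s = r₀}^{r₀ + P - 1} q_s^i q_s^j`. -/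
def wCoeff {N : ℕ} (P : ℕ) (q : ℕ → Fin N → ℝ) (r₀ : ℕ) (i : Fin N) : ℝ :=
  (1 / (N : ℝ)) * ∑ j : Fin N,
    ((if 0 < qBar P q r₀ j then 1 else 0) / ((P : ℝ) * qBar P q r₀ j)) *
      ∑ s ∈ range P, q (r₀ + s) i * q (r₀ + s) j

/-- `v^i_{r₀} = q̄^i_{r₀} - 1/N`. -/
def vCoeff {N : ℕ} (P : ℕ) (q : ℕ → Fin N → ℝ) (r₀ : ℕ) (i : Fin N) : ℝ :=
  qBar P q r₀ i - 1 / (N : ℝ)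

open Classical in
/-- `zPrev P q i m j` is `z^i_s` for `s = (m - 1) P + j`, `0 ≤ j < P`: the weight of client `i` in
the `j`-th round of the most recent window before round `mP` in which that client was sampled;
`z^i_s = q^i_0` for `-P ≤ s < 0`. -/
def zPrev {N : ℕ} (P : ℕ) (q : ℕ → Fin N → ℝ) (i : Fin N) : ℕ → ℕ → ℝ
  | 0, _ => q 0 i
  | m + 1, j => if 0 < qBar P q (m * P) i then q (m * P + j) i else zPrev P q i m j

/-- `Λ^i_{r₀}` at `r₀ = mP`: the mean over `s = r₀ - P, …, r₀ - 1` of `(z^i_s)²`, divided by the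
square of the mean of `z^i_s`. -/
def lambdaCoeff {N : ℕ} (P : ℕ) (q : ℕ → Fin N → ℝ) (m : ℕ) (i : Fin N) : ℝ :=
  ((1 / (P : ℝ)) * ∑ j ∈ range P, (zPrev P q i m j) ^ 2) /
    ((1 / (P : ℝ)) * ∑ j ∈ range P, zPrev P q i m j) ^ 2

/-- The first regularity condition, `E[w^i_{r₀}] ≤ P²/N`, both in this form and conditionally on
the weights before the window. -/
def WCondition {Ω : Type*} [MeasurableSpace Ω] (μ : Measure Ω) {N : ℕ} (P R : ℕ)
    (q : Ω → ℕ → Fin N → ℝ) : Prop :=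
  ∀ m < R / P, ∀ i : Fin N,
    Integrable (fun ω => wCoeff P (q ω) (m * P) i) μ ∧
    ∫ ω, wCoeff P (q ω) (m * P) i ∂μ ≤ (P : ℝ) ^ 2 / N ∧
    ∀ᵐ ω ∂μ, (μ[fun ω' => wCoeff P (q ω') (m * P) i | pastWeights q (m * P)]) ω ≤ (P : ℝ) ^ 2 / N

/-- The second regularity condition, `E[∑_i (v^i_{r₀})² Λ^i_{r₀}] ≤ ρ²`. -/
def VCondition {Ω : Type*} [MeasurableSpace Ω] (μ : Measure Ω) {N : ℕ} (P R : ℕ) (ρ : ℝ)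
    (q : Ω → ℕ → Fin N → ℝ) : Prop :=
  ∀ m < R / P,
    Integrable (fun ω => ∑ i, (vCoeff P (q ω) (m * P) i) ^ 2 * lambdaCoeff P (q ω) m i) μ ∧
    ∫ ω, ∑ i, (vCoeff P (q ω) (m * P) i) ^ 2 * lambdaCoeff P (q ω) m i ∂μ ≤ ρ ^ 2

/-! ### Data samples -/

/-- All data samples used by the algorithm: `ξ₀ ω b i` (`b < B`) are those that initialize the
control variate of client `i`, and `ξ ω r k i` is the one of round `r`, local step `k`. -/
def sample {Ω Ξ : Type*} {N : ℕ} (B R I : ℕ) (ξ₀ : Ω → ℕ → Fin N → Ξ)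
    (ξ : Ω → ℕ → ℕ → Fin N → Ξ) :
    (Fin B × Fin N) ⊕ (Fin R × Fin I × Fin N) → Ω → Ξ
  | Sum.inl s, ω => ξ₀ ω s.1 s.2
  | Sum.inr s, ω => ξ ω s.1 s.2.1 s.2.2

/-- The samples of client `i` have law `D_i`, all samples are mutually independent, and they are
independent of the participation weights. -/
structure SampleAssumption {Ω Ξ : Type*} [MeasurableSpace Ω] [MeasurableSpace Ξ] (μ : Measure Ω)
    {N : ℕ} (B R I : ℕ) (D : Fin N → Measure Ξ) (q : Ω → ℕ → Fin N → ℝ)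
    (ξ₀ : Ω → ℕ → Fin N → Ξ) (ξ : Ω → ℕ → ℕ → Fin N → Ξ) : Prop where
  law_init : ∀ b < B, ∀ i, MeasurePreserving (fun ω => ξ₀ ω b i) μ (D i)
  law : ∀ r < R, ∀ k < I, ∀ i, MeasurePreserving (fun ω => ξ ω r k i) μ (D i)
  indep : iIndepFun (sample B R I ξ₀ ξ) μ
  indep_weights : IndepFun (fun ω (r : Fin R) (i : Fin N) => q ω r i)
    (fun ω s => sample B R I ξ₀ ξ s ω) μ

/-! ### Amplified SCAFFOLD

One realization of the algorithm. The argument `g i r k x` is the stochastic gradient that client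
`i` computes at the point `x` in local step `k` of round `r`. -/

/-- The local iterates `x^i_{r,0} = x`, `x^i_{r,k+1} = x^i_{r,k} - η (∇F_i(x^i_{r,k}; ξ^i_{r,k}) -
G^i + G)` of one client in one round, where `h k` is its stochastic gradient in step `k`. -/
def localIter {d : ℕ} (η : ℝ) (h : ℕ → Vec d → Vec d) (Gi G x : Vec d) : ℕ → Vec d
  | 0 => x
  | k + 1 => localIter η h Gi G x k - η • (h k (localIter η h Gi G x k) - Gi + G)

/-- The server's variables at the start of a window: the global model and the clients' control
variates. -/
structure ServerState (N d : ℕ) where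
  model : Vec d
  control : Fin N → Vec d

/-- The averaged control variate `G = (1/N) ∑_i G^i`. -/
def ServerState.avgControl {N d : ℕ} (S : ServerState N d) : Vec d :=
  (1 / (N : ℝ)) • ∑ i, S.control i

/-- The local iterates of client `i` in round `r`, starting from the model `x`, in a window which
started in state `S`. -/
def clientIter {N d : ℕ} (η : ℝ) (g : Fin N → ℕ → ℕ → Vec d → Vec d) (S : ServerState N d)
    (r : ℕ) (i : Fin N) (x : Vec d) (k : ℕ) : Vec d :=
  localIter η (g i r) (S.control i) S.avgControl x k

/-- The weighted average of the local updates in round `r`, when the round starts at `x`. -/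
def roundUpdate {N d : ℕ} (η : ℝ) (I : ℕ) (g : Fin N → ℕ → ℕ → Vec d → Vec d)
    (q : ℕ → Fin N → ℝ) (S : ServerState N d) (r : ℕ) (x : Vec d) : Vec d :=
  ∑ i, q r i • (clientIter η g S r i x I - x)

/-- The global model at the start of the `j`-th round (`0 ≤ j < P`) of the window that starts at
round `r₀` in state `S`. -/
def windowModel {N d : ℕ} (η : ℝ) (I : ℕ) (g : Fin N → ℕ → ℕ → Vec d → Vec d)
    (q : ℕ → Fin N → ℝ) (S : ServerState N d) (r₀ : ℕ) : ℕ → Vec d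
  | 0 => S.model
  | j + 1 => windowModel η I g q S r₀ j +
      roundUpdate η I g q S (r₀ + j) (windowModel η I g q S r₀ j)

open Classical in
/-- One window of `P` rounds. The updates of its rounds are accumulated and applied, amplified by
`γ`, to the model at the start of the window. The control variate of a client that was sampled in
the window becomes the weighted average of its stochastic gradients in the window; otherwise
it is kept. -/
def windowStep {N d : ℕ} (η γ : ℝ) (P I : ℕ) (g : Fin N → ℕ → ℕ → Vec d → Vec d)
    (q : ℕ → Fin N → ℝ) (r₀ : ℕ) (S : ServerState N d) : ServerState N d where
  model := S.model + γ • ∑ j ∈ range P,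
    roundUpdate η I g q S (r₀ + j) (windowModel η I g q S r₀ j)
  control i :=
    if 0 < qBar P q r₀ i then
      (1 / ((P : ℝ) * qBar P q r₀ i * (I : ℝ))) • ∑ j ∈ range P, q (r₀ + j) i •
        ∑ k ∈ range I, g i (r₀ + j) k
          (clientIter η g S (r₀ + j) i (windowModel η I g q S r₀ j) k)
    else S.control i

/-- The server's variables at round `mP`. -/
def serverState {N d : ℕ} (η γ : ℝ) (P I : ℕ) (g : Fin N → ℕ → ℕ → Vec d → Vec d)
    (q : ℕ → Fin N → ℝ) (S₀ : ServerState N d) : ℕ → ServerState N d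
  | 0 => S₀
  | m + 1 => windowStep η γ P I g q (m * P) (serverState η γ P I g q S₀ m)

/-- Initially the model is `x₀` and `G^i_0` is the average of `B` stochastic gradients of client `i`
at `x₀`. -/
def initState {N d : ℕ} {Ξ : Type*} (F : Fin N → Vec d → Ξ → ℝ) (x₀ : Vec d) (B : ℕ)
    (ξ₀ : ℕ → Fin N → Ξ) : ServerState N d where
  model := x₀
  control i := (1 / (B : ℝ)) • ∑ b ∈ range B, stochGrad F i (ξ₀ b i) x₀

/-- The random iterate `x̄_{mP}` of Amplified SCAFFOLD. -/
def ampScaffold {Ω Ξ : Type*} {N d : ℕ} (F : Fin N → Vec d → Ξ → ℝ) (x₀ : Vec d)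
    (η γ : ℝ) (P I B : ℕ) (q : Ω → ℕ → Fin N → ℝ) (ξ₀ : Ω → ℕ → Fin N → Ξ)
    (ξ : Ω → ℕ → ℕ → Fin N → Ξ) (m : ℕ) (ω : Ω) : Vec d :=
  (serverState η γ P I (fun i r k => stochGrad F i (ξ ω r k i)) (q ω)
    (initState F x₀ B (ξ₀ ω)) m).model

/-- `E ‖∇f(x̂)‖² ≤ b`, where `x̂ = x̄_{mP}` and `m` is uniform on `{0, …, R/P - 1}` and independent
of everything else. -/
def OutputBound {Ω Ξ : Type*} [MeasurableSpace Ω] [MeasurableSpace Ξ] (μ : Measure Ω) {N d : ℕ}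
    (F : Fin N → Vec d → Ξ → ℝ) (D : Fin N → Measure Ξ) (x₀ : Vec d)
    (η γ : ℝ) (P R I B : ℕ) (q : Ω → ℕ → Fin N → ℝ) (ξ₀ : Ω → ℕ → Fin N → Ξ)
    (ξ : Ω → ℕ → ℕ → Fin N → Ξ) (b : ℝ) : Prop :=
  Integrable (fun p : Ω × ℕ =>
      ‖gradient (globalObj F D) (ampScaffold F x₀ η γ P I B q ξ₀ ξ p.2 p.1)‖ ^ 2)
    (μ.prod (uniformOn (Set.Iio (R / P)))) ∧
  ∫ p : Ω × ℕ, ‖gradient (globalObj F D) (ampScaffold F x₀ η γ P I B q ξ₀ ξ p.2 p.1)‖ ^ 2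
    ∂(μ.prod (uniformOn (Set.Iio (R / P)))) ≤ b

end

end AmpScaffold

/-!
Under regularized participation all clients have the same total weight in a window, so the
corrections `G - Gⁱ` cancel: the window moves the model by `-γ η P I` times a weighted mean of its
stochastic gradients. With `γ η P I = 1 / (24 L)` this is a descent step for `f` up to the noise of
the mean, whose variance is at most `ρ² σ² / (P I)`, and the drift of the local iterates away from
the model at the start of the window. The drift is at most of order `(η P I)²` times the sum of
`σ²`, the control error `∑ᵢ ‖Gⁱ - ∇fᵢ‖² / N` and `‖∇f‖²`; the control error at the end of a
window is in turn bounded by the noise, the drift and the step length of that window. For small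
`η P I L` the three recursions close when they are summed over all windows.

The weights are independent of the samples, so it suffices to do this for fixed weights and samples
that are the coordinates of a product space. A stochastic gradient is unbiased given the past
because its own sample can be redrawn without changing the iterate at which it is computed.
-/

namespace AmpScaffold

open scoped InnerProductSpace Topology ENNReal

noncomputable section

/-! ### Square-integrable functions -/

section UniformIntegrability

variable {α ι V : Type*} [MeasurableSpace α] {μ : Measure α} [NormedAddCommGroup V]

theorem unifIntegrable_of_eLpNorm_le {p q : ℝ≥0∞} (hp : p ≠ 0) (hpq : p < q) {f : ι → α → V}
    (hf : ∀ i, AEStronglyMeasurable (f i) μ) {K : ℝ≥0∞} (hK : K ≠ ∞)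
    (hfK : ∀ i, eLpNorm (f i) q μ ≤ K) : UnifIntegrable f p μ := by
  intro ε hε
  set a : ℝ := 1 / p.toReal - 1 / q.toReal
  have ha : 0 < a := by
    have hp0 : 0 < p.toReal := ENNReal.toReal_pos hp hpq.ne_top
    rcases eq_or_ne q ∞ with rfl | hq
    · simpa [a] using hp0
    · exact sub_pos.2 (one_div_lt_one_div_of_lt hp0 (ENNReal.toReal_strict_mono hq hpq))
  have hlim : Filter.Tendsto (fun δ => K * δ ^ a) (𝓝 0) (𝓝 0) := by
    simpa [ENNReal.zero_rpow_of_pos ha] using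
      ENNReal.Tendsto.const_mul ((ENNReal.continuous_rpow_const (y := a)).tendsto 0) (Or.inr hK)
  obtain ⟨δ, hδ, hδε⟩ := (ENNReal.nhds_zero_basis_Iic.tendsto_iff
    ENNReal.nhds_zero_basis_Iic).1 hlim _ (ENNReal.ofReal_pos.2 hε)
  obtain ⟨r, -, hr, hrδ⟩ := ENNReal.lt_iff_exists_real_btwn.1 hδ
  refine ⟨r, ENNReal.ofReal_pos.1 hr, fun i s hs hμs => ?_⟩
  calc eLpNorm (s.indicator (f i)) p μ
      = eLpNorm (f i) p (μ.restrict s) := eLpNorm_indicator_eq_eLpNorm_restrict hs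
    _ ≤ eLpNorm (f i) q (μ.restrict s) * (μ.restrict s) Set.univ ^ a :=
        eLpNorm_le_eLpNorm_mul_rpow_measure_univ hpq.le (hf i).restrict
    _ ≤ K * μ s ^ a := by
        rw [Measure.restrict_apply_univ]
        gcongr
        exact (eLpNorm_restrict_le _ _ _ _).trans (hfK i)
    _ ≤ ENNReal.ofReal ε := hδε _ (hμs.trans hrδ.le)

theorem tendsto_integral_of_eLpNorm_le [NormedSpace ℝ V] [IsFiniteMeasure μ] {q : ℝ≥0∞}
    (hq : 1 < q) {f : ℕ → α → V} {g : α → V} (hf : ∀ n, AEStronglyMeasurable (f n) μ)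
    {K : ℝ≥0∞} (hK : K ≠ ∞) (hfK : ∀ n, eLpNorm (f n) q μ ≤ K)
    (hfg : ∀ᵐ a ∂μ, Filter.Tendsto (fun n => f n a) Filter.atTop (𝓝 (g a))) :
    Filter.Tendsto (fun n => ∫ a, f n a ∂μ) Filter.atTop (𝓝 (∫ a, g a ∂μ)) := by
  have hunif := unifIntegrable_of_eLpNorm_le one_ne_zero hq hf hK hfK
  have hf1 : ∀ n, eLpNorm (f n) 1 μ ≤
      K * μ Set.univ ^ (1 / (1 : ℝ≥0∞).toReal - 1 / q.toReal) := fun n =>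
    (eLpNorm_le_eLpNorm_mul_rpow_measure_univ hq.le (hf n)).trans (by gcongr; exact hfK n)
  have hfin : K * μ Set.univ ^ (1 / (1 : ℝ≥0∞).toReal - 1 / q.toReal) ≠ ∞ := by
    refine ENNReal.mul_ne_top hK (ENNReal.rpow_ne_top_of_nonneg ?_ (measure_ne_top μ _))
    rcases eq_or_ne q ∞ with rfl | hq'
    · simp
    · have : 1 ≤ q.toReal := by simpa using ENNReal.toReal_mono hq' hq.le
      simpa using inv_le_one_of_one_le₀ this
  have hg : MemLp g 1 μ := UniformIntegrable.memLp_of_ae_tendsto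
    ⟨hf, hunif, _, fun n => (hf1 n).trans (ENNReal.coe_toNNReal hfin).ge⟩ hfg
  exact tendsto_integral_of_L1' g (memLp_one_iff_integrable.1 hg).aestronglyMeasurable
    (Filter.Eventually.of_forall fun n =>
      memLp_one_iff_integrable.1 ⟨hf n, (hf1 n).trans_lt hfin.lt_top⟩)
    (tendsto_Lp_finite_of_tendsto_ae le_rfl ENNReal.one_ne_top hf hg hunif hfg)

theorem eLpNorm_two_sq (f : α → V) : eLpNorm f 2 μ ^ 2 = ∫⁻ a, ‖f a‖ₑ ^ 2 ∂μ := by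
  have h := eLpNorm_nnreal_pow_eq_lintegral (μ := μ) (f := f) (p := 2) (by norm_num)
  simpa using h

theorem memLp_two_iff_lintegral_lt_top {f : α → V} (hf : AEStronglyMeasurable f μ) :
    MemLp f 2 μ ↔ ∫⁻ a, ‖f a‖ₑ ^ 2 ∂μ < ∞ := by
  rw [← eLpNorm_two_sq, MemLp, and_iff_right hf]
  simp [lt_top_iff_ne_top]

theorem memLp_two_of_lintegral_sub_lt_top [IsFiniteMeasure μ] {f : α → V}
    (hf : AEStronglyMeasurable f μ) {c : V} (h : ∫⁻ a, ‖f a - c‖ₑ ^ 2 ∂μ < ∞) :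
    MemLp f 2 μ := by
  have hsub : MemLp (fun a => f a - c) 2 μ :=
    (memLp_two_iff_lintegral_lt_top (hf.sub aestronglyMeasurable_const)).2 h
  simpa [Pi.add_def] using hsub.add (memLp_const c)

end UniformIntegrability

/-! ### Gradients of smooth functions and of expectations -/

section Gradient

variable {E Ξ : Type*} [NormedAddCommGroup E] [InnerProductSpace ℝ E]

theorem abs_sub_sub_inner_gradient_le [CompleteSpace E] {f : E → ℝ} {L : ℝ}
    (hf : Differentiable ℝ f)
    (hL : ∀ x y, ‖gradient f x - gradient f y‖ ≤ L * ‖x - y‖) (hL0 : 0 ≤ L) (x y : E) :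
    |f y - f x - ⟪gradient f x, y - x⟫_ℝ| ≤ L * ‖y - x‖ ^ 2 := by
  have h := (convex_closedBall x ‖y - x‖).norm_image_sub_le_of_norm_hasFDerivWithin_le'
    (f := f) (f' := fun z => fderiv ℝ f z) (φ := fderiv ℝ f x) (C := L * ‖y - x‖)
    (fun z _ => (hf z).hasFDerivAt.hasFDerivWithinAt) (x := x) (y := y) ?_
    (by simp) (by simp [dist_eq_norm])
  · have h2 : ⟪gradient f x, y - x⟫_ℝ = fderiv ℝ f x (y - x) := inner_gradient_left ..
    rw [h2, ← Real.norm_eq_abs]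
    exact h.trans_eq (by ring)
  · intro z hz
    rw [← toDual_gradient, ← toDual_gradient, ← map_sub, LinearIsometryEquiv.norm_map]
    refine (hL z x).trans ?_
    rw [Metric.mem_closedBall, dist_eq_norm] at hz
    gcongr

theorem tendsto_mul_sub_inner_gradient [CompleteSpace E] {f : E → ℝ} {x : E}
    (hf : DifferentiableAt ℝ f x) (v : E) :
    Filter.Tendsto (fun n : ℕ => ((n : ℝ) + 1) * (f (x + ((n : ℝ) + 1)⁻¹ • v) - f x)) Filter.atTop
      (𝓝 ⟪gradient f x, v⟫_ℝ) := by
  rw [inner_gradient_left]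
  refine hf.hasFDerivAt.lim v (c := fun n : ℕ => (n : ℝ) + 1) ?_
  refine Filter.tendsto_atTop_mono (fun n => ?_) (tendsto_natCast_atTop_atTop (R := ℝ))
  rw [Real.norm_of_nonneg (by positivity)]
  linarith

theorem enorm_sub_sq_le_lintegral_deriv {φ : ℝ → ℝ} (hφ : Differentiable ℝ φ) :
    ‖φ 1 - φ 0‖ₑ ^ 2 ≤ ∫⁻ s in Set.Ioc 0 1, ‖deriv φ s‖ₑ ^ 2 := by
  have hm : AEStronglyMeasurable (deriv φ) (volume.restrict (Set.Ioc (0 : ℝ) 1)) :=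
    (measurable_deriv φ).aestronglyMeasurable
  have : IsProbabilityMeasure (volume.restrict (Set.Ioc (0 : ℝ) 1)) := ⟨by simp⟩
  rcases eq_or_ne (∫⁻ s in Set.Ioc (0 : ℝ) 1, ‖deriv φ s‖ₑ ^ 2) ∞ with h | h
  · simp [h]
  · have hint : Integrable (deriv φ) (volume.restrict (Set.Ioc (0 : ℝ) 1)) :=
      ((memLp_two_iff_lintegral_lt_top hm).2 h.lt_top).integrable one_le_two
    rw [← intervalIntegral.integral_eq_sub_of_hasDerivAt (fun x _ => (hφ x).hasDerivAt)
      ((intervalIntegrable_iff_integrableOn_Ioc_of_le zero_le_one).2 hint),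
      intervalIntegral.integral_of_le zero_le_one, ← eLpNorm_two_sq]
    gcongr
    refine (enorm_integral_le_lintegral_enorm _).trans ?_
    rw [← eLpNorm_one_eq_lintegral_enorm]
    exact eLpNorm_le_eLpNorm_of_exponent_le one_le_two hm

variable [FiniteDimensional ℝ E] [MeasurableSpace E] [BorelSpace E] [MeasurableSpace Ξ]
  {F : E → Ξ → ℝ} (hm : Measurable fun p : E × Ξ => F p.1 p.2)
  (hd : ∀ ξ, Differentiable ℝ fun x => F x ξ)

include hm hd

theorem measurable_inner_gradient (v : E) :
    Measurable (fun p : E × Ξ => ⟪gradient (fun y => F y p.2) p.1, v⟫_ℝ) := by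
  refine measurable_of_tendsto_metrizable
    (f := fun (n : ℕ) (p : E × Ξ) =>
      ((n : ℝ) + 1) * (F (p.1 + ((n : ℝ) + 1)⁻¹ • v) p.2 - F p.1 p.2)) (fun n => ?_)
    (tendsto_pi_nhds.2 fun p => tendsto_mul_sub_inner_gradient (hd p.2 p.1) v)
  have hshift : Measurable (fun p : E × Ξ => F (p.1 + ((n : ℝ) + 1)⁻¹ • v) p.2) :=
    hm.comp ((measurable_fst.add_const _).prodMk measurable_snd)
  exact (hshift.sub hm).const_mul _

theorem measurable_gradient :
    Measurable (fun p : E × Ξ => gradient (fun y => F y p.2) p.1) := by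
  have h : (fun p : E × Ξ => gradient (fun y => F y p.2) p.1) = fun p => ∑ j,
      ⟪gradient (fun y => F y p.2) p.1, stdOrthonormalBasis ℝ E j⟫_ℝ •
        stdOrthonormalBasis ℝ E j := by
    funext p
    conv_lhs => rw [← (stdOrthonormalBasis ℝ E).sum_repr' (gradient (fun y => F y p.2) p.1)]
    simp only [real_inner_comm]
  rw [h]
  exact Finset.measurable_sum _ fun j _ => (measurable_inner_gradient hm hd _).smul_const _

variable {D : Measure Ξ}

theorem eLpNorm_sub_le_of_eLpNorm_gradient_le [SFinite D] {K : ℝ≥0∞} {x w : E}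
    (hK : ∀ s ∈ Set.Ioc (0 : ℝ) 1,
      eLpNorm (fun ξ => gradient (fun y => F y ξ) (x + s • w)) 2 D ≤ K) :
    eLpNorm (fun ξ => F (x + w) ξ - F x ξ) 2 D ≤ K * ‖w‖ₑ := by
  set G : Ξ → ℝ → E := fun ξ s => gradient (fun y => F y ξ) (x + s • w)
  have hderiv : ∀ ξ s, deriv (fun s : ℝ => F (x + s • w) ξ) s = ⟪G ξ s, w⟫_ℝ := by
    intro ξ s
    have hline : HasDerivAt (fun s : ℝ => x + s • w) w s := by
      simpa using ((hasDerivAt_id s).smul_const w).const_add x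
    rw [inner_gradient_left]
    exact ((hd ξ (x + s • w)).hasFDerivAt.comp_hasDerivAt s hline).deriv
  have hincr : ∀ ξ, ‖F (x + w) ξ - F x ξ‖ₑ ^ 2 ≤
      ∫⁻ s in Set.Ioc (0 : ℝ) 1, ‖⟪G ξ s, w⟫_ℝ‖ₑ ^ 2 := fun ξ => by
    simpa [hderiv] using enorm_sub_sq_le_lintegral_deriv
      (φ := fun s => F (x + s • w) ξ) ((hd ξ).comp ((differentiable_id.smul_const w).const_add x))
  have hinner : ∀ s ∈ Set.Ioc (0 : ℝ) 1, ∫⁻ ξ, ‖⟪G ξ s, w⟫_ℝ‖ₑ ^ 2 ∂D ≤ (K * ‖w‖ₑ) ^ 2 := by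
    intro s hs
    calc ∫⁻ ξ, ‖⟪G ξ s, w⟫_ℝ‖ₑ ^ 2 ∂D
        ≤ ∫⁻ ξ, ‖G ξ s‖ₑ ^ 2 * ‖w‖ₑ ^ 2 ∂D := by
          refine lintegral_mono fun ξ => ?_
          rw [← mul_pow]
          gcongr
          simpa [← ofReal_norm, ← ENNReal.ofReal_mul] using
            ENNReal.ofReal_le_ofReal (norm_inner_le_norm (𝕜 := ℝ) (G ξ s) w)
      _ = (eLpNorm (fun ξ => G ξ s) 2 D * ‖w‖ₑ) ^ 2 := by
          rw [lintegral_mul_const' _ _ (by simp), mul_pow, eLpNorm_two_sq]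
      _ ≤ (K * ‖w‖ₑ) ^ 2 := by gcongr; exact hK s hs
  rw [← ENNReal.pow_le_pow_left_iff two_ne_zero, eLpNorm_two_sq]
  calc ∫⁻ ξ, ‖F (x + w) ξ - F x ξ‖ₑ ^ 2 ∂D
      ≤ ∫⁻ ξ, (∫⁻ s in Set.Ioc (0 : ℝ) 1, ‖⟪G ξ s, w⟫_ℝ‖ₑ ^ 2) ∂D := lintegral_mono hincr
    _ = ∫⁻ s in Set.Ioc (0 : ℝ) 1, ∫⁻ ξ, ‖⟪G ξ s, w⟫_ℝ‖ₑ ^ 2 ∂D := by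
        refine lintegral_lintegral_swap (Measurable.aemeasurable ?_)
        have hpath : Measurable (fun p : Ξ × ℝ => (x + p.2 • w, p.1)) := by fun_prop
        exact ((measurable_inner_gradient hm hd w).comp hpath).enorm.pow_const 2
    _ ≤ ∫⁻ _ in Set.Ioc (0 : ℝ) 1, (K * ‖w‖ₑ) ^ 2 := setLIntegral_mono measurable_const hinner
    _ = (K * ‖w‖ₑ) ^ 2 := by simp

theorem integral_gradient_eq_gradient_integral [IsFiniteMeasure D] (hint : ∀ x, Integrable (F x) D)
    {x : E} (hdiff : DifferentiableAt ℝ (fun x => ∫ ξ, F x ξ ∂D) x) {K : ℝ≥0∞} (hK : K ≠ ∞)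
    (hbound : ∀ᶠ y in 𝓝 x, eLpNorm (fun ξ => gradient (fun y => F y ξ) y) 2 D ≤ K) :
    ∫ ξ, gradient (fun y => F y ξ) x ∂D = gradient (fun x => ∫ ξ, F x ξ ∂D) x := by
  have hmx : ∀ y, Measurable (F y) := fun y => hm.comp (measurable_const.prodMk measurable_id)
  have hgx : MemLp (fun ξ => gradient (fun y => F y ξ) x) 2 D :=
    ⟨((measurable_gradient hm hd).comp
      (measurable_const.prodMk measurable_id)).aestronglyMeasurable,
      hbound.self_of_nhds.trans_lt hK.lt_top⟩
  refine ext_inner_right ℝ fun v => ?_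
  rw [real_inner_comm, ← integral_inner (hgx.integrable one_le_two)]
  simp_rw [real_inner_comm _ v]
  set c : ℕ → ℝ := fun n => (n : ℝ) + 1
  set φ : ℕ → Ξ → ℝ := fun n ξ => c n * (F (x + (c n)⁻¹ • v) ξ - F x ξ)
  have hc : ∀ n, 0 < c n := fun n => by positivity
  obtain ⟨r, hr, hball⟩ := Metric.eventually_nhds_iff_ball.1 hbound
  obtain ⟨n₀, hn₀⟩ : ∃ n₀ : ℕ, ∀ n ≥ n₀, ‖(c n)⁻¹ • v‖ < r := by
    have hlim : Filter.Tendsto (fun n => (c n)⁻¹ • v) Filter.atTop (𝓝 0) := by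
      simpa [c] using (tendsto_one_div_add_atTop_nhds_zero_nat (𝕜 := ℝ)).smul_const v
    simpa using Metric.tendsto_atTop.1 hlim r hr
  have hφ : ∀ n ≥ n₀, eLpNorm (φ n) 2 D ≤ K * ‖v‖ₑ := by
    intro n hn
    have hincr := eLpNorm_sub_le_of_eLpNorm_gradient_le (D := D) hm hd (x := x)
      (w := (c n)⁻¹ • v) (K := K) fun s hs => hball _ ?_
    · calc eLpNorm (φ n) 2 D ≤ ‖c n‖ₑ * (K * ‖(c n)⁻¹ • v‖ₑ) :=
            (eLpNorm_const_smul_le (c := c n)).trans (by gcongr)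
        _ = K * ‖c n • (c n)⁻¹ • v‖ₑ := by rw [enorm_smul (c n)]; ring
        _ = K * ‖v‖ₑ := by rw [smul_inv_smul₀ (hc n).ne']
    · rw [Metric.mem_ball, dist_self_add_left, norm_smul, Real.norm_of_nonneg hs.1.le]
      exact (mul_le_of_le_one_left (norm_nonneg _) hs.2).trans_lt (hn₀ n hn)
  have hlim : Filter.Tendsto (fun n => ∫ ξ, φ n ξ ∂D) Filter.atTop
      (𝓝 (∫ ξ, ⟪gradient (fun y => F y ξ) x, v⟫_ℝ ∂D)) :=
    (Filter.tendsto_add_atTop_iff_nat n₀).1 <| tendsto_integral_of_eLpNorm_le ENNReal.one_lt_two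
      (fun n => (((hmx _).sub (hmx _)).const_mul _).aestronglyMeasurable)
      (ENNReal.mul_ne_top hK enorm_ne_top) (fun n => hφ (n + n₀) (by lia))
      (Filter.Eventually.of_forall fun ξ => (Filter.tendsto_add_atTop_iff_nat n₀).2
        (tendsto_mul_sub_inner_gradient (hd ξ x) v))
  refine tendsto_nhds_unique hlim ?_
  simpa only [φ, integral_const_mul, integral_sub (hint _) (hint _)] using
    tendsto_mul_sub_inner_gradient hdiff v

end Gradient

/-! ### The iterates depend only on earlier stochastic gradients -/

section Congr

variable {N d : ℕ} {η γ : ℝ} {P I : ℕ} {g g' : Fin N → ℕ → ℕ → Vec d → Vec d}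
  {q q' : ℕ → Fin N → ℝ} {S : ServerState N d}

theorem localIter_congr {h h' : ℕ → Vec d → Vec d} {Gi G x : Vec d} {n : ℕ}
    (hh : ∀ k < n, h k = h' k) : localIter η h Gi G x n = localIter η h' Gi G x n := by
  induction n with
  | zero => rfl
  | succ n ih =>
    rw [localIter, localIter, ih fun k hk => hh k (by lia), hh n (by lia)]

theorem roundUpdate_congr {r : ℕ} {x : Vec d} (hg : ∀ i, ∀ k < I, g i r k = g' i r k)
    (hq : q r = q' r) : roundUpdate η I g q S r x = roundUpdate η I g' q' S r x := by
  simp only [roundUpdate, clientIter, hq]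
  exact Finset.sum_congr rfl fun i _ => by rw [localIter_congr (hg i)]

theorem windowModel_congr {r₀ j : ℕ}
    (hg : ∀ i, ∀ r, r₀ ≤ r → r < r₀ + j → ∀ k < I, g i r k = g' i r k)
    (hq : ∀ r, r₀ ≤ r → r < r₀ + j → q r = q' r) :
    windowModel η I g q S r₀ j = windowModel η I g' q' S r₀ j := by
  induction j with
  | zero => rfl
  | succ j ih =>
    rw [windowModel, windowModel, ih (fun i r h1 h2 => hg i r h1 (by lia))
      (fun r h1 h2 => hq r h1 (by lia)),
      roundUpdate_congr (fun i => hg i _ (by lia) (by lia)) (hq _ (by lia) (by lia))]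

theorem qBar_congr {r₀ : ℕ} (hq : ∀ r, r₀ ≤ r → r < r₀ + P → q r = q' r) :
    qBar P q r₀ = qBar P q' r₀ := by
  funext i
  unfold qBar
  congr 1
  exact Finset.sum_congr rfl fun j hj => by
    rw [hq _ (by lia) (by have := Finset.mem_range.1 hj; lia)]

theorem windowStep_congr {r₀ : ℕ}
    (hg : ∀ i, ∀ r, r₀ ≤ r → r < r₀ + P → ∀ k < I, g i r k = g' i r k)
    (hq : ∀ r, r₀ ≤ r → r < r₀ + P → q r = q' r) :
    windowStep η γ P I g q r₀ S = windowStep η γ P I g' q' r₀ S := by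
  have hw : ∀ j < P, windowModel η I g q S r₀ j = windowModel η I g' q' S r₀ j := fun j hj =>
    windowModel_congr (fun i r h1 h2 => hg i r h1 (by lia)) (fun r h1 h2 => hq r h1 (by lia))
  unfold windowStep
  congr 1
  · congr 2
    refine Finset.sum_congr rfl fun j hj => ?_
    have hj := Finset.mem_range.1 hj
    rw [hw j hj, roundUpdate_congr (fun i => hg i _ (by lia) (by lia)) (hq _ (by lia) (by lia))]
  · funext i
    rw [qBar_congr hq]
    congr 2
    refine Finset.sum_congr rfl fun j hj => ?_
    have hj := Finset.mem_range.1 hj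
    rw [hw j hj, hq _ (by lia) (by lia)]
    congr 1
    refine Finset.sum_congr rfl fun k hk => ?_
    have hk := Finset.mem_range.1 hk
    rw [hg i _ (by lia) (by lia) k hk, clientIter, clientIter,
      localIter_congr fun k' hk' => hg i _ (by lia) (by lia) k' (by lia)]

theorem serverState_congr {m : ℕ} (hg : ∀ i, ∀ r < m * P, ∀ k < I, g i r k = g' i r k)
    (hq : ∀ r < m * P, q r = q' r) :
    serverState η γ P I g q S m = serverState η γ P I g' q' S m := by
  induction m with
  | zero => rfl
  | succ m ih =>
    rw [Nat.succ_mul] at hg hq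
    rw [serverState, serverState, ih (fun i r hr => hg i r (by lia)) (fun r hr => hq r (by lia)),
      windowStep_congr (fun i r _ h2 => hg i r h2) (fun r _ h2 => hq r h2)]

end Congr

/-! ### Measurability of the iterates -/

section Measurability

variable {Θ : Type*} [MeasurableSpace Θ] {N d : ℕ} {η γ : ℝ} {P I : ℕ}
  {g : Θ → Fin N → ℕ → ℕ → Vec d → Vec d} {q : Θ → ℕ → Fin N → ℝ} {S : Θ → ServerState N d}

/-- A random server state all of whose components are measurable. -/
structure MeasurableState (S : Θ → ServerState N d) : Prop where
  model : Measurable fun θ => (S θ).model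
  control : ∀ i, Measurable fun θ => (S θ).control i

theorem MeasurableState.avgControl (hS : MeasurableState S) :
    Measurable fun θ => (S θ).avgControl :=
  Measurable.fun_const_smul (Finset.measurable_sum _ fun i _ => hS.control i) _

theorem measurable_clientIter {r : ℕ} {i : Fin N} {x : Θ → Vec d}
    (hg : ∀ k, Measurable fun p : Θ × Vec d => g p.1 i r k p.2)
    (hS : MeasurableState S) (hx : Measurable x) (k : ℕ) :
    Measurable fun θ => clientIter η (g θ) (S θ) r i (x θ) k := by
  induction k with
  | zero => exact hx
  | succ k ih =>
    have hgrad : Measurable fun θ => g θ i r k (clientIter η (g θ) (S θ) r i (x θ) k) :=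
      (hg k).comp (measurable_id.prodMk ih)
    exact ih.sub (((hgrad.sub (hS.control i)).add hS.avgControl).const_smul η)

theorem measurable_roundUpdate {r : ℕ} {x : Θ → Vec d}
    (hg : ∀ i k, Measurable fun p : Θ × Vec d => g p.1 i r k p.2)
    (hq : ∀ i, Measurable fun θ => q θ r i) (hS : MeasurableState S) (hx : Measurable x) :
    Measurable fun θ => roundUpdate η I (g θ) (q θ) (S θ) r (x θ) :=
  Finset.measurable_sum _ fun i _ =>
    (hq i).smul ((measurable_clientIter (hg i) hS hx I).sub hx)

variable (hg : ∀ i r k, Measurable fun p : Θ × Vec d => g p.1 i r k p.2)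
  (hq : ∀ r i, Measurable fun θ => q θ r i)

include hg hq

theorem measurable_windowModel (hS : MeasurableState S) (r₀ j : ℕ) :
    Measurable fun θ => windowModel η I (g θ) (q θ) (S θ) r₀ j := by
  induction j with
  | zero => exact hS.model
  | succ j ih =>
    exact ih.add (measurable_roundUpdate (fun i k => hg i _ k) (hq _) hS ih)

theorem MeasurableState.windowStep (hS : MeasurableState S) (r₀ : ℕ) :
    MeasurableState fun θ => windowStep η γ P I (g θ) (q θ) r₀ (S θ) where
  model := hS.model.add ((Finset.measurable_sum _ fun j _ => measurable_roundUpdate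
    (fun i k => hg i _ k) (hq _) hS (measurable_windowModel hg hq hS r₀ j)).const_smul γ)
  control i := by
    have hqBar : Measurable fun θ => qBar P (q θ) r₀ i :=
      (Finset.measurable_sum _ fun j _ => hq _ i).const_mul _
    refine Measurable.ite (measurableSet_lt measurable_const hqBar) ?_ (hS.control i)
    refine ((hqBar.const_mul _).mul_const _).const_div _ |>.smul
      (Finset.measurable_sum _ fun j _ => (hq _ i).smul (Finset.measurable_sum _ fun k _ => ?_))
    exact (hg i _ k).comp (measurable_id.prodMk
      (measurable_clientIter (hg i _) hS (measurable_windowModel hg hq hS r₀ j) k))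

theorem MeasurableState.serverState (hS : MeasurableState S) (m : ℕ) :
    MeasurableState fun θ => serverState η γ P I (g θ) (q θ) (S θ) m := by
  induction m with
  | zero => exact hS
  | succ m ih => exact ih.windowStep hg hq _

end Measurability

/-! ### One window under regularized participation -/

section Window

variable {N d : ℕ} {η γ : ℝ} {P I : ℕ} {g : Fin N → ℕ → ℕ → Vec d → Vec d}
  {q : ℕ → Fin N → ℝ} {S : ServerState N d} {r₀ : ℕ}

/-- The iterate of client `i` before step `k` of the `j`-th round of a window. -/
def windowIter (η : ℝ) (I : ℕ) (g : Fin N → ℕ → ℕ → Vec d → Vec d)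
    (q : ℕ → Fin N → ℝ) (S : ServerState N d) (r₀ j : ℕ) (i : Fin N) (k : ℕ) : Vec d :=
  clientIter η g S (r₀ + j) i (windowModel η I g q S r₀ j) k

/-- The stochastic gradient that client `i` computes in step `k` of the `j`-th round of a window. -/
def windowGrad (η : ℝ) (I : ℕ) (g : Fin N → ℕ → ℕ → Vec d → Vec d)
    (q : ℕ → Fin N → ℝ) (S : ServerState N d) (r₀ j : ℕ) (i : Fin N) (k : ℕ) : Vec d :=
  g i (r₀ + j) k (windowIter η I g q S r₀ j i k)

/-- The deviation of that stochastic gradient from its mean, when the local gradients are `h`. -/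
def windowNoise (η : ℝ) (I : ℕ) (g : Fin N → ℕ → ℕ → Vec d → Vec d)
    (h : Fin N → Vec d → Vec d) (q : ℕ → Fin N → ℝ) (S : ServerState N d) (r₀ j : ℕ) (i : Fin N)
    (k : ℕ) : Vec d :=
  windowGrad η I g q S r₀ j i k - h i (windowIter η I g q S r₀ j i k)

theorem clientIter_sub (r : ℕ) (i : Fin N) (x : Vec d) (n : ℕ) :
    clientIter η g S r i x n - x =
      -(η • ∑ k ∈ range n, (g i r k (clientIter η g S r i x k) - S.control i + S.avgControl)) := by
  induction n with
  | zero => simp [clientIter, localIter]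
  | succ n ih =>
    rw [Finset.sum_range_succ, smul_add, neg_add, ← ih]
    simp only [clientIter, localIter]
    abel

theorem sum_weights_of_qBar (hP : 0 < P) {i : Fin N} {b : ℝ} (h : qBar P q r₀ i = b) :
    ∑ j ∈ range P, q (r₀ + j) i = P * b := by
  have hP' : (P : ℝ) ≠ 0 := by positivity
  rw [← h, qBar]
  field_simp

theorem ServerState.sum_control_sub_avgControl (S : ServerState N d) :
    ∑ i, (S.control i - S.avgControl) = 0 := by
  rcases N.eq_zero_or_pos with rfl | hN
  · simp
  · rw [Finset.sum_sub_distrib, Finset.sum_const, Finset.card_univ, Fintype.card_fin,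
      ServerState.avgControl, ← Nat.cast_smul_eq_nsmul ℝ, smul_smul,
      mul_one_div_cancel (by positivity), one_smul, sub_self]

theorem roundUpdate_windowModel (j : ℕ) :
    roundUpdate η I g q S (r₀ + j) (windowModel η I g q S r₀ j) =
      η • ∑ i, q (r₀ + j) i • ((I : ℝ) • (S.control i - S.avgControl)) -
        η • ∑ i, q (r₀ + j) i • ∑ k ∈ range I, windowGrad η I g q S r₀ j i k := by
  rw [← smul_sub, ← Finset.sum_sub_distrib, Finset.smul_sum]
  refine Finset.sum_congr rfl fun i _ => ?_
  rw [clientIter_sub, Finset.sum_add_distrib, Finset.sum_sub_distrib, Finset.sum_const,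
    Finset.sum_const, Finset.card_range, ← Nat.cast_smul_eq_nsmul ℝ, ← Nat.cast_smul_eq_nsmul ℝ]
  simp only [windowGrad, windowIter]
  module

-- Equal total weights make the corrections `G - Gⁱ` cancel over the window.
theorem windowStep_model (hP : 0 < P) (hq : ∀ i, qBar P q r₀ i = 1 / (N : ℝ)) :
    (windowStep η γ P I g q r₀ S).model = S.model - (γ * η) •
      ∑ j ∈ range P, ∑ i, q (r₀ + j) i • ∑ k ∈ range I, windowGrad η I g q S r₀ j i k := by
  have hcontrol :
      ∑ j ∈ range P, ∑ i, q (r₀ + j) i • ((I : ℝ) • (S.control i - S.avgControl)) = 0 := by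
    rw [Finset.sum_comm]
    simp_rw [← Finset.sum_smul, sum_weights_of_qBar hP (hq _), ← Finset.smul_sum,
      S.sum_control_sub_avgControl, smul_zero]
  change S.model + γ • ∑ j ∈ range P, _ = _
  simp_rw [roundUpdate_windowModel]
  rw [Finset.sum_sub_distrib, ← Finset.smul_sum, ← Finset.smul_sum, hcontrol]
  module

theorem windowStep_control (hN : 0 < N) {i : Fin N} (hq : qBar P q r₀ i = 1 / (N : ℝ)) :
    (windowStep η γ P I g q r₀ S).control i = ((N : ℝ) / (P * I)) •
      ∑ j ∈ range P, q (r₀ + j) i • ∑ k ∈ range I, windowGrad η I g q S r₀ j i k := by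
  have hN' : (0 : ℝ) < 1 / N := by positivity
  simp only [windowStep, hq, hN', if_true, windowGrad, windowIter]
  congr 1
  field_simp

end Window

/-! ### Weighted sums over a window -/

theorem sum_mul_sq_le {ι : Type*} (s : Finset ι) {a b : ι → ℝ} (ha : ∀ i ∈ s, 0 ≤ a i) :
    (∑ i ∈ s, a i * b i) ^ 2 ≤ (∑ i ∈ s, a i) * ∑ i ∈ s, a i * b i ^ 2 :=
  Finset.sum_sq_le_sum_mul_sum_of_sq_le_mul s ha
    (fun i hi => mul_nonneg (ha i hi) (sq_nonneg _)) fun i _ => le_of_eq (by ring)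

theorem norm_sum_smul_sq_le {ι V : Type*} [SeminormedAddCommGroup V] [NormedSpace ℝ V]
    (s : Finset ι) {a : ι → ℝ} {v : ι → V} (ha : ∀ i ∈ s, 0 ≤ a i) :
    ‖∑ i ∈ s, a i • v i‖ ^ 2 ≤ (∑ i ∈ s, a i) * ∑ i ∈ s, a i * ‖v i‖ ^ 2 := by
  refine le_trans ?_ (sum_mul_sq_le s ha)
  gcongr
  refine (norm_sum_le _ _).trans (Finset.sum_le_sum fun i hi => ?_)
  rw [norm_smul, Real.norm_of_nonneg (ha i hi)]

theorem norm_add₃_sq_le {V : Type*} [SeminormedAddCommGroup V] (a b c : V) :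
    ‖a + b + c‖ ^ 2 ≤ 3 * (‖a‖ ^ 2 + ‖b‖ ^ 2 + ‖c‖ ^ 2) := by
  calc ‖a + b + c‖ ^ 2 ≤ (‖a‖ + ‖b‖ + ‖c‖) ^ 2 := by gcongr; exact norm_add₃_le
    _ ≤ _ := by
      nlinarith [sq_nonneg (‖a‖ - ‖b‖), sq_nonneg (‖b‖ - ‖c‖), sq_nonneg (‖a‖ - ‖c‖)]

/-- The weights in the window from `r₀` are those of regularized participation, and their squares
sum to at most `ρ²` in each round. -/
structure RegularWindow {N : ℕ} (P : ℕ) (ρ : ℝ) (q : ℕ → Fin N → ℝ) (r₀ : ℕ) : Prop where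
  nonneg : ∀ j < P, ∀ i, 0 ≤ q (r₀ + j) i
  sum_eq_one : ∀ j < P, ∑ i, q (r₀ + j) i = 1
  sum_sq_le : ∀ j < P, ∑ i, q (r₀ + j) i ^ 2 ≤ ρ ^ 2
  qBar_eq : ∀ i, qBar P q r₀ i = 1 / (N : ℝ)

/-- The triples (round in the window, client, local step), which index the stochastic gradients of
a window. -/
def windowIdx (N P I : ℕ) : Finset (ℕ × Fin N × ℕ) := range P ×ˢ univ ×ˢ range I

/-- The weight `q^i_{r₀ + j} / (P I)` of the stochastic gradient `(j, i, k)` in a window. -/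
def windowWeight {N : ℕ} (P I : ℕ) (q : ℕ → Fin N → ℝ) (r₀ : ℕ) (p : ℕ × Fin N × ℕ) : ℝ :=
  q (r₀ + p.1) p.2.1 / (P * I)

section Weights

variable {N P I r₀ : ℕ} {ρ : ℝ} {q : ℕ → Fin N → ℝ}

theorem mem_windowIdx {p : ℕ × Fin N × ℕ} : p ∈ windowIdx N P I ↔ p.1 < P ∧ p.2.2 < I := by
  simp [windowIdx]

theorem RegularWindow.clients_pos (hq : RegularWindow P ρ q r₀) (hP : 0 < P) : 0 < N := by
  rcases N.eq_zero_or_pos with rfl | hN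
  · simpa using hq.sum_eq_one 0 hP
  · exact hN

theorem RegularWindow.windowWeight_nonneg (hq : RegularWindow P ρ q r₀) {p : ℕ × Fin N × ℕ}
    (hp : p ∈ windowIdx N P I) : 0 ≤ windowWeight P I q r₀ p :=
  div_nonneg (hq.nonneg _ (mem_windowIdx.1 hp).1 _) (by positivity)

theorem sum_windowWeight_smul {V : Type*} [AddCommGroup V] [Module ℝ V]
    (v : ℕ → Fin N → ℕ → V) :
    ∑ p ∈ windowIdx N P I, windowWeight P I q r₀ p • v p.1 p.2.1 p.2.2 =
      (1 / ((P : ℝ) * I)) • ∑ j ∈ range P, ∑ i, q (r₀ + j) i • ∑ k ∈ range I, v j i k := by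
  simp only [windowIdx, windowWeight, Finset.sum_product, Finset.smul_sum, smul_smul]
  refine Finset.sum_congr rfl fun j _ => Finset.sum_congr rfl fun i _ =>
    Finset.sum_congr rfl fun k _ => ?_
  congr 1
  ring

theorem sum_windowWeight_mul (v : ℕ → Fin N → ℕ → ℝ) :
    ∑ p ∈ windowIdx N P I, windowWeight P I q r₀ p * v p.1 p.2.1 p.2.2 =
      1 / ((P : ℝ) * I) * ∑ j ∈ range P, ∑ i, q (r₀ + j) i * ∑ k ∈ range I, v j i k :=
  sum_windowWeight_smul v

theorem RegularWindow.sum_windowWeight_smul_client {V : Type*} [AddCommGroup V] [Module ℝ V]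
    (hq : RegularWindow P ρ q r₀) (hP : 0 < P) (hI : 0 < I) (v : Fin N → V) :
    ∑ p ∈ windowIdx N P I, windowWeight P I q r₀ p • v p.2.1 = (1 / (N : ℝ)) • ∑ i, v i := by
  rw [sum_windowWeight_smul (v := fun _ i _ => v i), Finset.sum_comm]
  simp_rw [← Finset.sum_smul, sum_weights_of_qBar hP (hq.qBar_eq _), Finset.sum_const,
    Finset.card_range, ← Nat.cast_smul_eq_nsmul ℝ, Finset.smul_sum, smul_smul]
  refine Finset.sum_congr rfl fun i _ => ?_
  congr 1
  field_simp

theorem RegularWindow.sum_windowWeight (hq : RegularWindow P ρ q r₀) (hP : 0 < P) (hI : 0 < I) :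
    ∑ p ∈ windowIdx N P I, windowWeight P I q r₀ p = 1 := by
  have hN : (N : ℝ) ≠ 0 := Nat.cast_ne_zero.2 (hq.clients_pos hP).ne'
  simpa [hN] using hq.sum_windowWeight_smul_client hP hI fun _ => (1 : ℝ)

theorem RegularWindow.sum_windowWeight_sq_le (hq : RegularWindow P ρ q r₀) (hP : 0 < P)
    (hI : 0 < I) : ∑ p ∈ windowIdx N P I, windowWeight P I q r₀ p ^ 2 ≤ ρ ^ 2 / (P * I) := by
  calc ∑ p ∈ windowIdx N P I, windowWeight P I q r₀ p ^ 2
      = (I / ((P : ℝ) * I) ^ 2) * ∑ j ∈ range P, ∑ i, q (r₀ + j) i ^ 2 := by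
        simp only [windowIdx, windowWeight, Finset.sum_product, Finset.mul_sum, Finset.sum_const,
          Finset.card_range, nsmul_eq_mul]
        refine Finset.sum_congr rfl fun j _ => Finset.sum_congr rfl fun i _ => ?_
        ring
    _ ≤ (I / ((P : ℝ) * I) ^ 2) * ∑ _j ∈ range P, ρ ^ 2 := by
        gcongr with j hj
        exact hq.sum_sq_le j (Finset.mem_range.1 hj)
    _ = _ := by
        rw [Finset.sum_const, Finset.card_range, nsmul_eq_mul]
        field_simp

theorem RegularWindow.sum_windowWeight_mul_sum_sq_le (hq : RegularWindow P ρ q r₀)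
    (b : ℕ → Fin N → ℕ → ℝ) :
    ∑ p ∈ windowIdx N P I, windowWeight P I q r₀ p * (∑ k ∈ range I, b p.1 p.2.1 k) ^ 2 ≤
      (I : ℝ) ^ 2 * ∑ p ∈ windowIdx N P I, windowWeight P I q r₀ p * b p.1 p.2.1 p.2.2 ^ 2 := by
  rw [sum_windowWeight_mul fun j i _ => (∑ k ∈ range I, b j i k) ^ 2,
    sum_windowWeight_mul fun j i k => b j i k ^ 2, mul_left_comm]
  gcongr 1 / ((P : ℝ) * I) * ?_
  simp only [Finset.mul_sum (range P), Finset.mul_sum univ]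
  refine Finset.sum_le_sum fun j hj => Finset.sum_le_sum fun i _ => ?_
  have hqj := hq.nonneg j (Finset.mem_range.1 hj) i
  calc q (r₀ + j) i * ∑ _k ∈ range I, (∑ k ∈ range I, b j i k) ^ 2
      ≤ q (r₀ + j) i * ∑ _k ∈ range I, (I * ∑ k ∈ range I, b j i k ^ 2) := by
        gcongr
        simpa using sq_sum_le_card_mul_sum_sq (s := range I) (f := b j i)
    _ = _ := by
        rw [Finset.sum_const, Finset.card_range, nsmul_eq_mul]
        ring

end Weights

/-! ### Client drift -/

theorem le_three_halves_mul_sum_of_step {n : ℕ} {e w : ℕ → ℝ} {c : ℝ} (hc : 0 ≤ c)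
    (hcn : 3 * (c * n) ≤ 1) (hw : ∀ j < n, 0 ≤ w j) (he0 : e 0 = 0)
    (he : ∀ j < n, e (j + 1) ≤ e j + (w j + c * e j)) {j : ℕ} (hj : j ≤ n) :
    e j ≤ 3 / 2 * ∑ i ∈ range n, w i := by
  set s := ∑ i ∈ range n, w i
  have hs0 : 0 ≤ s := Finset.sum_nonneg fun i hi => hw i (Finset.mem_range.1 hi)
  have hle : ∀ k ≤ n, ∑ i ∈ range k, w i + c * k * (3 / 2 * s) ≤ 3 / 2 * s := by
    intro k hk
    have hsum : ∑ i ∈ range k, w i ≤ s := Finset.sum_le_sum_of_subset_of_nonneg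
      (Finset.range_mono hk) fun i hi _ => hw i (Finset.mem_range.1 hi)
    have hck : c * k ≤ c * n := by gcongr
    nlinarith
  suffices ∀ k ≤ n, e k ≤ ∑ i ∈ range k, w i + c * k * (3 / 2 * s) from
    (this j hj).trans (hle j hj)
  intro k hk
  induction k with
  | zero => simp [he0]
  | succ k ih =>
    have ihk := ih (by lia)
    have hek : c * e k ≤ c * (3 / 2 * s) := by gcongr; exact ihk.trans (hle k (by lia))
    rw [Finset.sum_range_succ]
    push_cast
    linarith [he k (by lia)]

section Drift

variable {N d : ℕ} {η ρ L : ℝ} {P I : ℕ} {g : Fin N → ℕ → ℕ → Vec d → Vec d}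
  {q : ℕ → Fin N → ℝ} {S : ServerState N d} {r₀ : ℕ} {b : ℕ → Fin N → ℕ → ℝ}

/-- The corrected stochastic gradient along which client `i` moves in step `k` of the `j`-th round
of a window. -/
def windowDir (η : ℝ) (I : ℕ) (g : Fin N → ℕ → ℕ → Vec d → Vec d) (q : ℕ → Fin N → ℝ)
    (S : ServerState N d) (r₀ j : ℕ) (i : Fin N) (k : ℕ) : Vec d :=
  windowGrad η I g q S r₀ j i k - S.control i + S.avgControl

theorem norm_windowIter_sub_windowModel_le (hη : 0 ≤ η) (j : ℕ) (i : Fin N) {n : ℕ} (hn : n ≤ I) :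
    ‖windowIter η I g q S r₀ j i n - windowModel η I g q S r₀ j‖ ≤
      η * ∑ k ∈ range I, ‖windowDir η I g q S r₀ j i k‖ := by
  rw [windowIter, clientIter_sub, norm_neg, norm_smul, Real.norm_of_nonneg hη]
  gcongr
  exact (norm_sum_le _ _).trans (Finset.sum_le_sum_of_subset_of_nonneg (Finset.range_mono hn)
    fun _ _ _ => norm_nonneg _)

theorem norm_windowIter_sub_model_le_add (hη : 0 ≤ η) (j : ℕ) (i : Fin N) {n : ℕ} (hn : n ≤ I) :
    ‖windowIter η I g q S r₀ j i n - S.model‖ ≤ ‖windowModel η I g q S r₀ j - S.model‖ +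
      η * ∑ k ∈ range I, ‖windowDir η I g q S r₀ j i k‖ := by
  rw [← sub_add_sub_cancel' (windowModel η I g q S r₀ j)]
  exact (norm_add_le _ _).trans (by gcongr; exact norm_windowIter_sub_windowModel_le hη j i hn)

-- The drift enters its own bound; for `ηLI ≤ 1/4` it is absorbed on the left.
theorem mul_sum_norm_windowDir_le (hη : 0 ≤ η) (hL : 0 ≤ L) (hηL : 4 * (η * L * I) ≤ 1) {j : ℕ}
    {i : Fin N} (hb : ∀ k < I, ‖windowDir η I g q S r₀ j i k‖ ≤
      b j i k + L * ‖windowIter η I g q S r₀ j i k - S.model‖) :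
    η * ∑ k ∈ range I, ‖windowDir η I g q S r₀ j i k‖ ≤
      4 / 3 * η * (∑ k ∈ range I, b j i k + L * I * ‖windowModel η I g q S r₀ j - S.model‖) := by
  set e := ‖windowModel η I g q S r₀ j - S.model‖
  set U := ∑ k ∈ range I, ‖windowDir η I g q S r₀ j i k‖
  have hU0 : 0 ≤ U := Finset.sum_nonneg fun k _ => norm_nonneg _
  have hU_le : U ≤ ∑ k ∈ range I, b j i k + L * I * (e + η * U) := by
    calc U ≤ ∑ k ∈ range I, (b j i k + L * (e + η * U)) := by
          refine Finset.sum_le_sum fun k hk => (hb k (Finset.mem_range.1 hk)).trans ?_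
          gcongr
          exact norm_windowIter_sub_model_le_add hη j i (Finset.mem_range.1 hk).le
      _ = _ := by
          rw [Finset.sum_add_distrib, Finset.sum_const, Finset.card_range, nsmul_eq_mul]
          ring
  have hηU := mul_le_mul_of_nonneg_left hU_le hη
  have habsorb := mul_le_mul_of_nonneg_right hηL (mul_nonneg hη hU0)
  linarith

theorem RegularWindow.norm_windowModel_succ_sub_le (hq : RegularWindow P ρ q r₀) (hη : 0 ≤ η)
    {j : ℕ} (hj : j < P) :
    ‖windowModel η I g q S r₀ (j + 1) - S.model‖ ≤ ‖windowModel η I g q S r₀ j - S.model‖ +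
      ∑ i, q (r₀ + j) i * (η * ∑ k ∈ range I, ‖windowDir η I g q S r₀ j i k‖) := by
  rw [windowModel, add_sub_right_comm, roundUpdate]
  refine (norm_add_le _ _).trans ?_
  gcongr
  refine (norm_sum_le _ _).trans (Finset.sum_le_sum fun i _ => ?_)
  rw [norm_smul, Real.norm_of_nonneg (hq.nonneg j hj i)]
  exact mul_le_mul_of_nonneg_left (norm_windowIter_sub_windowModel_le hη j i le_rfl)
    (hq.nonneg j hj i)

theorem four_mul_step_le_one (hP : 0 < P) (hηL : 4 * (η * P * I * L) ≤ 1) :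
    4 * (η * L * I) ≤ 1 := by
  have hP1 : (1 : ℝ) ≤ P := by exact_mod_cast hP
  rcases le_total (η * L * I) 0 with h | h <;> nlinarith

variable (hq : RegularWindow P ρ q r₀) (hη : 0 ≤ η) (hL : 0 ≤ L) (hηL : 4 * (η * P * I * L) ≤ 1)
  (hb0 : ∀ j i k, 0 ≤ b j i k) (hb : ∀ j < P, ∀ i, ∀ k < I, ‖windowDir η I g q S r₀ j i k‖ ≤
    b j i k + L * ‖windowIter η I g q S r₀ j i k - S.model‖)

include hq hη hL hηL hb0 hb

theorem norm_windowModel_sub_model_le (hP : 0 < P) (hI : 0 < I) {j : ℕ} (hj : j ≤ P) :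
    ‖windowModel η I g q S r₀ j - S.model‖ ≤ 2 * (η * P * I) *
      ∑ p ∈ windowIdx N P I, windowWeight P I q r₀ p * b p.1 p.2.1 p.2.2 := by
  set e := fun j => ‖windowModel η I g q S r₀ j - S.model‖ with he
  set w := fun j => ∑ i, q (r₀ + j) i * ∑ k ∈ range I, b j i k with hw
  have hηLI := four_mul_step_le_one hP hηL
  have hstep : ∀ j < P, e (j + 1) ≤ e j + (4 / 3 * η * w j + 4 / 3 * η * (L * I) * e j) := by
    intro j hj
    refine (hq.norm_windowModel_succ_sub_le hη hj).trans (add_le_add_right ?_ _)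
    calc _ ≤ ∑ i, q (r₀ + j) i * (4 / 3 * η * (∑ k ∈ range I, b j i k + L * I * e j)) := by
          gcongr ∑ i, q (r₀ + j) i * ?_ with i
          · exact hq.nonneg j hj i
          · exact mul_sum_norm_windowDir_le hη hL hηLI (hb j hj i)
      _ = 4 / 3 * η * w j + 4 / 3 * η * (L * I) * e j * ∑ i, q (r₀ + j) i := by
          simp only [hw, Finset.mul_sum univ, ← Finset.sum_add_distrib]
          exact Finset.sum_congr rfl fun i _ => by ring
      _ = _ := by rw [hq.sum_eq_one j hj, mul_one]
  have hw0 : ∀ j < P, 0 ≤ 4 / 3 * η * w j := fun j hj => mul_nonneg (by positivity)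
    (Finset.sum_nonneg fun i _ => mul_nonneg (hq.nonneg j hj i)
      (Finset.sum_nonneg fun k _ => hb0 j i k))
  have he_le := le_three_halves_mul_sum_of_step (by positivity) (by linarith) hw0
    (by simp [he, windowModel]) hstep hj
  refine he_le.trans (le_of_eq ?_)
  rw [sum_windowWeight_mul, ← Finset.mul_sum]
  field_simp
  ring

theorem norm_windowIter_sub_model_le (hP : 0 < P) (hI : 0 < I) {p : ℕ × Fin N × ℕ}
    (hp : p ∈ windowIdx N P I) :
    ‖windowIter η I g q S r₀ p.1 p.2.1 p.2.2 - S.model‖ ≤ 4 / 3 * η * (2 * (P * I *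
      ∑ p ∈ windowIdx N P I, windowWeight P I q r₀ p * b p.1 p.2.1 p.2.2) +
        ∑ k ∈ range I, b p.1 p.2.1 k) := by
  obtain ⟨hj, hk⟩ := mem_windowIdx.1 hp
  have hηLI := four_mul_step_le_one hP hηL
  have hmodel := norm_windowModel_sub_model_le hq hη hL hηL hb0 hb hP hI hj.le
  have hdir := mul_sum_norm_windowDir_le hη hL hηLI (hb p.1 hj p.2.1)
  have habsorb := mul_le_mul_of_nonneg_right hηLI
    (norm_nonneg (windowModel η I g q S r₀ p.1 - S.model))
  linarith [norm_windowIter_sub_model_le_add (g := g) (q := q) (S := S) (r₀ := r₀) hη p.1 p.2.1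
    hk.le]

theorem sum_norm_windowIter_sub_model_sq_le (hP : 0 < P) (hI : 0 < I) :
    ∑ p ∈ windowIdx N P I, windowWeight P I q r₀ p *
        ‖windowIter η I g q S r₀ p.1 p.2.1 p.2.2 - S.model‖ ^ 2 ≤
      18 * (η * P * I) ^ 2 *
        ∑ p ∈ windowIdx N P I, windowWeight P I q r₀ p * b p.1 p.2.1 p.2.2 ^ 2 := by
  set M := ∑ p ∈ windowIdx N P I, windowWeight P I q r₀ p * b p.1 p.2.1 p.2.2
  set V := ∑ p ∈ windowIdx N P I, windowWeight P I q r₀ p * b p.1 p.2.1 p.2.2 ^ 2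
  have hP1 : (1 : ℝ) ≤ P := by exact_mod_cast hP
  have hV0 : 0 ≤ V := Finset.sum_nonneg fun p hp =>
    mul_nonneg (hq.windowWeight_nonneg hp) (sq_nonneg _)
  have hMV : M ^ 2 ≤ V := by
    simpa [hq.sum_windowWeight hP hI] using sum_mul_sq_le (windowIdx N P I)
      (b := fun p => b p.1 p.2.1 p.2.2) fun p hp => hq.windowWeight_nonneg hp
  have hiter_sq : ∀ p ∈ windowIdx N P I,
      ‖windowIter η I g q S r₀ p.1 p.2.1 p.2.2 - S.model‖ ^ 2 ≤
        32 / 9 * η ^ 2 * ((2 * (P * I * M)) ^ 2 + (∑ k ∈ range I, b p.1 p.2.1 k) ^ 2) := by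
    intro p hp
    calc _ ≤ (4 / 3 * η * (2 * (P * I * M) + ∑ k ∈ range I, b p.1 p.2.1 k)) ^ 2 := by
          gcongr
          exact norm_windowIter_sub_model_le hq hη hL hηL hb0 hb hP hI hp
      _ ≤ 16 / 9 * η ^ 2 * (2 * ((2 * (P * I * M)) ^ 2 + (∑ k ∈ range I, b p.1 p.2.1 k) ^ 2)) := by
          rw [mul_pow, show (4 / 3 * η) ^ 2 = 16 / 9 * η ^ 2 by ring]
          gcongr
          exact add_sq_le
      _ = _ := by ring
  calc _ ≤ ∑ p ∈ windowIdx N P I, windowWeight P I q r₀ p *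
        (32 / 9 * η ^ 2 * ((2 * (P * I * M)) ^ 2 + (∑ k ∈ range I, b p.1 p.2.1 k) ^ 2)) :=
        Finset.sum_le_sum fun p hp =>
          mul_le_mul_of_nonneg_left (hiter_sq p hp) (hq.windowWeight_nonneg hp)
    _ = 32 / 9 * η ^ 2 * (4 * (P * I) ^ 2 * M ^ 2 + ∑ p ∈ windowIdx N P I,
          windowWeight P I q r₀ p * (∑ k ∈ range I, b p.1 p.2.1 k) ^ 2) := by
        simp_rw [mul_left_comm (windowWeight P I q r₀ _), mul_add, Finset.sum_add_distrib,
          ← Finset.mul_sum, ← Finset.sum_mul, hq.sum_windowWeight hP hI]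
        ring
    _ ≤ 32 / 9 * η ^ 2 * (4 * (P * I) ^ 2 * V + I ^ 2 * V) := by
        gcongr
        exact hq.sum_windowWeight_mul_sum_sq_le b
    _ ≤ 32 / 9 * η ^ 2 * (4 * (P * I) ^ 2 * V + (P * I) ^ 2 * V) := by
        gcongr
        exact le_mul_of_one_le_left (by positivity) hP1
    _ = 160 / 9 * (η * P * I) ^ 2 * V := by ring
    _ ≤ _ := by gcongr; norm_num

end Drift

/-! ### Pathwise estimates for one window -/

/-- The average `∇f = (1/N) ∑_i ∇f_i` of the local gradients `h i = ∇f_i`. -/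
def meanGrad {N d : ℕ} (h : Fin N → Vec d → Vec d) (x : Vec d) : Vec d :=
  (1 / (N : ℝ)) • ∑ i, h i x

/-- The mean squared error of the control variates as estimates of the local gradients `h i`. -/
def controlError {N d : ℕ} (h : Fin N → Vec d → Vec d) (S : ServerState N d) : ℝ :=
  (1 / (N : ℝ)) * ∑ i, ‖S.control i - h i S.model‖ ^ 2

/-- The weighted mean squared distance of the local iterates of a window to the model at its
start. -/
def windowDrift {N d : ℕ} (η : ℝ) (P I : ℕ) (g : Fin N → ℕ → ℕ → Vec d → Vec d)
    (q : ℕ → Fin N → ℝ) (S : ServerState N d) (r₀ : ℕ) : ℝ :=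
  ∑ p ∈ windowIdx N P I, windowWeight P I q r₀ p *
    ‖windowIter η I g q S r₀ p.1 p.2.1 p.2.2 - S.model‖ ^ 2

/-- The weighted mean of the squared gradient noise of a window. -/
def windowNoiseSq {N d : ℕ} (η : ℝ) (P I : ℕ) (g : Fin N → ℕ → ℕ → Vec d → Vec d)
    (h : Fin N → Vec d → Vec d) (q : ℕ → Fin N → ℝ) (S : ServerState N d) (r₀ : ℕ) : ℝ :=
  ∑ p ∈ windowIdx N P I, windowWeight P I q r₀ p *
    ‖windowNoise η I g h q S r₀ p.1 p.2.1 p.2.2‖ ^ 2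

/-- The weighted mean of the gradient noise of a window. -/
def windowNoiseMean {N d : ℕ} (η : ℝ) (P I : ℕ) (g : Fin N → ℕ → ℕ → Vec d → Vec d)
    (h : Fin N → Vec d → Vec d) (q : ℕ → Fin N → ℝ) (S : ServerState N d) (r₀ : ℕ) : Vec d :=
  ∑ p ∈ windowIdx N P I, windowWeight P I q r₀ p • windowNoise η I g h q S r₀ p.1 p.2.1 p.2.2

/-- The weighted mean of the stochastic gradients of a window, which is the direction of the
server's step. -/
def windowGradMean {N d : ℕ} (η : ℝ) (P I : ℕ) (g : Fin N → ℕ → ℕ → Vec d → Vec d)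
    (q : ℕ → Fin N → ℝ) (S : ServerState N d) (r₀ : ℕ) : Vec d :=
  ∑ p ∈ windowIdx N P I, windowWeight P I q r₀ p • windowGrad η I g q S r₀ p.1 p.2.1 p.2.2

section Pathwise

variable {N d : ℕ} {η γ ρ L : ℝ} {P I : ℕ} {g : Fin N → ℕ → ℕ → Vec d → Vec d}
  {h : Fin N → Vec d → Vec d} {q : ℕ → Fin N → ℝ} {S : ServerState N d} {r₀ : ℕ}

theorem RegularWindow.windowStep_model (hq : RegularWindow P ρ q r₀) (hP : 0 < P) (hI : 0 < I) :
    (windowStep η γ P I g q r₀ S).model =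
      S.model - (γ * η * P * I) • windowGradMean η P I g q S r₀ := by
  rw [AmpScaffold.windowStep_model hP hq.qBar_eq, windowGradMean,
    sum_windowWeight_smul (v := fun j i k => windowGrad η I g q S r₀ j i k), smul_smul]
  congr 2
  field_simp

theorem controlError_nonneg (h : Fin N → Vec d → Vec d) (S : ServerState N d) :
    0 ≤ controlError h S := by
  unfold controlError
  positivity

theorem RegularWindow.windowNoiseSq_nonneg (hq : RegularWindow P ρ q r₀) :
    0 ≤ windowNoiseSq η P I g h q S r₀ :=
  Finset.sum_nonneg fun _ hp => mul_nonneg (hq.windowWeight_nonneg hp) (sq_nonneg _)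

theorem norm_avgControl_sub_meanGrad_sq_le (h : Fin N → Vec d → Vec d) (S : ServerState N d) :
    ‖S.avgControl - meanGrad h S.model‖ ^ 2 ≤ controlError h S := by
  rw [ServerState.avgControl, meanGrad, ← smul_sub, ← Finset.sum_sub_distrib, Finset.smul_sum]
  refine (norm_sum_smul_sq_le univ fun i _ => by positivity).trans ?_
  rw [controlError, ← Finset.mul_sum]
  refine mul_le_of_le_one_left (by positivity) ?_
  simpa using mul_inv_le_one (a := (N : ℝ))

/-- An upper bound for the corrected gradient of client `i` at the start of a window, in terms of
the errors of the control variates and the full gradient. -/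
def startDirBound (h : Fin N → Vec d → Vec d) (S : ServerState N d) (i : Fin N) : ℝ :=
  ‖S.control i - h i S.model‖ + ‖S.avgControl - meanGrad h S.model‖ + ‖meanGrad h S.model‖

theorem startDirBound_nonneg (i : Fin N) : 0 ≤ startDirBound h S i := by
  unfold startDirBound
  positivity

theorem mean_startDirBound_sq_le (hN : 0 < N) :
    1 / (N : ℝ) * ∑ i, startDirBound h S i ^ 2 ≤
      6 * controlError h S + 3 * ‖meanGrad h S.model‖ ^ 2 := by
  calc 1 / (N : ℝ) * ∑ i, startDirBound h S i ^ 2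
      ≤ 1 / (N : ℝ) * ∑ i, (3 * ‖S.control i - h i S.model‖ ^ 2 +
          3 * (controlError h S + ‖meanGrad h S.model‖ ^ 2)) := by
        gcongr with i
        have h3 := norm_add₃_sq_le ‖S.control i - h i S.model‖
          ‖S.avgControl - meanGrad h S.model‖ ‖meanGrad h S.model‖
        simp only [Real.norm_eq_abs, sq_abs] at h3
        rw [startDirBound]
        linarith [norm_avgControl_sub_meanGrad_sq_le h S]
    _ = _ := by
        rw [Finset.sum_add_distrib, ← Finset.mul_sum, controlError]
        simp only [Finset.sum_const, Finset.card_univ, Fintype.card_fin, nsmul_eq_mul]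
        field_simp
        ring

theorem RegularWindow.norm_windowStep_control_sub_sq_le (hq : RegularWindow P ρ q r₀) (hP : 0 < P)
    (hI : 0 < I) (i : Fin N) (y : Vec d) :
    ‖(windowStep η γ P I g q r₀ S).control i - y‖ ^ 2 ≤ N / (P * I) *
      ∑ j ∈ range P, q (r₀ + j) i * ∑ k ∈ range I, ‖windowGrad η I g q S r₀ j i k - y‖ ^ 2 := by
  have hN := hq.clients_pos hP
  have hweights : ∑ p ∈ range P ×ˢ range I, (N : ℝ) / (P * I) * q (r₀ + p.1) i = 1 := by
    rw [Finset.sum_product, ← Finset.sum_comm]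
    simp only [← Finset.mul_sum, sum_weights_of_qBar hP (hq.qBar_eq i), Finset.sum_const,
      Finset.card_range, nsmul_eq_mul]
    field_simp
  have hcontrol : (windowStep η γ P I g q r₀ S).control i - y =
      ∑ p ∈ range P ×ˢ range I, ((N : ℝ) / (P * I) * q (r₀ + p.1) i) •
        (windowGrad η I g q S r₀ p.1 i p.2 - y) := by
    simp_rw [smul_sub]
    rw [Finset.sum_sub_distrib, ← Finset.sum_smul, hweights, one_smul,
      windowStep_control hN (hq.qBar_eq i), Finset.sum_product]
    simp_rw [Finset.smul_sum, smul_smul]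
  rw [hcontrol]
  refine (norm_sum_smul_sq_le _ fun p hp => mul_nonneg (by positivity)
    (hq.nonneg _ (Finset.mem_range.1 (Finset.mem_product.1 hp).1) i)).trans (le_of_eq ?_)
  rw [hweights, one_mul, Finset.sum_product]
  simp_rw [Finset.mul_sum, mul_assoc]

variable (hL : ∀ i x y, ‖h i x - h i y‖ ≤ L * ‖x - y‖)

include hL

theorem norm_windowDir_le (j : ℕ) (i : Fin N) (k : ℕ) :
    ‖windowDir η I g q S r₀ j i k‖ ≤
      ‖windowNoise η I g h q S r₀ j i k‖ + startDirBound h S i +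
        L * ‖windowIter η I g q S r₀ j i k - S.model‖ := by
  have hsplit : windowDir η I g q S r₀ j i k = windowNoise η I g h q S r₀ j i k +
      ((h i S.model - S.control i) + (S.avgControl - meanGrad h S.model) + meanGrad h S.model) +
        (h i (windowIter η I g q S r₀ j i k) - h i S.model) := by
    simp only [windowDir, windowNoise]
    abel
  rw [hsplit, startDirBound, norm_sub_rev (S.control i)]
  refine norm_add₃_le.trans ?_
  gcongr
  exacts [norm_add₃_le, hL _ _ _]

variable (hq : RegularWindow P ρ q r₀) (hP : 0 < P) (hI : 0 < I)

include hq hP hI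

theorem windowDrift_le (hη : 0 ≤ η) (hL0 : 0 ≤ L) (hηL : 4 * (η * P * I * L) ≤ 1) :
    windowDrift η P I g q S r₀ ≤ 216 * (η * P * I) ^ 2 *
      (windowNoiseSq η P I g h q S r₀ + controlError h S + ‖meanGrad h S.model‖ ^ 2) := by
  have hdrift := sum_norm_windowIter_sub_model_sq_le hq hη hL0 hηL
    (b := fun j i k => ‖windowNoise η I g h q S r₀ j i k‖ + startDirBound h S i)
    (fun j i k => add_nonneg (norm_nonneg _) (startDirBound_nonneg i))
    (fun j _ i k _ => norm_windowDir_le hL j i k) hP hI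
  refine hdrift.trans ?_
  calc _ ≤ 18 * (η * P * I) ^ 2 * ∑ p ∈ windowIdx N P I, windowWeight P I q r₀ p *
        (2 * (‖windowNoise η I g h q S r₀ p.1 p.2.1 p.2.2‖ ^ 2 + startDirBound h S p.2.1 ^ 2)) := by
        gcongr with p hp
        exacts [hq.windowWeight_nonneg hp, add_sq_le]
    _ = 36 * (η * P * I) ^ 2 * (windowNoiseSq η P I g h q S r₀ +
          1 / (N : ℝ) * ∑ i, startDirBound h S i ^ 2) := by
        simp_rw [windowNoiseSq, mul_left_comm (windowWeight P I q r₀ _), ← Finset.mul_sum,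
          mul_add, Finset.sum_add_distrib]
        rw [show ∑ p ∈ windowIdx N P I, windowWeight P I q r₀ p * startDirBound h S p.2.1 ^ 2 =
          1 / (N : ℝ) * ∑ i, startDirBound h S i ^ 2 from
          hq.sum_windowWeight_smul_client hP hI fun i => startDirBound h S i ^ 2]
        ring
    _ ≤ 36 * (η * P * I) ^ 2 * (6 * (windowNoiseSq η P I g h q S r₀ + controlError h S +
          ‖meanGrad h S.model‖ ^ 2)) := by
        gcongr
        linarith [mean_startDirBound_sq_le (h := h) (S := S) (hq.clients_pos hP),
          hq.windowNoiseSq_nonneg (η := η) (I := I) (g := g) (h := h) (S := S),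
          sq_nonneg ‖meanGrad h S.model‖]
    _ = _ := by ring

theorem norm_windowGradMean_sub_sq_le :
    ‖windowGradMean η P I g q S r₀ - meanGrad h S.model - windowNoiseMean η P I g h q S r₀‖ ^ 2 ≤
      L ^ 2 * windowDrift η P I g q S r₀ := by
  have hsum : windowGradMean η P I g q S r₀ - meanGrad h S.model -
      windowNoiseMean η P I g h q S r₀ = ∑ p ∈ windowIdx N P I, windowWeight P I q r₀ p •
        (h p.2.1 (windowIter η I g q S r₀ p.1 p.2.1 p.2.2) - h p.2.1 S.model) := by
    rw [meanGrad, ← hq.sum_windowWeight_smul_client hP hI, windowGradMean, windowNoiseMean,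
      ← Finset.sum_sub_distrib, ← Finset.sum_sub_distrib]
    refine Finset.sum_congr rfl fun p _ => ?_
    rw [windowNoise]
    module
  rw [hsum]
  refine (norm_sum_smul_sq_le _ fun p hp => hq.windowWeight_nonneg hp).trans ?_
  rw [hq.sum_windowWeight hP hI, one_mul, windowDrift, Finset.mul_sum]
  refine Finset.sum_le_sum fun p hp => ?_
  have hw := hq.windowWeight_nonneg hp
  calc _ ≤ windowWeight P I q r₀ p *
        (L * ‖windowIter η I g q S r₀ p.1 p.2.1 p.2.2 - S.model‖) ^ 2 := by
        gcongr
        exact hL _ _ _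
    _ = _ := by ring

theorem norm_windowGradMean_sq_le :
    ‖windowGradMean η P I g q S r₀‖ ^ 2 ≤ 3 * (‖meanGrad h S.model‖ ^ 2 +
      L ^ 2 * windowDrift η P I g q S r₀ + ‖windowNoiseMean η P I g h q S r₀‖ ^ 2) := by
  have hsplit : windowGradMean η P I g q S r₀ = meanGrad h S.model +
      (windowGradMean η P I g q S r₀ - meanGrad h S.model - windowNoiseMean η P I g h q S r₀) +
        windowNoiseMean η P I g h q S r₀ := by abel
  conv_lhs => rw [hsplit]
  refine (norm_add₃_sq_le _ _ _).trans ?_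
  gcongr
  exact norm_windowGradMean_sub_sq_le hL hq hP hI

theorem controlError_windowStep_le :
    controlError h (windowStep η γ P I g q r₀ S) ≤
      3 * (windowNoiseSq η P I g h q S r₀ + L ^ 2 * windowDrift η P I g q S r₀ +
        L ^ 2 * ‖(windowStep η γ P I g q r₀ S).model - S.model‖ ^ 2) := by
  set x' := (windowStep η γ P I g q r₀ S).model
  set E : ℕ → Fin N → ℕ → ℝ := fun j i k => 3 * (‖windowNoise η I g h q S r₀ j i k‖ ^ 2 +
    L ^ 2 * ‖windowIter η I g q S r₀ j i k - S.model‖ ^ 2 + L ^ 2 * ‖x' - S.model‖ ^ 2) with hE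
  have hN : (N : ℝ) ≠ 0 := Nat.cast_ne_zero.2 (hq.clients_pos hP).ne'
  have hgrad : ∀ j i k, ‖windowGrad η I g q S r₀ j i k - h i x'‖ ^ 2 ≤ E j i k := by
    intro j i k
    have hsplit : windowGrad η I g q S r₀ j i k - h i x' = windowNoise η I g h q S r₀ j i k +
        (h i (windowIter η I g q S r₀ j i k) - h i S.model) + (h i S.model - h i x') := by
      rw [windowNoise]
      abel
    rw [hsplit]
    refine (norm_add₃_sq_le _ _ _).trans ?_
    rw [hE, norm_sub_rev x']
    simp only [← mul_pow]
    gcongr <;> exact hL _ _ _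
  calc controlError h (windowStep η γ P I g q r₀ S)
      ≤ 1 / (N : ℝ) * ∑ i, N / (P * I) * ∑ j ∈ range P, q (r₀ + j) i * ∑ k ∈ range I, E j i k := by
        unfold controlError
        gcongr 1 / (N : ℝ) * ∑ i, ?_ with i
        refine (hq.norm_windowStep_control_sub_sq_le hP hI i _).trans ?_
        gcongr with j hj k
        exacts [hq.nonneg j (Finset.mem_range.1 hj) i, hgrad j i k]
    _ = ∑ p ∈ windowIdx N P I, windowWeight P I q r₀ p * E p.1 p.2.1 p.2.2 := by
        rw [sum_windowWeight_mul E, Finset.sum_comm, ← Finset.mul_sum]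
        field_simp
    _ = 3 * (windowNoiseSq η P I g h q S r₀ + L ^ 2 * windowDrift η P I g q S r₀ +
          L ^ 2 * ‖x' - S.model‖ ^ 2 * ∑ p ∈ windowIdx N P I, windowWeight P I q r₀ p) := by
        rw [windowNoiseSq, windowDrift, Finset.mul_sum, Finset.mul_sum, ← Finset.sum_add_distrib,
          ← Finset.sum_add_distrib, Finset.mul_sum]
        refine Finset.sum_congr rfl fun p _ => ?_
        simp only [hE]
        ring
    _ = _ := by rw [hq.sum_windowWeight hP hI, mul_one]

theorem objective_windowStep_le {f : Vec d → ℝ}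
    (hf : ∀ x y, f y ≤ f x + ⟪meanGrad h x, y - x⟫_ℝ + L * ‖y - x‖ ^ 2)
    {γ' : ℝ} (hγ' : γ' = γ * η * P * I) (hγ0 : 0 ≤ γ') :
    f (windowStep η γ P I g q r₀ S).model ≤ f S.model -
      γ' * (3 / 4 * ‖meanGrad h S.model‖ ^ 2 - L ^ 2 * windowDrift η P I g q S r₀ +
        ⟪meanGrad h S.model, windowNoiseMean η P I g h q S r₀⟫_ℝ) +
      L * γ' ^ 2 * ‖windowGradMean η P I g q S r₀‖ ^ 2 := by
  have hdescent := hf S.model (windowStep η γ P I g q r₀ S).model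
  rw [hq.windowStep_model hP hI, ← hγ', sub_sub_cancel_left, norm_neg, norm_smul, mul_pow,
    Real.norm_eq_abs, sq_abs, inner_neg_right, real_inner_smul_right] at hdescent
  rw [hq.windowStep_model hP hI, ← hγ']
  set a := meanGrad h S.model
  set n := windowNoiseMean η P I g h q S r₀
  set e := windowGradMean η P I g q S r₀ - a - n with he
  have he_sq : ‖e‖ ^ 2 ≤ L ^ 2 * windowDrift η P I g q S r₀ :=
    norm_windowGradMean_sub_sq_le hL hq hP hI
  have hinner : ⟪a, windowGradMean η P I g q S r₀⟫_ℝ = ‖a‖ ^ 2 + ⟪a, e⟫_ℝ + ⟪a, n⟫_ℝ := by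
    rw [← real_inner_self_eq_norm_sq, ← inner_add_right, ← inner_add_right, he]
    congr 1
    abel
  have hinner_ge : 3 / 4 * ‖a‖ ^ 2 - L ^ 2 * windowDrift η P I g q S r₀ + ⟪a, n⟫_ℝ ≤
      ⟪a, windowGradMean η P I g q S r₀⟫_ℝ := by
    have hae := abs_le.1 (abs_real_inner_le_norm a e)
    nlinarith [sq_nonneg (‖a‖ / 2 - ‖e‖)]
  linarith [mul_le_mul_of_nonneg_left hinner_ge hγ0]

end Pathwise

/-! ### Square-integrable random vectors -/

section L2

variable {Z V : Type*} [MeasurableSpace Z] {π : Measure Z} [NormedAddCommGroup V]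

theorem integrable_inner_of_memLp_two [InnerProductSpace ℝ V] {f g : Z → V}
    (hf : MemLp f 2 π) (hg : MemLp g 2 π) : Integrable (fun z => ⟪f z, g z⟫_ℝ) π :=
  (hf.norm.integrable_mul hg.norm).mono' (hf.1.inner hg.1)
    (Filter.Eventually.of_forall fun _ => norm_inner_le_norm _ _)

theorem integrable_norm_sq_of_memLp_two {f : Z → V} (hf : MemLp f 2 π) :
    Integrable (fun z => ‖f z‖ ^ 2) π :=
  (memLp_two_iff_integrable_sq_norm hf.1).1 hf

theorem integral_norm_sq_le_of_lintegral {f : Z → V} {s : ℝ} (hs : 0 ≤ s)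
    (hf : AEStronglyMeasurable f π) (h : ∫⁻ z, ‖f z‖ₑ ^ 2 ∂π ≤ ENNReal.ofReal s) :
    ∫ z, ‖f z‖ ^ 2 ∂π ≤ s := by
  rw [integral_eq_lintegral_of_nonneg_ae (Filter.Eventually.of_forall fun z => sq_nonneg _)
    (hf.norm.pow 2)]
  refine ENNReal.toReal_le_of_le_ofReal hs ((lintegral_congr fun z => ?_).trans_le h)
  rw [ENNReal.ofReal_pow (norm_nonneg _), ofReal_norm]

theorem continuous_of_norm_sub_le {W : Type*} [NormedAddCommGroup W] {h : V → W} {L : ℝ}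
    (hL : ∀ x y, ‖h x - h y‖ ≤ L * ‖x - y‖) : Continuous h := by
  refine (LipschitzWith.of_dist_le_mul (K := L.toNNReal) fun x y => ?_).continuous
  rw [dist_eq_norm, dist_eq_norm]
  exact (hL x y).trans (by gcongr; exact Real.le_coe_toNNReal L)

theorem memLp_comp_of_norm_sub_le [IsFiniteMeasure π] {W : Type*} [NormedAddCommGroup W]
    {h : V → W} {L : ℝ} (hL : ∀ x y, ‖h x - h y‖ ≤ L * ‖x - y‖) {p : ℝ≥0∞} {f : Z → V}
    (hf : MemLp f p π) : MemLp (fun z => h (f z)) p π := by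
  have hsub : MemLp (fun z => h (f z) - h 0) p π := by
    refine hf.of_le_mul (((continuous_of_norm_sub_le hL).comp_aestronglyMeasurable hf.1).sub
      aestronglyMeasurable_const) (c := L) (Filter.Eventually.of_forall fun z => ?_)
    simpa using hL (f z) 0
  simpa [Pi.add_def] using hsub.add (memLp_const (h 0))

theorem memLp_fun_const_smul [NormedSpace ℝ V] {p : ℝ≥0∞} {f : Z → V} (hf : MemLp f p π)
    (c : ℝ) : MemLp (fun z => c • f z) p π :=
  hf.const_smul c

theorem memLp_fun_sum_smul [NormedSpace ℝ V] {p : ℝ≥0∞} {ι : Type*} (s : Finset ι) (c : ι → ℝ)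
    {n : ι → Z → V} (hn : ∀ i ∈ s, MemLp (n i) p π) : MemLp (fun z => ∑ i ∈ s, c i • n i z) p π :=
  memLp_finsetSum _ fun i hi => memLp_fun_const_smul (hn i hi) (c i)

theorem integral_norm_sq_sum_of_orthogonal [InnerProductSpace ℝ V] {ι : Type*} (s : Finset ι)
    {n : ι → Z → V} (hn : ∀ p ∈ s, MemLp (n p) 2 π)
    (ho : ∀ p ∈ s, ∀ p' ∈ s, p ≠ p' → ∫ z, ⟪n p z, n p' z⟫_ℝ ∂π = 0) :
    ∫ z, ‖∑ p ∈ s, n p z‖ ^ 2 ∂π = ∑ p ∈ s, ∫ z, ‖n p z‖ ^ 2 ∂π := by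
  have hint : ∀ p ∈ s, ∀ p' ∈ s, Integrable (fun z => ⟪n p z, n p' z⟫_ℝ) π :=
    fun p hp p' hp' => integrable_inner_of_memLp_two (hn p hp) (hn p' hp')
  simp_rw [← real_inner_self_eq_norm_sq, sum_inner, inner_sum]
  rw [integral_finsetSum _ fun p hp => integrable_finsetSum _ (hint p hp)]
  refine Finset.sum_congr rfl fun p hp => ?_
  rw [integral_finsetSum _ (hint p hp)]
  exact Finset.sum_eq_single_of_mem p hp fun p' hp' hne => ho p hp p' hp' hne.symm

theorem integral_norm_sq_sum_smul_le [InnerProductSpace ℝ V] {ι : Type*} (s : Finset ι) {c : ι → ℝ}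
    {n : ι → Z → V} {b : ℝ} (hn : ∀ p ∈ s, MemLp (n p) 2 π)
    (ho : ∀ p ∈ s, ∀ p' ∈ s, p ≠ p' → ∫ z, ⟪n p z, n p' z⟫_ℝ ∂π = 0)
    (hb : ∀ p ∈ s, ∫ z, ‖n p z‖ ^ 2 ∂π ≤ b) :
    ∫ z, ‖∑ p ∈ s, c p • n p z‖ ^ 2 ∂π ≤ b * ∑ p ∈ s, c p ^ 2 := by
  rw [integral_norm_sq_sum_of_orthogonal s (fun p hp => memLp_fun_const_smul (hn p hp) (c p))
    fun p hp p' hp' hne => by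
      simp_rw [real_inner_smul_left, real_inner_smul_right, integral_const_mul,
        ho p hp p' hp' hne, mul_zero], Finset.mul_sum]
  refine Finset.sum_le_sum fun p hp => ?_
  simp_rw [norm_smul, mul_pow, integral_const_mul, Real.norm_eq_abs, sq_abs]
  rw [mul_comm]
  exact mul_le_mul_of_nonneg_right (hb p hp) (sq_nonneg _)

end L2

/-! ### Resampling one coordinate -/

section Resample

variable {Z Ξ V : Type*} [MeasurableSpace Z] [MeasurableSpace Ξ] {π : Measure Z} {D : Measure Ξ}
  [NormedAddCommGroup V] {τ : Z × Ξ → Z} {s : Z → Ξ} {X : Z → V} {G : Ξ → V → V} {h : V → V} {σ : ℝ}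

theorem lintegral_noise_sq_le [SFinite D] [IsProbabilityMeasure π]
    (hτ : MeasurePreserving τ (π.prod D) π)
    (hs : ∀ z y, s (τ (z, y)) = y) (hX : ∀ z y, X (τ (z, y)) = X z)
    (hm : Measurable fun z => ‖G (s z) (X z) - h (X z)‖ₑ)
    (hv : ∀ x, ∫⁻ y, ‖G y x - h x‖ₑ ^ 2 ∂D ≤ ENNReal.ofReal (σ ^ 2)) :
    ∫⁻ z, ‖G (s z) (X z) - h (X z)‖ₑ ^ 2 ∂π ≤ ENNReal.ofReal (σ ^ 2) := by
  rw [← hτ.lintegral_comp (hm.pow_const 2), lintegral_prod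
    (fun p => ‖G (s (τ p)) (X (τ p)) - h (X (τ p))‖ₑ ^ 2) ((hm.pow_const 2).comp
    hτ.measurable).aemeasurable]
  simp only [hs, hX]
  calc _ ≤ ∫⁻ _z, ENNReal.ofReal (σ ^ 2) ∂π := lintegral_mono fun z => hv _
    _ = _ := by simp

theorem integral_inner_noise_eq_zero [SFinite π] [IsProbabilityMeasure D] [InnerProductSpace ℝ V]
    [CompleteSpace V] {Y : Z → V}
    (hτ : MeasurePreserving τ (π.prod D) π)
    (hs : ∀ z y, s (τ (z, y)) = y) (hX : ∀ z y, X (τ (z, y)) = X z)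
    (hY : ∀ z y, Y (τ (z, y)) = Y z) (hYL : MemLp Y 2 π)
    (hn : MemLp (fun z => G (s z) (X z) - h (X z)) 2 π)
    (hi : ∀ x, Integrable (fun y => G y x) D) (hG : ∀ x, ∫ y, G y x ∂D = h x) :
    ∫ z, ⟪Y z, G (s z) (X z) - h (X z)⟫_ℝ ∂π = 0 := by
  have hint := integrable_inner_of_memLp_two hYL hn
  have hpull : ∫ z, ⟪Y z, G (s z) (X z) - h (X z)⟫_ℝ ∂π =
      ∫ p, ⟪Y (τ p), G (s (τ p)) (X (τ p)) - h (X (τ p))⟫_ℝ ∂(π.prod D) := by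
    conv_lhs => rw [← hτ.map_eq]
    exact integral_map hτ.aemeasurable (by rw [hτ.map_eq]; exact hint.aestronglyMeasurable)
  rw [hpull, integral_prod (fun p => ⟪Y (τ p), G (s (τ p)) (X (τ p)) - h (X (τ p))⟫_ℝ)
    (hτ.integrable_comp_of_integrable hint)]
  simp only [hs, hX, hY]
  refine integral_eq_zero_of_ae (Filter.Eventually.of_forall fun z => ?_)
  simp only [Pi.zero_apply]
  rw [integral_inner (f := fun y => G y (X z) - h (X z)) ((hi _).sub (integrable_const _)),
    integral_sub (hi _) (integrable_const _), hG]
  simp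

end Resample

/-- Unbiased stochastic gradients `G` of variance at most `σ²` for Lipschitz local gradients `h`. -/
structure GradOracle {N d : ℕ} {Ξ : Type*} [MeasurableSpace Ξ] (G : Fin N → Ξ → Vec d → Vec d)
    (h : Fin N → Vec d → Vec d) (D : Fin N → Measure Ξ) (L σ : ℝ) : Prop where
  measurable : ∀ i, Measurable (fun p : Vec d × Ξ => G i p.2 p.1)
  integral_eq : ∀ i x, ∫ ξ, G i ξ x ∂(D i) = h i x
  variance : ∀ i x, ∫⁻ ξ, ‖G i ξ x - h i x‖ₑ ^ 2 ∂(D i) ≤ ENNReal.ofReal (σ ^ 2)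
  lipschitz : ∀ i x y, ‖h i x - h i y‖ ≤ L * ‖x - y‖

/-- `τ r k i (z, y)` replaces the sample `ξ z r k i` by `y` and keeps all others; replacing it by
an independent sample of `D i` does not change the law. -/
structure Resampling {Z Ξ : Type*} [MeasurableSpace Z] [MeasurableSpace Ξ] {N : ℕ} (π : Measure Z)
    (D : Fin N → Measure Ξ) (R I : ℕ) (ξ : Z → ℕ → ℕ → Fin N → Ξ)
    (τ : ℕ → ℕ → Fin N → Z × Ξ → Z) : Prop where
  measurable : ∀ r k i, Measurable (fun z => ξ z r k i)
  measurePreserving : ∀ r < R, ∀ k < I, ∀ i, MeasurePreserving (τ r k i) (π.prod (D i)) π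
  apply_same : ∀ r < R, ∀ k < I, ∀ i z y, ξ (τ r k i (z, y)) r k i = y
  apply_other : ∀ r < R, ∀ k < I, ∀ i r' k' i', (r', k', i') ≠ (r, k, i) → ∀ z y,
    ξ (τ r k i (z, y)) r' k' i' = ξ z r' k' i'

/-- A square-integrable server state that depends only on the samples before round `r₀`. -/
structure AdaptedState {Z Ξ : Type*} [MeasurableSpace Z] {N d : ℕ} (π : Measure Z)
    (R I : ℕ) (τ : ℕ → ℕ → Fin N → Z × Ξ → Z) (r₀ : ℕ) (T : Z → ServerState N d) : Prop where
  measurable : MeasurableState T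
  memLp_model : MemLp (fun z => (T z).model) 2 π
  memLp_control : ∀ i, MemLp (fun z => (T z).control i) 2 π
  invariant : ∀ r, r₀ ≤ r → r < R → ∀ k < I, ∀ i z y, T (τ r k i (z, y)) = T z

theorem AdaptedState.memLp_avgControl {Z Ξ : Type*} [MeasurableSpace Z] {N d : ℕ}
    {π : Measure Z} {R I : ℕ} {τ : ℕ → ℕ → Fin N → Z × Ξ → Z} {r₀ : ℕ} {T : Z → ServerState N d}
    (hT : AdaptedState π R I τ r₀ T) :
    MemLp (fun z => (T z).avgControl) 2 π :=
  memLp_fun_const_smul (f := fun z => ∑ i, (T z).control i)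
    (memLp_finsetSum _ fun i _ => hT.memLp_control i) (1 / (N : ℝ))

section Noise

variable {Z Ξ : Type*} [MeasurableSpace Z] [MeasurableSpace Ξ] {N d : ℕ} {π : Measure Z}
  {D : Fin N → Measure Ξ}
  {P R I r₀ : ℕ} {ξ : Z → ℕ → ℕ → Fin N → Ξ} {τ : ℕ → ℕ → Fin N → Z × Ξ → Z}
  {G : Fin N → Ξ → Vec d → Vec d} {h : Fin N → Vec d → Vec d} {L σ η γ : ℝ}
  {q : ℕ → Fin N → ℝ} {T : Z → ServerState N d}

/-- The stochastic gradients computed with the samples `ξ`. -/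
def sampleGrad (G : Fin N → Ξ → Vec d → Vec d) (ξ : ℕ → ℕ → Fin N → Ξ) :
    Fin N → ℕ → ℕ → Vec d → Vec d :=
  fun i r k => G i (ξ r k i)

theorem GradOracle.integrable [∀ i, IsFiniteMeasure (D i)] (hG : GradOracle G h D L σ) (i : Fin N)
    (x : Vec d) : Integrable (fun y => G i y x) (D i) :=
  (memLp_two_of_lintegral_sub_lt_top
    ((hG.measurable i).comp (measurable_const.prodMk measurable_id)).aestronglyMeasurable
    ((hG.variance i x).trans_lt ENNReal.ofReal_lt_top)).integrable one_le_two

theorem GradOracle.continuous (hG : GradOracle G h D L σ) (i : Fin N) : Continuous (h i) :=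
  continuous_of_norm_sub_le (hG.lipschitz i)

theorem measurable_sampleGrad (hG : GradOracle G h D L σ) (hξ : Resampling π D R I ξ τ)
    (i : Fin N) (r k : ℕ) : Measurable fun p : Z × Vec d => sampleGrad G (ξ p.1) i r k p.2 :=
  (hG.measurable i).comp (measurable_snd.prodMk ((hξ.measurable r k i).comp measurable_fst))

theorem measurable_windowIter (hG : GradOracle G h D L σ) (hξ : Resampling π D R I ξ τ)
    (hT : AdaptedState π R I τ r₀ T) (j : ℕ) (i : Fin N) (k : ℕ) :
    Measurable fun z => windowIter η I (sampleGrad G (ξ z)) q (T z) r₀ j i k :=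
  measurable_clientIter (g := fun z => sampleGrad G (ξ z))
    (fun k => measurable_sampleGrad hG hξ i _ k) hT.measurable
    (measurable_windowModel (g := fun z => sampleGrad G (ξ z)) (q := fun _ => q)
      (measurable_sampleGrad hG hξ) (fun _ _ => measurable_const)
      hT.measurable r₀ j) k

theorem measurable_windowGrad (hG : GradOracle G h D L σ) (hξ : Resampling π D R I ξ τ)
    (hT : AdaptedState π R I τ r₀ T) (j : ℕ) (i : Fin N) (k : ℕ) :
    Measurable fun z => windowGrad η I (sampleGrad G (ξ z)) q (T z) r₀ j i k :=
  (measurable_sampleGrad hG hξ i _ k).comp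
    (measurable_id.prodMk (measurable_windowIter hG hξ hT j i k))

theorem measurable_windowNoise (hG : GradOracle G h D L σ) (hξ : Resampling π D R I ξ τ)
    (hT : AdaptedState π R I τ r₀ T) (j : ℕ) (i : Fin N) (k : ℕ) :
    Measurable fun z => windowNoise η I (sampleGrad G (ξ z)) h q (T z) r₀ j i k :=
  (measurable_windowGrad hG hξ hT j i k).sub
    ((hG.continuous i).measurable.comp (measurable_windowIter hG hξ hT j i k))

theorem windowIter_invariant (hξ : Resampling π D R I ξ τ) (hT : AdaptedState π R I τ r₀ T)
    {j k r' k' : ℕ} {i i' : Fin N} (hr' : r' < R) (hk' : k' < I)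
    (hlt : r₀ + j < r' ∨ r₀ + j = r' ∧ k ≤ k') (z : Z) (y : Ξ) :
    windowIter η I (sampleGrad G (ξ (τ r' k' i' (z, y)))) q (T (τ r' k' i' (z, y))) r₀ j i k =
      windowIter η I (sampleGrad G (ξ z)) q (T z) r₀ j i k := by
  rw [hT.invariant r' (by lia) hr' k' hk']
  have hg : ∀ i r k, (r < r' ∨ r = r' ∧ k < k') →
      sampleGrad G (ξ (τ r' k' i' (z, y))) i r k = sampleGrad G (ξ z) i r k := by
    intro i r k hrk
    unfold sampleGrad
    rw [hξ.apply_other r' hr' k' hk']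
    rintro ⟨⟩
    lia
  rw [windowIter, windowIter, windowModel_congr (fun i r _ hr k _ => hg i r k (by lia))
    (fun _ _ _ => rfl), clientIter, clientIter,
    localIter_congr fun k'' hk'' => hg i _ _ (by lia)]

theorem windowNoise_invariant (hξ : Resampling π D R I ξ τ) (hT : AdaptedState π R I τ r₀ T)
    {j k r' k' : ℕ} {i i' : Fin N} (hr' : r' < R) (hk' : k' < I)
    (hlt : r₀ + j < r' ∨ r₀ + j = r' ∧ k ≤ k') (hne : (r₀ + j, k, i) ≠ (r', k', i'))
    (z : Z) (y : Ξ) :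
    windowNoise η I (sampleGrad G (ξ (τ r' k' i' (z, y)))) h q (T (τ r' k' i' (z, y))) r₀ j i k =
      windowNoise η I (sampleGrad G (ξ z)) h q (T z) r₀ j i k := by
  rw [windowNoise, windowNoise, windowGrad, windowGrad, windowIter_invariant hξ hT hr' hk' hlt]
  unfold sampleGrad
  rw [hξ.apply_other r' hr' k' hk' _ _ _ _ hne]

variable [IsProbabilityMeasure π] [∀ i, IsProbabilityMeasure (D i)]

theorem lintegral_windowNoise_sq_le (hG : GradOracle G h D L σ) (hξ : Resampling π D R I ξ τ)
    (hT : AdaptedState π R I τ r₀ T) {j k : ℕ} (hj : r₀ + j < R) (hk : k < I) (i : Fin N) :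
    ∫⁻ z, ‖windowNoise η I (sampleGrad G (ξ z)) h q (T z) r₀ j i k‖ₑ ^ 2 ∂π ≤
      ENNReal.ofReal (σ ^ 2) :=
  lintegral_noise_sq_le (G := G i) (h := h i) (hξ.measurePreserving _ hj _ hk i)
    (hξ.apply_same _ hj _ hk i)
    (windowIter_invariant hξ hT hj hk (Or.inr ⟨rfl, le_rfl⟩))
    (measurable_windowNoise hG hξ hT j i k).enorm (hG.variance i)

theorem memLp_windowNoise (hG : GradOracle G h D L σ) (hξ : Resampling π D R I ξ τ)
    (hT : AdaptedState π R I τ r₀ T) {j k : ℕ} (hj : r₀ + j < R) (hk : k < I) (i : Fin N) :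
    MemLp (fun z => windowNoise η I (sampleGrad G (ξ z)) h q (T z) r₀ j i k) 2 π :=
  (memLp_two_iff_lintegral_lt_top
    (measurable_windowNoise hG hξ hT j i k).aestronglyMeasurable).2
    ((lintegral_windowNoise_sq_le hG hξ hT hj hk i).trans_lt ENNReal.ofReal_lt_top)

theorem integral_windowNoise_sq_le (hG : GradOracle G h D L σ) (hξ : Resampling π D R I ξ τ)
    (hT : AdaptedState π R I τ r₀ T) {j k : ℕ} (hj : r₀ + j < R) (hk : k < I) (i : Fin N) :
    ∫ z, ‖windowNoise η I (sampleGrad G (ξ z)) h q (T z) r₀ j i k‖ ^ 2 ∂π ≤ σ ^ 2 :=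
  integral_norm_sq_le_of_lintegral (sq_nonneg σ)
    (measurable_windowNoise hG hξ hT j i k).aestronglyMeasurable
    (lintegral_windowNoise_sq_le hG hξ hT hj hk i)

theorem integral_inner_windowNoise (hG : GradOracle G h D L σ) (hξ : Resampling π D R I ξ τ)
    (hT : AdaptedState π R I τ r₀ T) {j k : ℕ} (hj : r₀ + j < R) (hk : k < I) (i : Fin N)
    {Y : Z → Vec d} (hY : MemLp Y 2 π) (hYτ : ∀ z y, Y (τ (r₀ + j) k i (z, y)) = Y z) :
    ∫ z, ⟪Y z, windowNoise η I (sampleGrad G (ξ z)) h q (T z) r₀ j i k⟫_ℝ ∂π = 0 :=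
  integral_inner_noise_eq_zero (G := G i) (h := h i) (hξ.measurePreserving _ hj _ hk i)
    (hξ.apply_same _ hj _ hk i)
    (windowIter_invariant hξ hT hj hk (Or.inr ⟨rfl, le_rfl⟩)) hYτ hY
    (memLp_windowNoise hG hξ hT hj hk i) (hG.integrable i) (hG.integral_eq i)

theorem integral_inner_windowNoise_windowNoise (hG : GradOracle G h D L σ)
    (hξ : Resampling π D R I ξ τ) (hT : AdaptedState π R I τ r₀ T) {j k j' k' : ℕ} {i i' : Fin N}
    (hj : r₀ + j < R) (hk : k < I) (hj' : r₀ + j' < R) (hk' : k' < I)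
    (hne : (j, i, k) ≠ (j', i', k')) :
    ∫ z, ⟪windowNoise η I (sampleGrad G (ξ z)) h q (T z) r₀ j i k,
      windowNoise η I (sampleGrad G (ξ z)) h q (T z) r₀ j' i' k'⟫_ℝ ∂π = 0 := by
  have hne' : (r₀ + j, k, i) ≠ (r₀ + j', k', i') := by
    simp only [ne_eq, Prod.mk.injEq, add_right_inj] at hne ⊢
    tauto
  rcases (by lia : (r₀ + j < r₀ + j' ∨ r₀ + j = r₀ + j' ∧ k ≤ k') ∨
      (r₀ + j' < r₀ + j ∨ r₀ + j' = r₀ + j ∧ k' ≤ k)) with hlt | hlt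
  · exact integral_inner_windowNoise hG hξ hT hj' hk' i' (memLp_windowNoise hG hξ hT hj hk i)
      (windowNoise_invariant hξ hT hj' hk' hlt hne')
  · refine (integral_congr_ae (Filter.Eventually.of_forall fun z => real_inner_comm _ _)).trans ?_
    exact integral_inner_windowNoise hG hξ hT hj hk i (memLp_windowNoise hG hξ hT hj' hk' i')
      (windowNoise_invariant hξ hT hj hk hlt hne'.symm)

theorem memLp_windowGrad_of_windowIter (hG : GradOracle G h D L σ) (hξ : Resampling π D R I ξ τ)
    (hT : AdaptedState π R I τ r₀ T) {j k : ℕ} (hj : r₀ + j < R) (hk : k < I) (i : Fin N)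
    (hi : MemLp (fun z => windowIter η I (sampleGrad G (ξ z)) q (T z) r₀ j i k) 2 π) :
    MemLp (fun z => windowGrad η I (sampleGrad G (ξ z)) q (T z) r₀ j i k) 2 π := by
  have := (memLp_windowNoise (η := η) (q := q) hG hξ hT hj hk i).add
    (memLp_comp_of_norm_sub_le (hG.lipschitz i) hi)
  simpa only [windowNoise, Pi.add_def, sub_add_cancel] using this

theorem memLp_windowIter_of_windowModel (hG : GradOracle G h D L σ) (hξ : Resampling π D R I ξ τ)
    (hT : AdaptedState π R I τ r₀ T) {j : ℕ} (hj : r₀ + j < R)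
    (hX : MemLp (fun z => windowModel η I (sampleGrad G (ξ z)) q (T z) r₀ j) 2 π) (i : Fin N)
    {k : ℕ} (hk : k ≤ I) :
    MemLp (fun z => windowIter η I (sampleGrad G (ξ z)) q (T z) r₀ j i k) 2 π := by
  induction k with
  | zero => exact hX
  | succ k ih =>
    have hiter := ih (by lia)
    have hgrad := memLp_windowGrad_of_windowIter hG hξ hT hj (by lia) i hiter
    exact hiter.sub
      (memLp_fun_const_smul ((hgrad.sub (hT.memLp_control i)).add hT.memLp_avgControl) η)

theorem memLp_windowModel (hG : GradOracle G h D L σ) (hξ : Resampling π D R I ξ τ)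
    (hT : AdaptedState π R I τ r₀ T) {j : ℕ} (hj : r₀ + j ≤ R) :
    MemLp (fun z => windowModel η I (sampleGrad G (ξ z)) q (T z) r₀ j) 2 π := by
  induction j with
  | zero => exact hT.memLp_model
  | succ j ih =>
    have hX := ih (by lia)
    exact hX.add (memLp_fun_sum_smul _ (fun i => q (r₀ + j) i) fun i _ =>
      (memLp_windowIter_of_windowModel hG hξ hT (by lia) hX i le_rfl).sub hX)

theorem memLp_windowIter (hG : GradOracle G h D L σ) (hξ : Resampling π D R I ξ τ)
    (hT : AdaptedState π R I τ r₀ T) {j : ℕ} (hj : r₀ + j < R) (i : Fin N) {k : ℕ} (hk : k ≤ I) :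
    MemLp (fun z => windowIter η I (sampleGrad G (ξ z)) q (T z) r₀ j i k) 2 π :=
  memLp_windowIter_of_windowModel hG hξ hT hj (memLp_windowModel hG hξ hT hj.le) i hk

theorem memLp_windowGrad (hG : GradOracle G h D L σ) (hξ : Resampling π D R I ξ τ)
    (hT : AdaptedState π R I τ r₀ T) {j : ℕ} (hj : r₀ + j < R) (i : Fin N) {k : ℕ} (hk : k < I) :
    MemLp (fun z => windowGrad η I (sampleGrad G (ξ z)) q (T z) r₀ j i k) 2 π :=
  memLp_windowGrad_of_windowIter hG hξ hT hj hk i (memLp_windowIter hG hξ hT hj i hk.le)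

theorem AdaptedState.windowStep (hG : GradOracle G h D L σ) (hξ : Resampling π D R I ξ τ)
    (hT : AdaptedState π R I τ r₀ T) (hR : r₀ + P ≤ R) :
    AdaptedState π R I τ (r₀ + P)
      (fun z => windowStep η γ P I (sampleGrad G (ξ z)) q r₀ (T z)) where
  measurable := MeasurableState.windowStep (g := fun z => sampleGrad G (ξ z)) (q := fun _ => q)
    (measurable_sampleGrad hG hξ) (fun _ _ => measurable_const) hT.measurable r₀
  memLp_model := by
    refine hT.memLp_model.add (memLp_fun_const_smul (f := fun z => ∑ j ∈ range P,
      roundUpdate η I (sampleGrad G (ξ z)) q (T z) (r₀ + j)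
        (windowModel η I (sampleGrad G (ξ z)) q (T z) r₀ j)) (memLp_finsetSum _ fun j hj => ?_) γ)
    have hj := Finset.mem_range.1 hj
    exact memLp_fun_sum_smul _ (fun i => q (r₀ + j) i) fun i _ =>
      (memLp_windowIter hG hξ hT (by lia) i le_rfl).sub (memLp_windowModel hG hξ hT (by lia))
  memLp_control i := by
    by_cases hq : 0 < qBar P q r₀ i
    · simp only [AmpScaffold.windowStep, if_pos hq]
      refine memLp_fun_const_smul (memLp_fun_sum_smul _ (fun j => q (r₀ + j) i)
        (n := fun j z => ∑ k ∈ range I, windowGrad η I (sampleGrad G (ξ z)) q (T z) r₀ j i k)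
        fun j hj => memLp_finsetSum _ fun k hk => ?_) (1 / ((P : ℝ) * qBar P q r₀ i * (I : ℝ)))
      exact memLp_windowGrad hG hξ hT (by have := Finset.mem_range.1 hj; lia) i
        (Finset.mem_range.1 hk)
    · simp only [AmpScaffold.windowStep, if_neg hq]
      exact hT.memLp_control i
  invariant r hr hrR k hk i z y := by
    rw [hT.invariant r (by lia) hrR k hk]
    refine windowStep_congr (fun i' r' _ h2 k' _ => ?_) fun _ _ _ => rfl
    unfold sampleGrad
    rw [hξ.apply_other r hrR k hk]
    rintro ⟨⟩
    lia

theorem AdaptedState.serverState (hG : GradOracle G h D L σ) (hξ : Resampling π D R I ξ τ)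
    (hT : AdaptedState π R I τ 0 T) {m : ℕ} (hR : m * P ≤ R) :
    AdaptedState π R I τ (m * P)
      (fun z => serverState η γ P I (sampleGrad G (ξ z)) q (T z) m) := by
  induction m with
  | zero => simpa [AmpScaffold.serverState] using hT
  | succ m ih =>
    rw [Nat.succ_mul] at hR ⊢
    exact (ih (by lia)).windowStep hG hξ hR

end Noise

/-! ### Expected progress for fixed weights -/

theorem integral_le_const_mul_add₃ {Z : Type*} [MeasurableSpace Z] {π : Measure Z}
    {u a b e : Z → ℝ} {c : ℝ} (hu : Integrable u π) (ha : Integrable a π) (hb : Integrable b π)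
    (he : Integrable e π) (h : ∀ z, u z ≤ c * (a z + b z + e z)) :
    ∫ z, u z ∂π ≤ c * (∫ z, a z ∂π + ∫ z, b z ∂π + ∫ z, e z ∂π) := by
  refine (integral_mono hu (((ha.add hb).add he).const_mul c) h).trans_eq ?_
  rw [integral_const_mul, integral_add' (ha.add hb) he, integral_add' ha hb]

section Expectation

variable {Z Ξ : Type*} [MeasurableSpace Z] {N d : ℕ} {π : Measure Z} [IsProbabilityMeasure π]
  {P R I r₀ : ℕ} {τ : ℕ → ℕ → Fin N → Z × Ξ → Z} {h : Fin N → Vec d → Vec d} {L : ℝ}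
  {T : Z → ServerState N d}

theorem AdaptedState.memLp_localGrad (hT : AdaptedState π R I τ r₀ T)
    (hL : ∀ i x y, ‖h i x - h i y‖ ≤ L * ‖x - y‖) (i : Fin N) :
    MemLp (fun z => h i (T z).model) 2 π :=
  memLp_comp_of_norm_sub_le (hL i) hT.memLp_model

theorem AdaptedState.memLp_meanGrad (hT : AdaptedState π R I τ r₀ T)
    (hL : ∀ i x y, ‖h i x - h i y‖ ≤ L * ‖x - y‖) :
    MemLp (fun z => meanGrad h (T z).model) 2 π :=
  memLp_fun_const_smul (f := fun z => ∑ i, h i (T z).model)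
    (memLp_finsetSum _ fun i _ => hT.memLp_localGrad hL i) (1 / (N : ℝ))

theorem AdaptedState.integrable_controlError (hT : AdaptedState π R I τ r₀ T)
    (hL : ∀ i x y, ‖h i x - h i y‖ ≤ L * ‖x - y‖) :
    Integrable (fun z => controlError h (T z)) π :=
  (integrable_finsetSum _ fun i _ => integrable_norm_sq_of_memLp_two
    ((hT.memLp_control i).sub (hT.memLp_localGrad hL i))).const_mul _

theorem AdaptedState.integrable_objective (hT : AdaptedState π R I τ r₀ T) {f : Vec d → ℝ}
    (hfm : Measurable f) {v : Vec d} (hf : ∀ y, |f y - f 0 - ⟪v, y⟫_ℝ| ≤ L * ‖y‖ ^ 2) :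
    Integrable (fun z => f (T z).model) π := by
  have hlin : Integrable (fun z => ⟪v, (T z).model⟫_ℝ) π :=
    integrable_inner_of_memLp_two (memLp_const v) hT.memLp_model
  have hrem : Integrable (fun z => f (T z).model - f 0 - ⟪v, (T z).model⟫_ℝ) π :=
    ((integrable_norm_sq_of_memLp_two hT.memLp_model).const_mul L).mono'
      (((hfm.comp hT.measurable.model).aestronglyMeasurable.sub
        aestronglyMeasurable_const).sub hlin.aestronglyMeasurable)
      (Filter.Eventually.of_forall fun z => hf _)
  simpa [Pi.add_def] using (hrem.add hlin).add (integrable_const (f 0))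

variable [MeasurableSpace Ξ] {D : Fin N → Measure Ξ} [∀ i, IsProbabilityMeasure (D i)]
  {ξ : Z → ℕ → ℕ → Fin N → Ξ} {G : Fin N → Ξ → Vec d → Vec d} {σ ρ η γ : ℝ} {q : ℕ → Fin N → ℝ}
  (hG : GradOracle G h D L σ) (hξ : Resampling π D R I ξ τ) (hT : AdaptedState π R I τ r₀ T)
  (hR : r₀ + P ≤ R)

include hG hξ hT hR

theorem integrable_windowDrift :
    Integrable (fun z => windowDrift η P I (sampleGrad G (ξ z)) q (T z) r₀) π := by
  refine integrable_finsetSum _ fun p hp => Integrable.const_mul ?_ _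
  obtain ⟨hj, hk⟩ := mem_windowIdx.1 hp
  exact integrable_norm_sq_of_memLp_two
    ((memLp_windowIter hG hξ hT (by lia) p.2.1 hk.le).sub hT.memLp_model)

theorem integrable_windowNoiseSq :
    Integrable (fun z => windowNoiseSq η P I (sampleGrad G (ξ z)) h q (T z) r₀) π := by
  refine integrable_finsetSum _ fun p hp => Integrable.const_mul ?_ _
  obtain ⟨hj, hk⟩ := mem_windowIdx.1 hp
  exact integrable_norm_sq_of_memLp_two (memLp_windowNoise hG hξ hT (by lia) hk p.2.1)

theorem memLp_windowNoiseMean :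
    MemLp (fun z => windowNoiseMean η P I (sampleGrad G (ξ z)) h q (T z) r₀) 2 π :=
  memLp_fun_sum_smul _ (windowWeight P I q r₀) fun p hp => memLp_windowNoise hG hξ hT
    (by have := (mem_windowIdx.1 hp).1; lia) (mem_windowIdx.1 hp).2 p.2.1

theorem memLp_windowGradMean :
    MemLp (fun z => windowGradMean η P I (sampleGrad G (ξ z)) q (T z) r₀) 2 π :=
  memLp_fun_sum_smul _ (windowWeight P I q r₀) fun p hp => memLp_windowGrad hG hξ hT
    (by have := (mem_windowIdx.1 hp).1; lia) p.2.1 (mem_windowIdx.1 hp).2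

theorem integral_inner_windowNoiseMean :
    ∫ z, ⟪meanGrad h (T z).model,
      windowNoiseMean η P I (sampleGrad G (ξ z)) h q (T z) r₀⟫_ℝ ∂π = 0 := by
  have hgrad := hT.memLp_meanGrad hG.lipschitz
  unfold windowNoiseMean
  simp_rw [inner_sum, real_inner_smul_right]
  rw [integral_finsetSum _ fun p hp => (integrable_inner_of_memLp_two hgrad
    (memLp_windowNoise hG hξ hT (by have := (mem_windowIdx.1 hp).1; lia)
      (mem_windowIdx.1 hp).2 p.2.1)).const_mul _]
  refine Finset.sum_eq_zero fun p hp => ?_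
  obtain ⟨hj, hk⟩ := mem_windowIdx.1 hp
  rw [integral_const_mul, integral_inner_windowNoise hG hξ hT (by lia) hk _ hgrad, mul_zero]
  intro z y
  rw [hT.invariant _ (by lia) (by lia) _ hk]

variable (hq : RegularWindow P ρ q r₀) (hP : 0 < P) (hI : 0 < I)

include hq hP hI

theorem integral_windowNoiseSq_le :
    ∫ z, windowNoiseSq η P I (sampleGrad G (ξ z)) h q (T z) r₀ ∂π ≤ σ ^ 2 := by
  unfold windowNoiseSq
  rw [integral_finsetSum _ fun p hp => (integrable_norm_sq_of_memLp_two (memLp_windowNoise hG hξ hT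
    (by have := (mem_windowIdx.1 hp).1; lia) (mem_windowIdx.1 hp).2 p.2.1)).const_mul _]
  calc _ ≤ ∑ p ∈ windowIdx N P I, windowWeight P I q r₀ p * σ ^ 2 := by
        refine Finset.sum_le_sum fun p hp => ?_
        obtain ⟨hj, hk⟩ := mem_windowIdx.1 hp
        rw [integral_const_mul]
        exact mul_le_mul_of_nonneg_left
          (integral_windowNoise_sq_le hG hξ hT (by lia) hk _) (hq.windowWeight_nonneg hp)
    _ = σ ^ 2 := by rw [← Finset.sum_mul, hq.sum_windowWeight hP hI, one_mul]

theorem integral_windowNoiseMean_sq_le :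
    ∫ z, ‖windowNoiseMean η P I (sampleGrad G (ξ z)) h q (T z) r₀‖ ^ 2 ∂π ≤
      ρ ^ 2 * σ ^ 2 / (P * I) := by
  refine (integral_norm_sq_sum_smul_le (windowIdx N P I) (c := windowWeight P I q r₀)
    (n := fun p z => windowNoise η I (sampleGrad G (ξ z)) h q (T z) r₀ p.1 p.2.1 p.2.2)
    (b := σ ^ 2) (fun p hp => ?_) (fun p hp p' hp' hne => ?_) fun p hp => ?_).trans ?_
  · obtain ⟨hj, hk⟩ := mem_windowIdx.1 hp
    exact memLp_windowNoise hG hξ hT (by lia) hk _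
  · obtain ⟨hj, hk⟩ := mem_windowIdx.1 hp
    obtain ⟨hj', hk'⟩ := mem_windowIdx.1 hp'
    exact integral_inner_windowNoise_windowNoise hG hξ hT (by lia) hk (by lia) hk' hne
  · obtain ⟨hj, hk⟩ := mem_windowIdx.1 hp
    exact integral_windowNoise_sq_le hG hξ hT (by lia) hk _
  · calc _ ≤ σ ^ 2 * (ρ ^ 2 / (P * I)) := by gcongr; exact hq.sum_windowWeight_sq_le hP hI
      _ = _ := by ring

theorem integral_windowDrift_le (hη : 0 ≤ η) (hL0 : 0 ≤ L) (hηL : 4 * (η * P * I * L) ≤ 1) :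
    ∫ z, windowDrift η P I (sampleGrad G (ξ z)) q (T z) r₀ ∂π ≤ 216 * (η * P * I) ^ 2 *
      (σ ^ 2 + ∫ z, controlError h (T z) ∂π + ∫ z, ‖meanGrad h (T z).model‖ ^ 2 ∂π) := by
  refine (integral_le_const_mul_add₃ (integrable_windowDrift hG hξ hT hR)
    (integrable_windowNoiseSq hG hξ hT hR) (hT.integrable_controlError hG.lipschitz)
    (integrable_norm_sq_of_memLp_two (hT.memLp_meanGrad hG.lipschitz))
    fun z => windowDrift_le hG.lipschitz hq hP hI hη hL0 hηL).trans ?_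
  gcongr
  exact integral_windowNoiseSq_le hG hξ hT hR hq hP hI

theorem integral_windowGradMean_sq_le :
    ∫ z, ‖windowGradMean η P I (sampleGrad G (ξ z)) q (T z) r₀‖ ^ 2 ∂π ≤
      3 * (∫ z, ‖meanGrad h (T z).model‖ ^ 2 ∂π +
        L ^ 2 * ∫ z, windowDrift η P I (sampleGrad G (ξ z)) q (T z) r₀ ∂π +
        ρ ^ 2 * σ ^ 2 / (P * I)) := by
  refine (integral_le_const_mul_add₃
    (integrable_norm_sq_of_memLp_two (memLp_windowGradMean hG hξ hT hR))
    (integrable_norm_sq_of_memLp_two (hT.memLp_meanGrad hG.lipschitz))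
    ((integrable_windowDrift hG hξ hT hR).const_mul (L ^ 2))
    (integrable_norm_sq_of_memLp_two (memLp_windowNoiseMean hG hξ hT hR))
    fun z => norm_windowGradMean_sq_le hG.lipschitz hq hP hI).trans ?_
  rw [integral_const_mul]
  gcongr
  exact integral_windowNoiseMean_sq_le hG hξ hT hR hq hP hI

theorem integral_controlError_windowStep_le :
    ∫ z, controlError h (windowStep η γ P I (sampleGrad G (ξ z)) q r₀ (T z)) ∂π ≤
      3 * (σ ^ 2 + L ^ 2 * ∫ z, windowDrift η P I (sampleGrad G (ξ z)) q (T z) r₀ ∂π +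
        L ^ 2 * (γ * η * P * I) ^ 2 *
          ∫ z, ‖windowGradMean η P I (sampleGrad G (ξ z)) q (T z) r₀‖ ^ 2 ∂π) := by
  refine (integral_le_const_mul_add₃ (c := 3)
    ((hT.windowStep hG hξ hR).integrable_controlError hG.lipschitz)
    (integrable_windowNoiseSq (η := η) (q := q) hG hξ hT hR)
    ((integrable_windowDrift (η := η) (q := q) hG hξ hT hR).const_mul (L ^ 2))
    ((integrable_norm_sq_of_memLp_two
      (memLp_windowGradMean (η := η) (q := q) hG hξ hT hR)).const_mul
        (L ^ 2 * (γ * η * P * I) ^ 2)) fun z => ?_).trans ?_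
  · refine (controlError_windowStep_le hG.lipschitz hq hP hI).trans (le_of_eq ?_)
    rw [hq.windowStep_model hP hI, sub_sub_cancel_left, norm_neg, norm_smul, mul_pow,
      Real.norm_eq_abs, sq_abs, ← mul_assoc (L ^ 2)]
  · rw [integral_const_mul, integral_const_mul]
    gcongr
    exact integral_windowNoiseSq_le hG hξ hT hR hq hP hI

theorem integral_objective_windowStep_le {f : Vec d → ℝ} (hfm : Measurable f)
    (hf : ∀ x y, |f y - f x - ⟪meanGrad h x, y - x⟫_ℝ| ≤ L * ‖y - x‖ ^ 2)
    (hγ0 : 0 ≤ γ * η * P * I) :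
    ∫ z, f (windowStep η γ P I (sampleGrad G (ξ z)) q r₀ (T z)).model ∂π ≤
      ∫ z, f (T z).model ∂π -
        γ * η * P * I * (3 / 4 * ∫ z, ‖meanGrad h (T z).model‖ ^ 2 ∂π -
          L ^ 2 * ∫ z, windowDrift η P I (sampleGrad G (ξ z)) q (T z) r₀ ∂π) +
        L * (γ * η * P * I) ^ 2 *
          ∫ z, ‖windowGradMean η P I (sampleGrad G (ξ z)) q (T z) r₀‖ ^ 2 ∂π := by
  have hfint : ∀ {r₀ T}, AdaptedState π R I τ r₀ T → Integrable (fun z => f (T z).model) π :=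
    fun hT => hT.integrable_objective hfm fun y => by simpa using hf 0 y
  have hgrad := hT.memLp_meanGrad hG.lipschitz
  have hgrad_sq := (integrable_norm_sq_of_memLp_two hgrad).const_mul (3 / 4)
  have hdrift := (integrable_windowDrift (η := η) (q := q) hG hξ hT hR).const_mul (L ^ 2)
  have hinner := integrable_inner_of_memLp_two hgrad
    (memLp_windowNoiseMean (η := η) (q := q) hG hξ hT hR)
  have hstep_sq := (integrable_norm_sq_of_memLp_two
    (memLp_windowGradMean (η := η) (q := q) hG hξ hT hR)).const_mul (L * (γ * η * P * I) ^ 2)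
  have hdescent := ((hgrad_sq.sub hdrift).add hinner).const_mul (γ * η * P * I)
  refine (integral_mono (hfint (hT.windowStep hG hξ hR)) (((hfint hT).sub hdescent).add hstep_sq)
    fun z => objective_windowStep_le hG.lipschitz hq hP hI
      (fun x y => by linarith [(abs_le.1 (hf x y)).2]) rfl hγ0).trans (le_of_eq ?_)
  have hadd_step := integral_add ((hfint hT).sub hdescent) hstep_sq
  have hsub_descent := integral_sub (hfint hT) hdescent
  have hadd_inner := integral_add (hgrad_sq.sub hdrift) hinner
  have hsub_drift := integral_sub hgrad_sq hdrift
  simp only [Pi.add_apply, Pi.sub_apply] at hadd_step hsub_descent hadd_inner hsub_drift ⊢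
  rw [hadd_step, hsub_descent, integral_const_mul, hadd_inner, hsub_drift, integral_const_mul,
    integral_const_mul, integral_const_mul, integral_inner_windowNoiseMean hG hξ hT hR, add_zero]

end Expectation

/-! ### Summation over the windows -/

theorem sum_range_le_of_succ_le {M : ℕ} {H u : ℕ → ℝ} (hM : 0 ≤ H M)
    (h : ∀ m < M, H (m + 1) ≤ u m) : ∑ m ∈ range M, H m ≤ H 0 + ∑ m ∈ range M, u m := by
  have hu : ∑ m ∈ range M, H (m + 1) ≤ ∑ m ∈ range M, u m :=
    Finset.sum_le_sum fun m hm => h m (Finset.mem_range.1 hm)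
  linarith [Finset.sum_range_succ H M, Finset.sum_range_succ' H M]

theorem sum_le_of_progress {M : ℕ} {a H Q f : ℕ → ℝ} {γ δ s Δ e : ℝ} (hM : 1 ≤ M) (hγ : 0 < γ)
    (hδ0 : 0 ≤ δ) (hδ : 64 * δ ≤ 1) (hδs : 5 * δ * s ≤ e) (hs : 0 ≤ s) (he : 0 ≤ e)
    (ha : ∀ m < M, 0 ≤ a m) (hQ0 : ∀ m < M, 0 ≤ Q m) (hHM : 0 ≤ H M) (hH0 : H 0 ≤ s)
    (hQ : ∀ m < M, Q m ≤ δ * (s + H m + a m))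
    (hH : ∀ m < M, H (m + 1) ≤ 3 * s + 3 * Q m + 1 / 64 * (a m + Q m + e))
    (hf : ∀ m < M, γ * (5 / 8 * a m - 9 / 8 * Q m - 1 / 8 * e) ≤ f m - f (m + 1))
    (hΔ0 : 0 ≤ Δ) (hΔ : f 0 - f M ≤ Δ) :
    ∑ m ∈ range M, a m ≤ 2 * (Δ / γ) + 3 * M * e := by
  have hM' : (1 : ℝ) ≤ M := by exact_mod_cast hM
  have sumQ_le := Finset.sum_le_sum fun m hm => hQ m (Finset.mem_range.1 hm)
  have sumH_le := sum_range_le_of_succ_le hHM hH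
  have descent := Finset.sum_le_sum fun m hm => hf m (Finset.mem_range.1 hm)
  simp only [← Finset.mul_sum, Finset.sum_add_distrib, Finset.sum_sub_distrib, Finset.sum_const,
    Finset.card_range, nsmul_eq_mul] at sumQ_le sumH_le descent
  rw [← Finset.sum_sub_distrib, Finset.sum_range_sub'] at descent
  set A := ∑ m ∈ range M, a m
  set Qs := ∑ m ∈ range M, Q m
  set Hs := ∑ m ∈ range M, H m
  have hA0 : 0 ≤ A := Finset.sum_nonneg fun m hm => ha m (Finset.mem_range.1 hm)
  have hQ0 : 0 ≤ Qs := Finset.sum_nonneg fun m hm => hQ0 m (Finset.mem_range.1 hm)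
  have hMe : 0 ≤ M * e := by positivity
  have descent_le : 5 / 8 * A - 9 / 8 * Qs - 1 / 8 * (M * e) ≤ Δ / γ := by
    rw [le_div_iff₀ hγ]
    linarith
  have sumQ_le' : Qs ≤ M * e + 1 / 64 * (4 * Qs + 2 * A + M * e) := by
    calc Qs ≤ δ * (M * s + Hs + A) := sumQ_le
      _ ≤ δ * (5 * (M * s) + (4 * Qs + 2 * A + M * e)) := by
          refine mul_le_mul_of_nonneg_left ?_ hδ0
          linarith [le_mul_of_one_le_left hs hM']
      _ = M * (5 * δ * s) + δ * (4 * Qs + 2 * A + M * e) := by ring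
      _ ≤ _ := by
          gcongr
          linarith
  have : 0 ≤ Δ / γ := by positivity
  linarith

/-- Step sizes `η`, `γ` and a number `I` of local steps that are tuned to the accuracy `ε`: the
server moves by a multiple of `1 / L` along the averaged gradient of a window, and both the
variance of this average and the contribution of the noise to the drift of the local iterates are
at most `ε²`. -/
structure TunedStepSizes (η γ : ℝ) (P I : ℕ) (L σ ρ ε : ℝ) : Prop where
  step_nonneg : 0 ≤ η
  smooth_pos : 0 < L
  serverStep_eq : γ * η * P * I = 1 / (24 * L)
  variance_le : ρ ^ 2 * σ ^ 2 / (P * I) ≤ ε ^ 2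
  drift_le : 64 * (216 * (η * P * I * L) ^ 2) ≤ 1
  driftNoise_le : 5 * (216 * (η * P * I * L) ^ 2) * σ ^ 2 ≤ ε ^ 2

section Summation

variable {η γ L σ ρ ε : ℝ} {P I : ℕ}

theorem TunedStepSizes.serverStep_pos (hs : TunedStepSizes η γ P I L σ ρ ε) :
    0 < γ * η * P * I := by
  have := hs.smooth_pos
  rw [hs.serverStep_eq]
  positivity

theorem TunedStepSizes.windowLength_pos (hs : TunedStepSizes η γ P I L σ ρ ε) : 0 < P := by
  rcases Nat.eq_zero_or_pos P with rfl | hP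
  · simpa using hs.serverStep_pos
  · exact hP

theorem TunedStepSizes.localSteps_pos (hs : TunedStepSizes η γ P I L σ ρ ε) : 0 < I := by
  rcases Nat.eq_zero_or_pos I with rfl | hI
  · simpa using hs.serverStep_pos
  · exact hI

variable {Z Ξ : Type*} [MeasurableSpace Z] [MeasurableSpace Ξ] {N d : ℕ} {π : Measure Z}
  [IsProbabilityMeasure π] {D : Fin N → Measure Ξ} [∀ i, IsProbabilityMeasure (D i)]
  {R r₀ : ℕ} {ξ : Z → ℕ → ℕ → Fin N → Ξ} {τ : ℕ → ℕ → Fin N → Z × Ξ → Z}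
  {G : Fin N → Ξ → Vec d → Vec d} {h : Fin N → Vec d → Vec d} {q : ℕ → Fin N → ℝ}
  {T : Z → ServerState N d} {f : Vec d → ℝ}

theorem TunedStepSizes.sq_mul_integral_windowDrift_le (hs : TunedStepSizes η γ P I L σ ρ ε)
    (hG : GradOracle G h D L σ) (hξ : Resampling π D R I ξ τ) (hT : AdaptedState π R I τ r₀ T)
    (hR : r₀ + P ≤ R) (hq : RegularWindow P ρ q r₀) :
    L ^ 2 * ∫ z, windowDrift η P I (sampleGrad G (ξ z)) q (T z) r₀ ∂π ≤
      216 * (η * P * I * L) ^ 2 *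
        (σ ^ 2 + ∫ z, controlError h (T z) ∂π + ∫ z, ‖meanGrad h (T z).model‖ ^ 2 ∂π) := by
  have hL := hs.smooth_pos
  have hη := hs.step_nonneg
  have hηL : 4 * (η * P * I * L) ≤ 1 := by
    nlinarith [hs.drift_le, show 0 ≤ η * P * I * L by positivity]
  refine (mul_le_mul_of_nonneg_left (integral_windowDrift_le hG hξ hT hR hq hs.windowLength_pos
    hs.localSteps_pos hη hL.le hηL) (sq_nonneg L)).trans_eq ?_
  ring

theorem TunedStepSizes.integral_windowGradMean_sq_le (hs : TunedStepSizes η γ P I L σ ρ ε)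
    (hG : GradOracle G h D L σ) (hξ : Resampling π D R I ξ τ) (hT : AdaptedState π R I τ r₀ T)
    (hR : r₀ + P ≤ R) (hq : RegularWindow P ρ q r₀) :
    ∫ z, ‖windowGradMean η P I (sampleGrad G (ξ z)) q (T z) r₀‖ ^ 2 ∂π ≤
      3 * (∫ z, ‖meanGrad h (T z).model‖ ^ 2 ∂π +
        L ^ 2 * ∫ z, windowDrift η P I (sampleGrad G (ξ z)) q (T z) r₀ ∂π + ε ^ 2) := by
  have := AmpScaffold.integral_windowGradMean_sq_le (η := η) hG hξ hT hR hq hs.windowLength_pos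
    hs.localSteps_pos
  linarith [hs.variance_le]

theorem TunedStepSizes.integral_controlError_windowStep_le
    (hs : TunedStepSizes η γ P I L σ ρ ε) (hG : GradOracle G h D L σ)
    (hξ : Resampling π D R I ξ τ) (hT : AdaptedState π R I τ r₀ T) (hR : r₀ + P ≤ R)
    (hq : RegularWindow P ρ q r₀) :
    ∫ z, controlError h (windowStep η γ P I (sampleGrad G (ξ z)) q r₀ (T z)) ∂π ≤
      3 * σ ^ 2 + 3 * (L ^ 2 * ∫ z, windowDrift η P I (sampleGrad G (ξ z)) q (T z) r₀ ∂π) +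
        1 / 64 * (∫ z, ‖meanGrad h (T z).model‖ ^ 2 ∂π +
          L ^ 2 * ∫ z, windowDrift η P I (sampleGrad G (ξ z)) q (T z) r₀ ∂π + ε ^ 2) := by
  have hL := hs.smooth_pos
  have control_le := AmpScaffold.integral_controlError_windowStep_le (η := η) (γ := γ) hG hξ hT hR
    hq hs.windowLength_pos hs.localSteps_pos
  rw [← mul_pow, hs.serverStep_eq, show L * (1 / (24 * L)) = 1 / 24 by field_simp] at control_le
  linarith [hs.integral_windowGradMean_sq_le hG hξ hT hR hq]

theorem TunedStepSizes.le_integral_objective_sub (hs : TunedStepSizes η γ P I L σ ρ ε)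
    (hG : GradOracle G h D L σ) (hξ : Resampling π D R I ξ τ) (hT : AdaptedState π R I τ r₀ T)
    (hR : r₀ + P ≤ R) (hq : RegularWindow P ρ q r₀) (hfm : Measurable f)
    (hf : ∀ x y, |f y - f x - ⟪meanGrad h x, y - x⟫_ℝ| ≤ L * ‖y - x‖ ^ 2) :
    1 / (24 * L) * (5 / 8 * ∫ z, ‖meanGrad h (T z).model‖ ^ 2 ∂π -
        9 / 8 * (L ^ 2 * ∫ z, windowDrift η P I (sampleGrad G (ξ z)) q (T z) r₀ ∂π) -
        1 / 8 * ε ^ 2) ≤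
      ∫ z, f (T z).model ∂π -
        ∫ z, f (windowStep η γ P I (sampleGrad G (ξ z)) q r₀ (T z)).model ∂π := by
  have hL := hs.smooth_pos
  have objective_le := integral_objective_windowStep_le (η := η) (γ := γ) hG hξ hT hR hq
    hs.windowLength_pos hs.localSteps_pos hfm hf hs.serverStep_pos.le
  rw [hs.serverStep_eq, show L * (1 / (24 * L)) ^ 2 = 1 / (24 * L) / 24 by field_simp]
    at objective_le
  linarith [mul_le_mul_of_nonneg_left (hs.integral_windowGradMean_sq_le hG hξ hT hR hq)
    (show 0 ≤ 1 / (24 * L) by positivity)]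

theorem sum_integral_meanGrad_sq_le (hs : TunedStepSizes η γ P I L σ ρ ε)
    (hG : GradOracle G h D L σ) (hξ : Resampling π D R I ξ τ) (hT : AdaptedState π R I τ 0 T)
    {M : ℕ} (hM : 1 ≤ M) (hR : M * P ≤ R) (hq : ∀ m < M, RegularWindow P ρ q (m * P))
    (hfm : Measurable f) (hf : ∀ x y, |f y - f x - ⟪meanGrad h x, y - x⟫_ℝ| ≤ L * ‖y - x‖ ^ 2)
    {Δ : ℝ} {x₀ : Vec d} (hx₀ : ∀ z, (T z).model = x₀) (hΔ : ∀ x, f x₀ - f x ≤ Δ)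
    (hc : ∫ z, controlError h (T z) ∂π ≤ σ ^ 2) :
    ∑ m ∈ range M, ∫ z, ‖meanGrad h
        (serverState η γ P I (sampleGrad G (ξ z)) q (T z) m).model‖ ^ 2 ∂π ≤
      48 * (Δ * L) + 3 * M * ε ^ 2 := by
  have hL := hs.smooth_pos
  set St : ℕ → Z → ServerState N d := fun m z =>
    serverState η γ P I (sampleGrad G (ξ z)) q (T z) m
  have hSt : ∀ m ≤ M, AdaptedState π R I τ (m * P) (St m) := fun m hm =>
    hT.serverState hG hξ ((Nat.mul_le_mul_right P hm).trans hR)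
  have hRm : ∀ m < M, m * P + P ≤ R := fun m hm => by
    rw [← Nat.succ_mul]
    exact (Nat.mul_le_mul_right P hm).trans hR
  have objective_ge : f x₀ - Δ ≤ ∫ z, f (St M z).model ∂π := by
    simpa using integral_mono (μ := π) (integrable_const (f x₀ - Δ))
      ((hSt M le_rfl).integrable_objective hfm fun y => by simpa using hf 0 y)
      fun z => sub_le_comm.1 (hΔ (St M z).model)
  refine (sum_le_of_progress (a := fun m => ∫ z, ‖meanGrad h (St m z).model‖ ^ 2 ∂π)
    (H := fun m => ∫ z, controlError h (St m z) ∂π)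
    (Q := fun m => L ^ 2 * ∫ z, windowDrift η P I (sampleGrad G (ξ z)) q (St m z) (m * P) ∂π)
    (f := fun m => ∫ z, f (St m z).model ∂π) (γ := 1 / (24 * L)) (e := ε ^ 2) (Δ := Δ)
    hM (by positivity) (by positivity) hs.drift_le hs.driftNoise_le (sq_nonneg _) (sq_nonneg _)
    (fun m _ => integral_nonneg fun z => sq_nonneg _)
    (fun m hm => mul_nonneg (sq_nonneg _) (integral_nonneg fun z => Finset.sum_nonneg fun p hp =>
      mul_nonneg ((hq m hm).windowWeight_nonneg hp) (sq_nonneg _)))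
    (integral_nonneg fun z => controlError_nonneg _ _) hc
    (fun m hm => hs.sq_mul_integral_windowDrift_le hG hξ (hSt m hm.le) (hRm m hm) (hq m hm))
    (fun m hm => hs.integral_controlError_windowStep_le hG hξ (hSt m hm.le) (hRm m hm) (hq m hm))
    (fun m hm => hs.le_integral_objective_sub hG hξ (hSt m hm.le) (hRm m hm) (hq m hm) hfm hf)
    (by simpa using hΔ x₀) ?_).trans_eq (by field_simp; ring)
  simp only [St, serverState, hx₀, integral_const, probReal_univ, smul_eq_mul, one_mul]
    at objective_ge ⊢
  linarith

end Summation

/-! ### The product space of the samples -/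

theorem measurePreserving_update {ι : Type*} [Fintype ι] [DecidableEq ι] {X : ι → Type*}
    [∀ i, MeasurableSpace (X i)] (μ : ∀ i, Measure (X i)) [∀ i, IsProbabilityMeasure (μ i)]
    (b : ι) : MeasurePreserving (fun p : (∀ i, X i) × X b => Function.update p.1 b p.2)
      ((Measure.pi μ).prod (μ b)) (Measure.pi μ) := by
  refine ⟨measurable_update', (Measure.pi_eq fun s hs => ?_).symm⟩
  have hpre : (fun p : (∀ i, X i) × X b => Function.update p.1 b p.2) ⁻¹' (Set.univ.pi s) =
      (Set.univ.pi (Function.update s b Set.univ)) ×ˢ s b := by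
    ext ⟨z, y⟩
    simp only [Set.mem_preimage, Set.mem_univ_pi, Set.mem_prod]
    rw [Function.forall_update_iff z fun i x => x ∈ s i,
      Function.forall_update_iff s fun i t => z i ∈ t]
    simp [and_comm]
  rw [Measure.map_apply measurable_update' (MeasurableSet.univ_pi hs), hpre, Measure.prod_prod,
    Measure.pi_pi]
  simp_rw [Function.apply_update (fun i => μ i)]
  rw [Finset.prod_update_of_mem (Finset.mem_univ b), measure_univ, one_mul, mul_comm]
  exact (Finset.prod_eq_mul_prod_sdiff_singleton_of_mem (Finset.mem_univ b)
    fun k => μ k (s k)).symm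

section Product

variable {Ξ : Type*} {N B R I : ℕ}

/-- The index set of all samples: those of the initialization and those of the local steps. -/
abbrev SampleIdx (N B R I : ℕ) : Type := (Fin B × Fin N) ⊕ (Fin R × Fin I × Fin N)

/-- The client to which a sample belongs. -/
def SampleIdx.client : SampleIdx N B R I → Fin N :=
  Sum.elim Prod.snd fun s => s.2.2

/-- The samples of the local steps, as a function of all samples; out of range it is `c`. -/
def roundSample (c : Ξ) (z : SampleIdx N B R I → Ξ) (r k : ℕ) (i : Fin N) : Ξ :=
  if h : r < R ∧ k < I then z (Sum.inr (⟨r, h.1⟩, ⟨k, h.2⟩, i)) else c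

/-- The samples of the initialization, as a function of all samples; out of range it is `c`. -/
def initSample (c : Ξ) (z : SampleIdx N B R I → Ξ) (b : ℕ) (i : Fin N) : Ξ :=
  if h : b < B then z (Sum.inl (⟨b, h⟩, i)) else c

/-- Replaces the sample of one local step; out of range nothing is replaced. -/
def resample (r k : ℕ) (i : Fin N) (p : (SampleIdx N B R I → Ξ) × Ξ) : SampleIdx N B R I → Ξ :=
  if h : r < R ∧ k < I then Function.update p.1 (Sum.inr (⟨r, h.1⟩, ⟨k, h.2⟩, i)) p.2 else p.1

theorem initSample_resample (c : Ξ) (r k : ℕ) (i : Fin N) (z : SampleIdx N B R I → Ξ) (y : Ξ) :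
    initSample c (resample r k i (z, y)) = initSample c z := by
  funext b i'
  unfold initSample resample
  split_ifs <;> simp

variable [MeasurableSpace Ξ]

theorem measurable_roundSample (c : Ξ) (r k : ℕ) (i : Fin N) :
    Measurable fun z : SampleIdx N B R I → Ξ => roundSample c z r k i := by
  unfold roundSample
  split_ifs <;> fun_prop

theorem measurable_initSample (c : Ξ) (b : ℕ) (i : Fin N) :
    Measurable fun z : SampleIdx N B R I → Ξ => initSample c z b i := by
  unfold initSample
  split_ifs <;> fun_prop

/-- The joint law of independent samples, where those of client `i` have law `D i`. -/
abbrev sampleLaw (D : Fin N → Measure Ξ) (B R I : ℕ) : Measure (SampleIdx N B R I → Ξ) :=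
  Measure.pi fun s => D s.client

theorem resampling_sampleLaw (D : Fin N → Measure Ξ) [∀ i, IsProbabilityMeasure (D i)] (c : Ξ) :
    Resampling (sampleLaw D B R I) D R I (roundSample c) resample where
  measurable := measurable_roundSample c
  measurePreserving r hr k hk i := by
    simp only [funext fun p : (SampleIdx N B R I → Ξ) × Ξ => show resample r k i p =
      Function.update p.1 (Sum.inr (⟨r, hr⟩, ⟨k, hk⟩, i)) p.2 from dif_pos ⟨hr, hk⟩]
    exact measurePreserving_update (fun s : SampleIdx N B R I => D s.client)
      (Sum.inr (⟨r, hr⟩, ⟨k, hk⟩, i))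
  apply_same r hr k hk i z y := by
    simp [roundSample, resample, hr, hk]
  apply_other r hr k hk i r' k' i' hne z y := by
    by_cases h : r' < R ∧ k' < I
    · simp only [roundSample, resample, hr, hk, h, and_self, dif_pos]
      exact Function.update_of_ne (by simpa using hne) _ _
    · simp [roundSample, h]

theorem measurePreserving_initSample (D : Fin N → Measure Ξ) [∀ i, IsProbabilityMeasure (D i)]
    (c : Ξ) {b : ℕ} (hb : b < B) (i : Fin N) :
    MeasurePreserving (fun z => initSample c z b i) (sampleLaw D B R I) (D i) := by
  simp only [initSample, hb, dif_pos]
  exact measurePreserving_eval (fun s : SampleIdx N B R I => D s.client) (Sum.inl (⟨b, hb⟩, i))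

end Product

theorem norm_initState_control_sub_sq_le {Ξ : Type*} {N B d : ℕ} (F : Fin N → Vec d → Ξ → ℝ)
    (hB : 0 < B) (ξ₀ : ℕ → Fin N → Ξ) (x₀ v : Vec d) (i : Fin N) :
    ‖(initState F x₀ B ξ₀).control i - v‖ ^ 2 ≤
      ∑ b ∈ range B, 1 / (B : ℝ) * ‖stochGrad F i (ξ₀ b i) x₀ - v‖ ^ 2 := by
  have hw : ∑ _b ∈ range B, 1 / (B : ℝ) = 1 := by simp [hB.ne']
  have hsub : (initState F x₀ B ξ₀).control i - v =
      ∑ b ∈ range B, (1 / (B : ℝ)) • (stochGrad F i (ξ₀ b i) x₀ - v) := by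
    simp_rw [smul_sub]
    rw [Finset.sum_sub_distrib, ← Finset.sum_smul, hw, one_smul, ← Finset.smul_sum]
    rfl
  rw [hsub]
  refine (norm_sum_smul_sq_le _ fun b _ => by positivity).trans_eq ?_
  rw [hw, one_mul]

section Init

variable {Ξ : Type*} [MeasurableSpace Ξ] {N B R I d : ℕ} {F : Fin N → Vec d → Ξ → ℝ}
  {h : Fin N → Vec d → Vec d} {D : Fin N → Measure Ξ} {L σ : ℝ}

theorem GradOracle.measurable_initGrad (hG : GradOracle (stochGrad F) h D L σ) (c : Ξ)
    (x₀ : Vec d) (b : ℕ) (i : Fin N) :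
    Measurable fun z : SampleIdx N B R I → Ξ => stochGrad F i (initSample c z b i) x₀ :=
  (hG.measurable i).comp (measurable_const.prodMk (measurable_initSample c b i))

theorem GradOracle.measurableState_initState (hG : GradOracle (stochGrad F) h D L σ) (c : Ξ)
    (x₀ : Vec d) : MeasurableState fun z : SampleIdx N B R I → Ξ =>
      initState F x₀ B (initSample c z) where
  model := measurable_const
  control i := Measurable.fun_const_smul
    (Finset.measurable_sum _ fun b _ => hG.measurable_initGrad c x₀ b i) _

variable [∀ i, IsProbabilityMeasure (D i)]

theorem lintegral_initGrad_sub_sq_le (hG : GradOracle (stochGrad F) h D L σ) (c : Ξ) (x₀ : Vec d)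
    {b : ℕ} (hb : b < B) (i : Fin N) :
    ∫⁻ z, ‖stochGrad F i (initSample c z b i) x₀ - h i x₀‖ₑ ^ 2 ∂(sampleLaw D B R I) ≤
      ENNReal.ofReal (σ ^ 2) := by
  have hmeas : Measurable fun y => ‖stochGrad F i y x₀ - h i x₀‖ₑ ^ 2 :=
    (((hG.measurable i).comp (measurable_const.prodMk measurable_id)).sub_const _).enorm.pow_const 2
  exact ((measurePreserving_initSample D c hb i).lintegral_comp hmeas).trans_le (hG.variance i x₀)

theorem memLp_initGrad (hG : GradOracle (stochGrad F) h D L σ) (c : Ξ) (x₀ : Vec d) {b : ℕ}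
    (hb : b < B) (i : Fin N) :
    MemLp (fun z => stochGrad F i (initSample c z b i) x₀) 2 (sampleLaw D B R I) :=
  memLp_two_of_lintegral_sub_lt_top (hG.measurable_initGrad c x₀ b i).aestronglyMeasurable
    ((lintegral_initGrad_sub_sq_le hG c x₀ hb i).trans_lt ENNReal.ofReal_lt_top)

theorem adaptedState_initState (hG : GradOracle (stochGrad F) h D L σ) (c : Ξ) (x₀ : Vec d) :
    AdaptedState (sampleLaw D B R I) R I resample 0
      (fun z => initState F x₀ B (initSample c z)) where
  measurable := hG.measurableState_initState c x₀
  memLp_model := memLp_const x₀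
  memLp_control i := memLp_fun_const_smul (f := fun z => ∑ b ∈ range B,
    stochGrad F i (initSample c z b i) x₀) (memLp_finsetSum _ fun b hb =>
      memLp_initGrad hG c x₀ (Finset.mem_range.1 hb) i) (1 / (B : ℝ))
  invariant r _ _ k _ i z y := by rw [initSample_resample]

theorem integral_initState_control_sub_sq_le (hG : GradOracle (stochGrad F) h D L σ) (c : Ξ)
    (x₀ : Vec d) (hB : 0 < B) (i : Fin N) :
    ∫ z, ‖(initState F x₀ B (initSample c z)).control i - h i x₀‖ ^ 2 ∂(sampleLaw D B R I) ≤
      σ ^ 2 := by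
  have hint : ∀ b ∈ range B, Integrable (fun z => 1 / (B : ℝ) *
      ‖stochGrad F i (initSample c z b i) x₀ - h i x₀‖ ^ 2) (sampleLaw D B R I) := fun b hb =>
    (integrable_norm_sq_of_memLp_two ((memLp_initGrad hG c x₀ (Finset.mem_range.1 hb) i).sub
      (memLp_const _))).const_mul _
  refine (integral_mono (integrable_norm_sq_of_memLp_two
    (((adaptedState_initState hG c x₀).memLp_control i).sub (memLp_const _)))
    (integrable_finsetSum _ hint) fun z => norm_initState_control_sub_sq_le F hB _ _ _ i).trans ?_
  rw [integral_finsetSum _ hint]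
  calc _ ≤ ∑ _b ∈ range B, 1 / (B : ℝ) * σ ^ 2 := by
        gcongr with b hb
        rw [integral_const_mul]
        gcongr
        exact integral_norm_sq_le_of_lintegral (sq_nonneg σ)
          ((hG.measurable_initGrad c x₀ b i).sub_const _).aestronglyMeasurable
          (lintegral_initGrad_sub_sq_le hG c x₀ (Finset.mem_range.1 hb) i)
    _ = σ ^ 2 := by simp [hB.ne']

theorem integral_controlError_initState_le (hG : GradOracle (stochGrad F) h D L σ) (c : Ξ)
    (x₀ : Vec d) (hB : 0 < B) :
    ∫ z, controlError h (initState F x₀ B (initSample c z)) ∂(sampleLaw D B R I) ≤ σ ^ 2 := by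
  have hint : ∀ i, Integrable (fun z => ‖(initState F x₀ B (initSample c z)).control i -
      h i (initState F x₀ B (initSample c z)).model‖ ^ 2) (sampleLaw D B R I) := fun i =>
    integrable_norm_sq_of_memLp_two (((adaptedState_initState hG c x₀).memLp_control i).sub
      ((adaptedState_initState hG c x₀).memLp_localGrad hG.lipschitz i))
  unfold controlError
  rw [integral_const_mul, integral_finsetSum _ fun i _ => hint i]
  calc _ ≤ 1 / (N : ℝ) * ∑ _i : Fin N, σ ^ 2 := by
        gcongr with i
        exact integral_initState_control_sub_sq_le hG c x₀ hB i
    _ = 1 / (N : ℝ) * N * σ ^ 2 := by simp [mul_assoc]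
    _ ≤ 1 * σ ^ 2 := by
        gcongr
        exact (one_div_mul_eq_div _ _).trans_le (div_self_le_one _)
    _ = σ ^ 2 := one_mul _

end Init

/-! ### The objective -/

theorem norm_meanGrad_sub_le {N d : ℕ} {h : Fin N → Vec d → Vec d} {L : ℝ} (hL0 : 0 ≤ L)
    (hL : ∀ i x y, ‖h i x - h i y‖ ≤ L * ‖x - y‖) (x y : Vec d) :
    ‖meanGrad h x - meanGrad h y‖ ≤ L * ‖x - y‖ := by
  rw [meanGrad, meanGrad, ← smul_sub, ← Finset.sum_sub_distrib, norm_smul,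
    Real.norm_of_nonneg (by positivity)]
  calc 1 / (N : ℝ) * ‖∑ i, (h i x - h i y)‖ ≤ 1 / (N : ℝ) * ∑ _i : Fin N, L * ‖x - y‖ := by
        gcongr
        exact (norm_sum_le _ _).trans (Finset.sum_le_sum fun i _ => hL i x y)
    _ = 1 / (N : ℝ) * N * (L * ‖x - y‖) := by simp [mul_assoc]
    _ ≤ 1 * (L * ‖x - y‖) := by
        gcongr
        exact (one_div_mul_eq_div _ _).trans_le (div_self_le_one _)
    _ = _ := one_mul _

section Objective

variable {Ξ : Type*} [MeasurableSpace Ξ] {N d : ℕ} {F : Fin N → Vec d → Ξ → ℝ}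
  {D : Fin N → Measure Ξ} {x₀ : Vec d} {Δ L L' σ : ℝ}

theorem ObjectiveAssumption.measurable_stochGrad (hF : ObjectiveAssumption F D x₀ Δ L σ)
    (i : Fin N) : Measurable fun p : Vec d × Ξ => stochGrad F i p.2 p.1 :=
  measurable_gradient (hF.measurable i) (hF.differentiable i)

theorem ObjectiveAssumption.eLpNorm_stochGrad_le [∀ i, IsProbabilityMeasure (D i)]
    (hF : ObjectiveAssumption F D x₀ Δ L σ) (i : Fin N) (y : Vec d) :
    eLpNorm (fun ξ => stochGrad F i ξ y) 2 (D i) ≤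
      ENNReal.ofReal |σ| + ‖gradient (localObj F D i) y‖ₑ := by
  have hmeas : Measurable fun ξ => stochGrad F i ξ y - gradient (localObj F D i) y :=
    ((hF.measurable_stochGrad i).comp (measurable_const.prodMk measurable_id)).sub_const _
  have hsub : eLpNorm (fun ξ => stochGrad F i ξ y - gradient (localObj F D i) y) 2 (D i) ≤
      ENNReal.ofReal |σ| := by
    rw [← ENNReal.pow_le_pow_left_iff two_ne_zero, eLpNorm_two_sq,
      ← ENNReal.ofReal_pow (abs_nonneg σ), sq_abs]
    exact hF.variance i y
  calc eLpNorm (fun ξ => stochGrad F i ξ y) 2 (D i)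
      = eLpNorm ((fun ξ => stochGrad F i ξ y - gradient (localObj F D i) y) +
          fun _ => gradient (localObj F D i) y) 2 (D i) := by
        congr 1
        funext ξ
        exact (sub_add_cancel _ _).symm
    _ ≤ ENNReal.ofReal |σ| + eLpNorm (fun _ => gradient (localObj F D i) y) 2 (D i) :=
        (eLpNorm_add_le hmeas.aestronglyMeasurable aestronglyMeasurable_const (by norm_num)).trans
          (by gcongr)
    _ = _ := by rw [eLpNorm_const _ two_ne_zero (IsProbabilityMeasure.ne_zero _)]; simp

theorem ObjectiveAssumption.integral_stochGrad [∀ i, IsProbabilityMeasure (D i)]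
    (hF : ObjectiveAssumption F D x₀ Δ L σ) (i : Fin N) (x : Vec d) :
    ∫ ξ, stochGrad F i ξ x ∂(D i) = gradient (localObj F D i) x := by
  have hcont : Continuous fun y => ‖gradient (localObj F D i) y‖₊ :=
    (continuous_of_norm_sub_le (hF.smooth i)).nnnorm
  refine integral_gradient_eq_gradient_integral
    (K := ENNReal.ofReal |σ| + (‖gradient (localObj F D i) x‖₊ + 1 : NNReal)) (hF.measurable i)
    (hF.differentiable i) (hF.integrable i) (hF.smooth_differentiable i x) (by simp) ?_
  filter_upwards [hcont.continuousAt.eventually_lt continuousAt_const (lt_add_one _)] with y hy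
  refine (hF.eLpNorm_stochGrad_le i y).trans ?_
  gcongr
  exact ENNReal.coe_le_coe.2 hy.le

theorem gradOracle_stochGrad [∀ i, IsProbabilityMeasure (D i)]
    (hF : ObjectiveAssumption F D x₀ Δ L σ) (hL : L ≤ L') :
    GradOracle (stochGrad F) (fun i => gradient (localObj F D i)) D L' σ where
  measurable := hF.measurable_stochGrad
  integral_eq := hF.integral_stochGrad
  variance := hF.variance
  lipschitz i x y := (hF.smooth i x y).trans (by gcongr)

theorem hasGradientAt_globalObj (hF : ObjectiveAssumption F D x₀ Δ L σ) (x : Vec d) :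
    HasGradientAt (globalObj F D) (meanGrad (fun i => gradient (localObj F D i)) x) x := by
  have hsum := (HasFDerivAt.fun_sum (u := univ) fun i _ =>
    (hF.smooth_differentiable i x).hasGradientAt.hasFDerivAt).const_mul (1 / (N : ℝ))
  rw [hasGradientAt_iff_hasFDerivAt]
  refine hsum.congr_fderiv ?_
  simp [meanGrad]

theorem differentiable_globalObj (hF : ObjectiveAssumption F D x₀ Δ L σ) :
    Differentiable ℝ (globalObj F D) :=
  fun x => (hasGradientAt_globalObj hF x).differentiableAt

theorem gradient_globalObj (hF : ObjectiveAssumption F D x₀ Δ L σ) :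
    gradient (globalObj F D) = meanGrad (fun i => gradient (localObj F D i)) :=
  gradient_eq (hasGradientAt_globalObj hF)

theorem abs_globalObj_sub_le (hF : ObjectiveAssumption F D x₀ Δ L σ) (hL0 : 0 ≤ L) (hL : L ≤ L')
    (x y : Vec d) :
    |globalObj F D y - globalObj F D x -
      ⟪meanGrad (fun i => gradient (localObj F D i)) x, y - x⟫_ℝ| ≤ L' * ‖y - x‖ ^ 2 := by
  have hsmooth := abs_sub_sub_inner_gradient_le (differentiable_globalObj hF) (L := L)
    (by rw [gradient_globalObj hF]; exact norm_meanGrad_sub_le hL0 hF.smooth) hL0 x y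
  rw [gradient_globalObj hF] at hsmooth
  exact hsmooth.trans (by gcongr)

end Objective

/-! ### A uniformly distributed index -/

section Uniform

variable {Ω α : Type*} [MeasurableSpace Ω] [MeasurableSpace α]

theorem prod_finsetSum_dirac (μ : Measure Ω) [SFinite μ] (s : Finset α) :
    μ.prod (∑ a ∈ s, Measure.dirac a) = ∑ a ∈ s, μ.map fun ω => (ω, a) := by
  classical
  induction s using Finset.induction_on with
  | empty => simp
  | insert a s ha ih =>
    rw [Finset.sum_insert ha, Finset.sum_insert ha, Measure.prod_add, ih, Measure.prod_dirac]

variable [MeasurableSingletonClass α]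

theorem uniformOn_coe_finset (s : Finset α) :
    uniformOn (s : Set α) = (#s : ℝ≥0∞)⁻¹ • ∑ a ∈ s, Measure.dirac a := by
  classical
  have hrestrict : (Measure.count : Measure α).restrict s = ∑ a ∈ s, Measure.dirac a := by
    induction s using Finset.induction_on with
    | empty => simp
    | insert a s ha ih =>
      rw [Finset.sum_insert ha, Finset.coe_insert, Set.insert_eq,
        Measure.restrict_union (by simpa using ha) s.measurableSet, ih, Measure.restrict_singleton]
      simp
  rw [uniformOn, ProbabilityTheory.cond, hrestrict, Measure.count_apply_finset]

variable {μ : Measure Ω} [SFinite μ] {s : Finset α} {f : Ω × α → ℝ}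

theorem integrable_prod_uniformOn (hs : s.Nonempty)
    (hf : ∀ a ∈ s, Integrable (fun ω => f (ω, a)) μ) :
    Integrable f (μ.prod (uniformOn s)) := by
  rw [uniformOn_coe_finset, Measure.prod_smul_right, prod_finsetSum_dirac]
  refine Integrable.smul_measure (integrable_finsetSum_measure.2 fun a ha =>
    (measurableEmbedding_prod_mk_right a).integrable_map_iff.2 (hf a ha)) ?_
  simpa using hs.ne_empty

theorem integral_prod_uniformOn (hf : ∀ a ∈ s, Integrable (fun ω => f (ω, a)) μ) :
    ∫ p, f p ∂(μ.prod (uniformOn s)) = (#s : ℝ)⁻¹ * ∑ a ∈ s, ∫ ω, f (ω, a) ∂μ := by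
  rw [uniformOn_coe_finset, Measure.prod_smul_right, prod_finsetSum_dirac, integral_smul_measure,
    integral_finsetSum_measure fun a ha =>
      (measurableEmbedding_prod_mk_right a).integrable_map_iff.2 (hf a ha)]
  simp only [(measurableEmbedding_prod_mk_right _).integral_map, ENNReal.toReal_inv,
    ENNReal.toReal_natCast, smul_eq_mul]

end Uniform

theorem outputBound_of_sum_le {Ω Ξ : Type*} [MeasurableSpace Ω] [MeasurableSpace Ξ] {μ : Measure Ω}
    [SFinite μ] {N d : ℕ} {F : Fin N → Vec d → Ξ → ℝ} {D : Fin N → Measure Ξ}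
    {x₀ : Vec d} {η γ : ℝ} {P R I B : ℕ} {q : Ω → ℕ → Fin N → ℝ} {ξ₀ : Ω → ℕ → Fin N → Ξ}
    {ξ : Ω → ℕ → ℕ → Fin N → Ξ} {b : ℝ} (hM : 1 ≤ R / P)
    (hint : ∀ m ∈ range (R / P), Integrable (fun ω => ‖gradient (globalObj F D)
      (ampScaffold F x₀ η γ P I B q ξ₀ ξ m ω)‖ ^ 2) μ)
    (hb : ∑ m ∈ range (R / P), ∫ ω, ‖gradient (globalObj F D)
      (ampScaffold F x₀ η γ P I B q ξ₀ ξ m ω)‖ ^ 2 ∂μ ≤ (R / P : ℕ) * b) :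
    OutputBound μ F D x₀ η γ P R I B q ξ₀ ξ b := by
  unfold OutputBound
  rw [← Finset.coe_range, integral_prod_uniformOn hint, Finset.card_range,
    inv_mul_le_iff₀ (by exact_mod_cast hM)]
  exact ⟨integrable_prod_uniformOn (Finset.nonempty_range_iff.2 (by lia)) hint, hb⟩

/-! ### Conditioning on the weights -/

section Conditioning

variable {Ω W Z : Type*} [MeasurableSpace Ω] [MeasurableSpace W] [MeasurableSpace Z]
  {μ : Measure Ω} [IsProbabilityMeasure μ] {π : Measure Z} [SFinite π] {X : Ω → W} {Y : Ω → Z}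
  (hXY : MeasurePreserving (fun ω => (X ω, Y ω)) μ ((μ.map X).prod π))
include hXY

theorem integrable_prod_of_ae_integral_le {ψ : W × Z → ℝ} (hψ : Measurable ψ)
    (hψ0 : ∀ p, 0 ≤ ψ p) (hint : ∀ w, Integrable (fun z => ψ (w, z)) π) {b : ℝ}
    (hb : ∀ᵐ ω ∂μ, ∫ z, ψ (X ω, z) ∂π ≤ b) : Integrable ψ ((μ.map X).prod π) := by
  have hX : Measurable X := hXY.measurable.fst
  have hmeas : Measurable fun w => ∫ z, ψ (w, z) ∂π :=
    hψ.stronglyMeasurable.integral_prod_right'.measurable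
  have : IsProbabilityMeasure (μ.map X) := Measure.isProbabilityMeasure_map hX.aemeasurable
  refine (integrable_prod_iff hψ.aestronglyMeasurable).2 ⟨.of_forall hint, ?_⟩
  simp only [Real.norm_of_nonneg (hψ0 _)]
  refine Integrable.of_bound hmeas.aestronglyMeasurable b
    ((ae_map_iff hX.aemeasurable (measurableSet_le hmeas.norm measurable_const)).2 ?_)
  filter_upwards [hb] with ω hω
  rwa [Real.norm_of_nonneg (integral_nonneg fun z => hψ0 _)]

variable {ι : Type*} {s : Finset ι} {ψ : ι → W × Z → ℝ} (hψ : ∀ i, Measurable (ψ i))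
  (hψ0 : ∀ i p, 0 ≤ ψ i p) (hint : ∀ i ∈ s, ∀ w, Integrable (fun z => ψ i (w, z)) π) {b : ℝ}
  (hb : ∀ᵐ ω ∂μ, ∑ i ∈ s, ∫ z, ψ i (X ω, z) ∂π ≤ b)
include hψ hψ0 hint hb

theorem integrable_prod_of_ae_sum_integral_le {i : ι} (hi : i ∈ s) :
    Integrable (ψ i) ((μ.map X).prod π) := by
  refine integrable_prod_of_ae_integral_le hXY (hψ i) (hψ0 i) (hint i hi) (b := b) ?_
  filter_upwards [hb] with ω hω
  exact (Finset.single_le_sum (f := fun i => ∫ z, ψ i (X ω, z) ∂π)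
    (fun j _ => integral_nonneg fun z => hψ0 j _) hi).trans hω

theorem sum_integral_comp_le : ∑ i ∈ s, ∫ ω, ψ i (X ω, Y ω) ∂μ ≤ b := by
  have hX : Measurable X := hXY.measurable.fst
  have hintegrable := fun i (hi : i ∈ s) =>
    integrable_prod_of_ae_sum_integral_le hXY hψ hψ0 hint hb hi
  have hsection : ∀ i ∈ s, Integrable (fun ω => ∫ z, ψ i (X ω, z) ∂π) μ := fun i hi =>
    (hintegrable i hi).integral_prod_left.comp_measurable hX
  have : IsProbabilityMeasure (μ.map X) := Measure.isProbabilityMeasure_map hX.aemeasurable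
  calc ∑ i ∈ s, ∫ ω, ψ i (X ω, Y ω) ∂μ
      = ∑ i ∈ s, ∫ ω, ∫ z, ψ i (X ω, z) ∂π ∂μ := Finset.sum_congr rfl fun i hi => by
        rw [← integral_map (φ := fun ω => (X ω, Y ω)) hXY.aemeasurable
          (hψ i).aestronglyMeasurable, hXY.map_eq, integral_prod _ (hintegrable i hi),
          integral_map hX.aemeasurable
            (hψ i).stronglyMeasurable.integral_prod_right'.aestronglyMeasurable]
    _ = ∫ ω, ∑ i ∈ s, ∫ z, ψ i (X ω, z) ∂π ∂μ := (integral_finsetSum _ hsection).symm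
    _ ≤ ∫ _ω, b ∂μ := integral_mono_ae (integrable_finsetSum _ hsection) (integrable_const b) hb
    _ = b := by simp

end Conditioning

theorem mul_add_lt_of_lt_div {P R m j : ℕ} (hm : m < R / P) (hj : j < P) : m * P + j < R :=
  calc m * P + j < m * P + P := by lia
    _ = (m + 1) * P := by ring
    _ ≤ R / P * P := Nat.mul_le_mul_right P hm
    _ ≤ R := Nat.div_mul_le_self R P

theorem RegularWindow.congr {N P r₀ : ℕ} {ρ : ℝ} {q q' : ℕ → Fin N → ℝ}
    (h : RegularWindow P ρ q r₀) (hq : ∀ r, r₀ ≤ r → r < r₀ + P → q r = q' r) :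
    RegularWindow P ρ q' r₀ where
  nonneg j hj := by simpa only [hq (r₀ + j) (by lia) (by lia)] using h.nonneg j hj
  sum_eq_one j hj := by simpa only [hq (r₀ + j) (by lia) (by lia)] using h.sum_eq_one j hj
  sum_sq_le j hj := by simpa only [hq (r₀ + j) (by lia) (by lia)] using h.sum_sq_le j hj
  qBar_eq := by simpa only [qBar_congr hq] using h.qBar_eq

/-- Extends weights of the rounds before `R` by zero to all rounds. -/
def extendWeights {N R : ℕ} (w : Fin R → Fin N → ℝ) (r : ℕ) (i : Fin N) : ℝ :=
  if h : r < R then w ⟨r, h⟩ i else 0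

theorem measurable_extendWeights {N R : ℕ} (r : ℕ) (i : Fin N) :
    Measurable fun w : Fin R → Fin N → ℝ => extendWeights w r i := by
  unfold extendWeights
  split_ifs <;> fun_prop

theorem extendWeights_restrict {N R r : ℕ} (q : ℕ → Fin N → ℝ) (hr : r < R) :
    extendWeights (fun r : Fin R => q r) r = q r := by
  funext i
  simp [extendWeights, hr]

section Weights

variable {Ω : Type*} [MeasurableSpace Ω] {μ : Measure Ω} {N P R : ℕ} {ρ : ℝ}
  {q : Ω → ℕ → Fin N → ℝ}

theorem WeightAssumption.measurable_restrict (hW : WeightAssumption μ R ρ q) :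
    Measurable fun ω (r : Fin R) (i : Fin N) => q ω r i :=
  measurable_pi_lambda _ fun r => measurable_pi_lambda _ fun i => hW.measurable r r.2 i

theorem WeightAssumption.numClients_pos [NeZero μ] (hW : WeightAssumption μ R ρ q) (hR : 0 < R) :
    0 < N := by
  rcases Nat.eq_zero_or_pos N with rfl | hN
  · obtain ⟨ω, hω⟩ := (hW.sum_eq_one 0 hR).exists
    simp at hω
  · exact hN

theorem ae_regularWindow (hW : WeightAssumption μ R ρ q) (hreg : IsRegularized μ P R q) :
    ∀ᵐ ω ∂μ, ∀ m < R / P, RegularWindow P ρ (q ω) (m * P) := by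
  simp only [ae_all_iff]
  intro m hm
  have hweights : ∀ᵐ ω ∂μ, ∀ r < R,
      (∀ i, 0 ≤ q ω r i) ∧ ∑ i, q ω r i = 1 ∧ ∑ i, q ω r i ^ 2 ≤ ρ ^ 2 := by
    simp only [ae_all_iff]
    intro r hr
    filter_upwards [ae_all_iff.2 (hW.nonneg r hr), hW.sum_eq_one r hr, hW.sum_sq_le r hr]
      with ω h_nonneg hsum hsq using ⟨h_nonneg, hsum, hsq⟩
  filter_upwards [hweights, ae_all_iff.2 (hreg m hm)] with ω hω hqBar
  have hround := fun j (hj : j < P) => hω _ (mul_add_lt_of_lt_div hm hj)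
  exact ⟨fun j hj => (hround j hj).1, fun j hj => (hround j hj).2.1,
    fun j hj => (hround j hj).2.2, hqBar⟩

theorem ae_regularWindow_extendWeights (hW : WeightAssumption μ R ρ q)
    (hreg : IsRegularized μ P R q) :
    ∀ᵐ ω ∂μ, ∀ m < R / P, RegularWindow P ρ (extendWeights fun r : Fin R => q ω r) (m * P) := by
  filter_upwards [ae_regularWindow hW hreg] with ω hω m hm
  refine (hω m hm).congr fun r hr hr' => (extendWeights_restrict (q ω) ?_).symm
  obtain ⟨j, rfl⟩ := Nat.exists_eq_add_of_le hr
  exact mul_add_lt_of_lt_div hm (by lia)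

end Weights

section ModelOf

variable {Ω Ξ : Type*} {N d : ℕ} {F : Fin N → Vec d → Ξ → ℝ} {x₀ : Vec d} {η γ : ℝ}
  {P R I B : ℕ} {q : Ω → ℕ → Fin N → ℝ} {ξ₀ : Ω → ℕ → Fin N → Ξ} {ξ : Ω → ℕ → ℕ → Fin N → Ξ}

/-- The model at round `mP` as a function of the weights and the samples. -/
def modelOf (F : Fin N → Vec d → Ξ → ℝ) (x₀ : Vec d) (η γ : ℝ) (P : ℕ) (c : Ξ) (m : ℕ)
    (p : (Fin R → Fin N → ℝ) × (SampleIdx N B R I → Ξ)) : Vec d :=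
  (serverState η γ P I (sampleGrad (stochGrad F) (roundSample c p.2)) (extendWeights p.1)
    (initState F x₀ B (initSample c p.2)) m).model

theorem initState_eq_initState_initSample (c : Ξ) (ω : Ω) :
    initState F x₀ B (ξ₀ ω) =
      initState F x₀ B (initSample c fun s => sample B R I ξ₀ ξ s ω) := by
  unfold initState
  congr 1
  funext i
  congr 1
  refine Finset.sum_congr rfl fun b hb => ?_
  simp [initSample, Finset.mem_range.1 hb, sample]

theorem ampScaffold_eq_modelOf (c : Ξ) {m : ℕ} (hm : m * P ≤ R) (ω : Ω) :
    ampScaffold F x₀ η γ P I B q ξ₀ ξ m ω = modelOf (R := R) F x₀ η γ P c m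
      (fun r i => q ω r i, fun s => sample B R I ξ₀ ξ s ω) := by
  unfold ampScaffold modelOf
  rw [← initState_eq_initState_initSample]
  congr 1
  refine serverState_congr (fun i r hr k hk => ?_) fun r hr =>
    (extendWeights_restrict (q ω) (hr.trans_le hm)).symm
  funext x
  simp [sampleGrad, roundSample, hr.trans_le hm, hk, sample]

end ModelOf

section Reduction

variable {Ω Ξ : Type*} [MeasurableSpace Ω] [MeasurableSpace Ξ] {μ : Measure Ω} {N d : ℕ}
  {F : Fin N → Vec d → Ξ → ℝ} {D : Fin N → Measure Ξ} {x₀ : Vec d} {η γ ρ : ℝ} {P R I B : ℕ}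
  {q : Ω → ℕ → Fin N → ℝ} {ξ₀ : Ω → ℕ → Fin N → Ξ} {ξ : Ω → ℕ → ℕ → Fin N → Ξ}

theorem SampleAssumption.measurePreserving_sample (hS : SampleAssumption μ B R I D q ξ₀ ξ)
    (s : SampleIdx N B R I) : MeasurePreserving (sample B R I ξ₀ ξ s) μ (D s.client) := by
  rcases s with ⟨b, i⟩ | ⟨r, k, i⟩
  · exact hS.law_init b b.2 i
  · exact hS.law r r.2 k k.2 i

theorem SampleAssumption.isProbabilityMeasure [IsProbabilityMeasure μ]
    (hS : SampleAssumption μ B R I D q ξ₀ ξ) (hR : 0 < R) (hI : 0 < I) (i : Fin N) :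
    IsProbabilityMeasure (D i) :=
  (hS.law 0 hR 0 hI i).map_eq ▸
    Measure.isProbabilityMeasure_map (hS.law 0 hR 0 hI i).aemeasurable

theorem measurePreserving_weights_samples [IsProbabilityMeasure μ]
    (hW : WeightAssumption μ R ρ q) (hS : SampleAssumption μ B R I D q ξ₀ ξ) :
    MeasurePreserving
      (fun ω => (fun (r : Fin R) (i : Fin N) => q ω r i, fun s => sample B R I ξ₀ ξ s ω)) μ
      ((μ.map fun ω (r : Fin R) (i : Fin N) => q ω r i).prod (sampleLaw D B R I)) := by
  have hweights := hW.measurable_restrict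
  have hsample := fun s => (hS.measurePreserving_sample s).measurable
  have hsamples : Measurable fun ω s => sample B R I ξ₀ ξ s ω := measurable_pi_lambda _ hsample
  refine ⟨hweights.prodMk hsamples, ?_⟩
  rw [(indepFun_iff_map_prod_eq_prod_map_map hweights.aemeasurable hsamples.aemeasurable).1
      hS.indep_weights,
    (iIndepFun_iff_map_fun_eq_pi_map fun s => (hsample s).aemeasurable).1 hS.indep]
  simp only [(hS.measurePreserving_sample _).map_eq, sampleLaw]

variable {h : Fin N → Vec d → Vec d} {L σ : ℝ}

theorem measurable_modelOf (hG : GradOracle (stochGrad F) h D L σ) (c : Ξ) (m : ℕ) :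
    Measurable (modelOf (R := R) (I := I) (B := B) F x₀ η γ P c m) := by
  have hinit := hG.measurableState_initState (B := B) (R := R) (I := I) c x₀
  refine (MeasurableState.serverState
    (g := fun p : (Fin R → Fin N → ℝ) × (SampleIdx N B R I → Ξ) =>
      sampleGrad (stochGrad F) (roundSample c p.2)) (q := fun p => extendWeights p.1)
    (S := fun p => initState F x₀ B (initSample c p.2)) (fun i r k => ?_)
    (fun r i => (measurable_extendWeights r i).comp measurable_fst)
    ⟨hinit.model.comp measurable_snd, fun i => (hinit.control i).comp measurable_snd⟩ m).model
  exact (hG.measurable i).comp (measurable_snd.prodMk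
    ((measurable_roundSample c r k i).comp (measurable_snd.comp measurable_fst)))

variable [∀ i, IsProbabilityMeasure (D i)]

theorem integrable_norm_sq_gradient_modelOf {Δ : ℝ} (hF : ObjectiveAssumption F D x₀ Δ L σ)
    (c : Ξ) {m : ℕ} (hm : m * P ≤ R) (w : Fin R → Fin N → ℝ) :
    Integrable (fun z => ‖gradient (globalObj F D) (modelOf F x₀ η γ P c m (w, z))‖ ^ 2)
      (sampleLaw D B R I) := by
  have hG := gradOracle_stochGrad hF le_rfl
  rw [gradient_globalObj hF]
  have hT := (adaptedState_initState hG c x₀).serverState (η := η) (γ := γ) (q := extendWeights w)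
    hG (resampling_sampleLaw (B := B) (R := R) (I := I) D c) hm
  exact integrable_norm_sq_of_memLp_two (hT.memLp_meanGrad hG.lipschitz)

theorem sum_integral_norm_sq_gradient_modelOf_le {Δ L' ε : ℝ} {M : ℕ} {w : Fin R → Fin N → ℝ}
    (hs : TunedStepSizes η γ P I L' σ ρ ε) (hF : ObjectiveAssumption F D x₀ Δ L σ) (hL0 : 0 ≤ L)
    (hL : L ≤ L') (hB : 0 < B) (hM : 1 ≤ M) (hR : M * P ≤ R)
    (hw : ∀ m < M, RegularWindow P ρ (extendWeights w) (m * P)) (c : Ξ) :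
    ∑ m ∈ range M, ∫ z, ‖gradient (globalObj F D) (modelOf F x₀ η γ P c m (w, z))‖ ^ 2
      ∂(sampleLaw D B R I) ≤ 48 * (Δ * L') + 3 * M * ε ^ 2 := by
  have hG := gradOracle_stochGrad hF hL
  rw [gradient_globalObj hF]
  exact sum_integral_meanGrad_sq_le hs hG (resampling_sampleLaw D c)
    (adaptedState_initState hG c x₀) hM hR hw (differentiable_globalObj hF).continuous.measurable
    (abs_globalObj_sub_le hF hL0 hL) (fun _ => rfl) hF.gap
    (integral_controlError_initState_le hG c x₀ hB)

end Reduction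

theorem outputBound_of_tunedStepSizes {Ω Ξ : Type*} [MeasurableSpace Ω] [MeasurableSpace Ξ]
    {μ : Measure Ω} [IsProbabilityMeasure μ] {N d : ℕ} {F : Fin N → Vec d → Ξ → ℝ}
    {D : Fin N → Measure Ξ} {x₀ : Vec d} {η γ ρ Δ L L' σ ε b : ℝ} {P R I B : ℕ}
    {q : Ω → ℕ → Fin N → ℝ} {ξ₀ : Ω → ℕ → Fin N → Ξ} {ξ : Ω → ℕ → ℕ → Fin N → Ξ}
    (hs : TunedStepSizes η γ P I L' σ ρ ε) (hF : ObjectiveAssumption F D x₀ Δ L σ) (hL0 : 0 ≤ L)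
    (hL : L ≤ L') (hB : 0 < B) (hW : WeightAssumption μ R ρ q) (hreg : IsRegularized μ P R q)
    (hS : SampleAssumption μ B R I D q ξ₀ ξ) (hM : 1 ≤ R / P)
    (hb : 48 * (Δ * L') + 3 * (R / P : ℕ) * ε ^ 2 ≤ (R / P : ℕ) * b) :
    OutputBound μ F D x₀ η γ P R I B q ξ₀ ξ b := by
  have hR : 0 < R := Nat.pos_of_ne_zero fun h => by simp [h] at hM
  have hD := hS.isProbabilityMeasure hR hs.localSteps_pos
  obtain ⟨c⟩ : Nonempty Ξ := (D ⟨0, hW.numClients_pos hR⟩).nonempty_of_neZero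
  set ψ : ℕ → (Fin R → Fin N → ℝ) × (SampleIdx N B R I → Ξ) → ℝ := fun m p =>
    ‖gradient (globalObj F D) (modelOf F x₀ η γ P c m p)‖ ^ 2
  have hψ : ∀ m, Measurable (ψ m) := fun m => by
    have hgrad : Continuous (gradient (globalObj F D)) := by
      rw [gradient_globalObj hF]
      exact continuous_of_norm_sub_le (norm_meanGrad_sub_le hL0 hF.smooth)
    exact (hgrad.measurable.comp
      (measurable_modelOf (gradOracle_stochGrad hF hL) c m)).norm.pow_const 2
  have hle : ∀ m ∈ range (R / P), m * P ≤ R := fun m hm =>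
    (Nat.mul_le_mul_right P (Finset.mem_range.1 hm).le).trans (Nat.div_mul_le_self R P)
  have hXY := measurePreserving_weights_samples hW hS
  have hint : ∀ m ∈ range (R / P), ∀ w, Integrable (fun z => ψ m (w, z)) (sampleLaw D B R I) :=
    fun m hm w => integrable_norm_sq_gradient_modelOf hF c (hle m hm) w
  have hbound : ∀ᵐ ω ∂μ, ∑ m ∈ range (R / P), ∫ z, ψ m (fun r i => q ω r i, z)
      ∂(sampleLaw D B R I) ≤ (R / P : ℕ) * b := by
    filter_upwards [ae_regularWindow_extendWeights hW hreg] with ω hω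
    exact (sum_integral_norm_sq_gradient_modelOf_le hs hF hL0 hL hB hM (Nat.div_mul_le_self R P)
      hω c).trans hb
  have hψ0 : ∀ m p, 0 ≤ ψ m p := fun m p => sq_nonneg _
  have heq : ∀ m ∈ range (R / P), (fun ω => ‖gradient (globalObj F D)
      (ampScaffold F x₀ η γ P I B q ξ₀ ξ m ω)‖ ^ 2) = fun ω => ψ m
        (fun r i => q ω r i, fun s => sample B R I ξ₀ ξ s ω) := fun m hm => by
    funext ω
    rw [ampScaffold_eq_modelOf c (hle m hm)]
  refine outputBound_of_sum_le hM (fun m hm => ?_) ?_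
  · rw [heq m hm]
    exact hXY.integrable_comp_of_integrable
      (integrable_prod_of_ae_sum_integral_le hXY hψ hψ0 hint hbound hm)
  · rw [Finset.sum_congr rfl fun m hm => by rw [heq m hm]]
    exact sum_integral_comp_le hXY hψ hψ0 hint hbound

/-! ### Regularity of regularized participation -/

section Regularity

variable {Ω : Type*} [mΩ : MeasurableSpace Ω] {μ : Measure Ω} {N P R : ℕ} {ρ : ℝ}
  {q : Ω → ℕ → Fin N → ℝ}

theorem pastWeights_le (hW : WeightAssumption μ R ρ q) {m : ℕ} (hm : m < R / P) :
    pastWeights q (m * P) ≤ mΩ := by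
  refine Measurable.comap_le (measurable_pi_lambda _ fun r => measurable_pi_lambda _ fun i =>
    hW.measurable r (r.2.trans_le ?_) i)
  exact (Nat.mul_le_mul_right P hm.le).trans (Nat.div_mul_le_self R P)

theorem condExp_ae_eq_const [IsProbabilityMeasure μ] {m' : MeasurableSpace Ω}
    (hm' : m' ≤ mΩ) {f : Ω → ℝ} {c : ℝ} (hf : f =ᵐ[μ] fun _ => c) :
    μ[f | m'] =ᵐ[μ] fun _ => c := by
  simpa only [condExp_const hm'] using condExp_congr_ae (m := m') hf

theorem RegularWindow.wCoeff_eq {w : ℕ → Fin N → ℝ} {r₀ : ℕ} (hw : RegularWindow P ρ w r₀)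
    (hP : 0 < P) (i : Fin N) : wCoeff P w r₀ i = 1 / (N : ℝ) := by
  have hN : (0 : ℝ) < N := by exact_mod_cast Fin.pos i
  have hsum : ∑ j : Fin N, ∑ s ∈ range P, w (r₀ + s) i * w (r₀ + s) j = P * (1 / N) := by
    rw [Finset.sum_comm, ← sum_weights_of_qBar hP (hw.qBar_eq i)]
    refine Finset.sum_congr rfl fun s hs => ?_
    rw [← Finset.mul_sum, hw.sum_eq_one s (Finset.mem_range.1 hs), mul_one]
  simp only [wCoeff, hw.qBar_eq, one_div_pos.2 hN, if_true]
  rw [← Finset.mul_sum, hsum]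
  field_simp

theorem ae_wCoeff_eq (hP : 0 < P) (hW : WeightAssumption μ R ρ q)
    (hreg : IsRegularized μ P R q) {m : ℕ} (hm : m < R / P) (i : Fin N) :
    (fun ω => wCoeff P (q ω) (m * P) i) =ᵐ[μ] fun _ => 1 / (N : ℝ) := by
  filter_upwards [ae_regularWindow hW hreg] with ω hω
  exact (hω m hm).wCoeff_eq hP i

theorem unbiasedParticipation_of_regularized [IsProbabilityMeasure μ]
    (hW : WeightAssumption μ R ρ q) (hreg : IsRegularized μ P R q) :
    UnbiasedParticipation μ P R q := fun m hm i =>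
  condExp_ae_eq_const (pastWeights_le hW hm) (hreg m hm i)

theorem sampledWithProb_of_regularized [IsProbabilityMeasure μ]
    (hW : WeightAssumption μ R ρ q) (hreg : IsRegularized μ P R q) :
    SampledWithProb μ P R q 1 := by
  intro m hm i
  have hsampled : Set.indicator {ω | 0 < qBar P (q ω) (m * P) i} (fun _ => (1 : ℝ)) =ᵐ[μ]
      fun _ => 1 := by
    filter_upwards [hreg m hm i] with ω hω
    have hN : (0 : ℝ) < N := by exact_mod_cast Fin.pos i
    have hpos : 0 < qBar P (q ω) (m * P) i := by
      rw [hω]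
      positivity
    exact Set.indicator_of_mem (s := {ω | 0 < qBar P (q ω) (m * P) i}) hpos _
  filter_upwards [condExp_ae_eq_const (pastWeights_le hW hm) hsampled] with ω hω
  exact hω.ge

theorem wCondition_of_regularized [IsProbabilityMeasure μ] (hP : 0 < P)
    (hW : WeightAssumption μ R ρ q) (hreg : IsRegularized μ P R q) : WCondition μ P R q := by
  intro m hm i
  have hw := ae_wCoeff_eq hP hW hreg hm i
  have hle : 1 / (N : ℝ) ≤ (P : ℝ) ^ 2 / N := by
    gcongr
    exact one_le_pow₀ (by exact_mod_cast hP)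
  refine ⟨(integrable_const _).congr hw.symm, ?_, ?_⟩
  · rw [integral_congr_ae hw, integral_const, probReal_univ, one_smul]
    exact hle
  · filter_upwards [condExp_ae_eq_const (pastWeights_le hW hm) hw] with ω hω
    exact hω.trans_le hle

theorem vCondition_of_regularized (hreg : IsRegularized μ P R q) : VCondition μ P R ρ q := by
  intro m hm
  have hv : (fun ω => ∑ i, (vCoeff P (q ω) (m * P) i) ^ 2 * lambdaCoeff P (q ω) m i) =ᵐ[μ]
      fun _ => 0 := by
    filter_upwards [ae_all_iff.2 (hreg m hm)] with ω hω
    simp [vCoeff, hω]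
  refine ⟨(integrable_zero _ _ _).congr hv.symm, ?_⟩
  rw [integral_congr_ae hv, integral_zero]
  exact sq_nonneg ρ

end Regularity

/-! ### Parameters -/

theorem natCeil_max_one_pos (x : ℝ) : 0 < ⌈max 1 x⌉₊ :=
  Nat.ceil_pos.2 (zero_lt_one.trans_le (le_max_left 1 x))

theorem le_natCeil_max_one (x : ℝ) : x ≤ ⌈max 1 x⌉₊ :=
  (le_max_right 1 x).trans (Nat.le_ceil _)

theorem natCeil_max_one_le (x : ℝ) : (⌈max 1 x⌉₊ : ℝ) ≤ 2 * max 1 x := by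
  linarith [Nat.ceil_lt_add_one (zero_le_one.trans (le_max_left 1 x)), le_max_left 1 x]

theorem max_one_div_eq {a b : ℝ} (ha : 0 < a) (hab : a ≤ b) : max 1 (b / a) = b / a :=
  max_eq_right ((one_le_div ha).2 hab)

theorem mul_natCeil_max_one_le {C : ℝ} (hC : 2 ≤ C) (P : ℕ) (x : ℝ) :
    ((P * ⌈max 1 x⌉₊ : ℕ) : ℝ) ≤ C * (P * max 1 x) :=
  calc ((P * ⌈max 1 x⌉₊ : ℕ) : ℝ) ≤ P * (2 * max 1 x) := by
        rw [Nat.cast_mul]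
        gcongr
        exact natCeil_max_one_le x
    _ = 2 * (P * max 1 x) := mul_left_comm _ _ _
    _ ≤ C * (P * max 1 x) := by gcongr

theorem mul_natCeil_max_one_mul_natCeil_max_one_le {C : ℝ} (hC : 4 ≤ C) (P : ℕ) (x y : ℝ) :
    ((P * ⌈max 1 x⌉₊ : ℕ) : ℝ) * ⌈max 1 y⌉₊ ≤ C * (P * max 1 x * max 1 y) :=
  calc ((P * ⌈max 1 x⌉₊ : ℕ) : ℝ) * ⌈max 1 y⌉₊
      ≤ 2 * (P * max 1 x) * (2 * max 1 y) := by
        gcongr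
        exacts [mul_natCeil_max_one_le le_rfl P x, natCeil_max_one_le y]
    _ = 4 * (P * max 1 x * max 1 y) := by ring
    _ ≤ C * (P * max 1 x * max 1 y) := by gcongr

theorem exists_tunedStepSizes {P I : ℕ} {L σ ρ ε : ℝ} (hP : 0 < P) (hI : 0 < I) (hL : 0 < L)
    (hσ : 0 ≤ σ) (hε : 0 < ε) (hvar : ρ ^ 2 * σ ^ 2 / (P * ε ^ 2) ≤ I) :
    ∃ η γ : ℝ, 0 < η ∧ 0 < γ ∧ TunedStepSizes η γ P I L σ ρ ε := by
  have hP' : (0 : ℝ) < P := by exact_mod_cast hP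
  have hI' : (0 : ℝ) < I := by exact_mod_cast hI
  -- `t` is the length `η P I L` of a window on the scale of the curvature.
  obtain ⟨t, ht, htε, htσ⟩ : ∃ t : ℝ, 0 < t ∧ 120 * t ≤ 1 ∧ 120 * t * σ ≤ ε := by
    refine ⟨ε / (120 * (ε + σ)), by positivity, ?_, ?_⟩
    all_goals
      field_simp
      nlinarith
  have hη : t / (P * I * L) * P * I * L = t := by field_simp
  refine ⟨t / (P * I * L), 1 / (24 * t), by positivity, by positivity,
    { step_nonneg := by positivity
      smooth_pos := hL
      serverStep_eq := by field_simp
      variance_le := ?_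
      drift_le := ?_
      driftNoise_le := ?_ }⟩
  · rw [div_le_iff₀ (by positivity)] at hvar ⊢
    linarith
  · rw [hη]
    nlinarith
  · rw [hη]
    have hsq : (120 * t * σ) ^ 2 ≤ ε ^ 2 := by gcongr
    linarith [show 0 ≤ t ^ 2 * σ ^ 2 by positivity]

-- Adding `ε² / (Δ + 1)` makes the smoothness constant positive at a cost of at most `ε²` in `Δ L`.
theorem descentBudget_le {Δ L ε M : ℝ} (hΔ : 0 ≤ Δ) (hε : 0 < ε) (hM : 1 ≤ M)
    (hΔL : Δ * L / ε ^ 2 ≤ M) :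
    48 * (Δ * (L + ε ^ 2 / (Δ + 1))) + 3 * M * ε ^ 2 ≤ M * (100 * ε ^ 2) := by
  have hgap : Δ * L ≤ M * ε ^ 2 := (div_le_iff₀ (by positivity)).1 hΔL
  have hextra : Δ * (ε ^ 2 / (Δ + 1)) ≤ 1 * ε ^ 2 := by
    rw [mul_div_assoc', div_le_iff₀ (by positivity)]
    linarith [sq_nonneg ε]
  have hM' : 1 * ε ^ 2 ≤ M * ε ^ 2 := by gcongr
  rw [mul_add]
  linarith [sq_nonneg ε]

theorem outputBound_of_regularized {Ω Ξ : Type*} [MeasurableSpace Ω] [MeasurableSpace Ξ]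
    {μ : Measure Ω} [IsProbabilityMeasure μ] {N d : ℕ} {F : Fin N → Vec d → Ξ → ℝ}
    {D : Fin N → Measure Ξ} {x₀ : Vec d} {η γ ρ Δ L σ ε : ℝ} {P M I B : ℕ}
    {q : Ω → ℕ → Fin N → ℝ} {ξ₀ : Ω → ℕ → Fin N → Ξ} {ξ : Ω → ℕ → ℕ → Fin N → Ξ} (hP : 0 < P)
    (hΔ : 0 ≤ Δ) (hL : 0 ≤ L) (hε : 0 < ε) (hM : 1 ≤ M) (hΔL : Δ * L / ε ^ 2 ≤ M)
    (hs : TunedStepSizes η γ P I (L + ε ^ 2 / (Δ + 1)) σ ρ ε) (hB : 0 < B)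
    (hF : ObjectiveAssumption F D x₀ Δ L σ) (hW : WeightAssumption μ (P * M) ρ q)
    (hreg : IsRegularized μ P (P * M) q) (hS : SampleAssumption μ B (P * M) I D q ξ₀ ξ) :
    OutputBound μ F D x₀ η γ P (P * M) I B q ξ₀ ξ (100 * ε ^ 2) := by
  have hdiv : P * M / P = M := Nat.mul_div_cancel_left M hP
  refine outputBound_of_tunedStepSizes hs hF hL (le_add_of_nonneg_right (by positivity)) hB hW
    hreg hS (by rwa [hdiv]) ?_
  rw [hdiv]
  exact descentBudget_le hΔ hε (by exact_mod_cast hM) hΔL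

end

end AmpScaffold

theorem mainTheorem3 :
    (∀ {Ω : Type*} [MeasurableSpace Ω] (μ : Measure Ω) [IsProbabilityMeasure μ]
        (N P R : ℕ) (ρ : ℝ) (q : Ω → ℕ → Fin N → ℝ),
        1 ≤ P → P ∣ R →
        AmpScaffold.WeightAssumption μ R ρ q →
        AmpScaffold.IsRegularized μ P R q →
        AmpScaffold.UnbiasedParticipation μ P R q ∧
        AmpScaffold.SampledWithProb μ P R q 1 ∧
        AmpScaffold.WCondition μ P R q ∧
        AmpScaffold.VCondition μ P R ρ q) ∧
    (∃ C : ℝ, 0 < C ∧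
      ∀ (P : ℕ) (Δ L σ ρ ε : ℝ), 1 ≤ P → 0 ≤ Δ → 0 ≤ L → 0 ≤ σ → 0 ≤ ρ → 0 < ε →
        ∃ (η γ : ℝ) (I R : ℕ), 0 < η ∧ 0 < γ ∧ 1 ≤ I ∧ 1 ≤ R ∧ P ∣ R ∧
          (R : ℝ) ≤ C * (P * max 1 (Δ * L / ε ^ 2)) ∧
          (R : ℝ) * I ≤
            C * (P * max 1 (Δ * L / ε ^ 2) * max 1 (ρ ^ 2 * σ ^ 2 / (P * ε ^ 2))) ∧
          (ε ^ 2 ≤ Δ * L → (R : ℝ) ≤ C * (Δ * L * P / ε ^ 2)) ∧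
          (ε ^ 2 ≤ Δ * L → P * ε ^ 2 ≤ ρ ^ 2 * σ ^ 2 →
            (R : ℝ) * I ≤ C * (Δ * L * ρ ^ 2 * σ ^ 2 / ε ^ 4)) ∧
          ∀ {Ω Ξ : Type*} [MeasurableSpace Ω] [MeasurableSpace Ξ]
            (μ : Measure Ω) [IsProbabilityMeasure μ] (N d B : ℕ)
            (F : Fin N → AmpScaffold.Vec d → Ξ → ℝ) (D : Fin N → Measure Ξ)
            (x₀ : AmpScaffold.Vec d) (q : Ω → ℕ → Fin N → ℝ)
            (ξ₀ : Ω → ℕ → Fin N → Ξ) (ξ : Ω → ℕ → ℕ → Fin N → Ξ),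
            1 ≤ B →
            AmpScaffold.ObjectiveAssumption F D x₀ Δ L σ →
            AmpScaffold.WeightAssumption μ R ρ q →
            AmpScaffold.IsRegularized μ P R q →
            AmpScaffold.SampleAssumption μ B R I D q ξ₀ ξ →
            AmpScaffold.OutputBound μ F D x₀ η γ P R I B q ξ₀ ξ (C * ε ^ 2)) := by
  refine ⟨fun μ _ N P R ρ q hP _ hW hreg =>
    ⟨AmpScaffold.unbiasedParticipation_of_regularized hW hreg,
      AmpScaffold.sampledWithProb_of_regularized hW hreg,
      AmpScaffold.wCondition_of_regularized hP hW hreg,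
      AmpScaffold.vCondition_of_regularized hreg⟩,
    100, by norm_num, fun P Δ L σ ρ ε hP hΔ hL hσ _ hε => ?_⟩
  have hM := AmpScaffold.natCeil_max_one_pos (Δ * L / ε ^ 2)
  have hI := AmpScaffold.natCeil_max_one_pos (ρ ^ 2 * σ ^ 2 / (P * ε ^ 2))
  obtain ⟨η, γ, hη, hγ, hs⟩ := AmpScaffold.exists_tunedStepSizes (L := L + ε ^ 2 / (Δ + 1)) hP hI
    (by positivity) hσ hε (AmpScaffold.le_natCeil_max_one _)
  have hR := AmpScaffold.mul_natCeil_max_one_le (C := 100) (by norm_num) P (Δ * L / ε ^ 2)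
  have hRI := AmpScaffold.mul_natCeil_max_one_mul_natCeil_max_one_le (C := 100) (by norm_num) P
    (Δ * L / ε ^ 2) (ρ ^ 2 * σ ^ 2 / (P * ε ^ 2))
  refine ⟨η, γ, _, _, hη, hγ, hI, Nat.mul_pos hP hM, Nat.dvd_mul_right _ _, hR, hRI,
    fun hΔL => hR.trans_eq ?_, fun hΔL hvar => hRI.trans_eq ?_,
    fun μ _ N d B F D x₀ q ξ₀ ξ hB hF hW hreg hS =>
      AmpScaffold.outputBound_of_regularized hP hΔ hL hε hM (AmpScaffold.le_natCeil_max_one _) hs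
        hB hF hW hreg hS⟩
  · rw [AmpScaffold.max_one_div_eq (by positivity) hΔL]
    ring
  · rw [AmpScaffold.max_one_div_eq (by positivity) hΔL,
      AmpScaffold.max_one_div_eq (by positivity) hvar]
    field_simp
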